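/- Let $d\ge 2$, $p\in(1,\infty)$ and $q\in(\frac d2,\infty)$ with $\frac1p+\frac1q<\frac2{d-1}$. Set $\delta_1:=\frac2{d-1}-\frac1p-\frac1q>0$, $\delta_2:=\frac2d-\frac1q>0$, let $\theta:=p$ if $d=2$ and $\theta:=1+p\delta_1$ if $d\ge3$, and put $\nu:=1-\delta_2(1-\frac1\theta)\in(0,1)$. Let $\mathbb B^d$ be the set of non-oriented nearest-neighbour bonds of $\mathbb Z^d$. For conductances $\omega:\mathbb B^d\to(0,\infty)$ set $(\mathcal L^\omega v)(x):=\sum_{y:\{x,y\}\in\mathbb B^d}\omega(\{x,y\})(v(y)-v(x))$. For $x_0\in\mathbb Z^d$ and $r\ge0$ let $B(x_0,r):=x_0+([-r,r]\cap\mathbb Z)^d$, and for $\sigma\in(0,1]$, $t_0\in\mathbb R$, $\tau>0$ and $n\ge0$ let $Q_\sigma(t_0,x_0,\tau,n):=[t_0-\sigma\tau n^2,t_0]\times B(x_0,\sigma n)$. For a finite $B\subset\mathbb Z^d$ and $F:\mathbb B^d\to\mathbb R$ let $\|F\|_{\underline L^p(B)}:=\bigl(\frac1{N}\sum_{e}|F(e)|^p\bigr)^{1/p}$,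 where the sum runs over the $N$ bonds $e$ with both end-points in $B$. For $Q=I\times B$ let $\|u\|_{L^\infty(Q)}:=\sup_Q|u|$ and $\|u\|_{\underline L^1(Q)}:=\frac1{|I||B|}\int_I\sum_{x\in B}|u(t,x)|\,dt$. Finally set $$\mathcal C(\omega,B,\tau):=\max\Bigl\{1,\ \tau^{\frac12}\Bigl(\|\omega^{-1}\|_{\underline L^q(B)}\bigl(\|\omega\|_{\underline L^p(B)}+\tau^{-1}\bigr)^{2-\nu}\Bigr)^{\frac1{2(1-\nu)}}\Bigr\}.$$ Then there exists a constant $c=c(d,p,q)\in[1,\infty)$ such that the following is true for all $\omega:\mathbb B^d\to(0,\infty)$, $t_0\in\mathbb R$, $x_0\in\mathbb Z^d$, $\tau>0$ and real $n\ge 2^{20}$. Let $u:\mathbb R\times\mathbb Z^d\to\mathbb R$ be positive and subcaloric in $Q_1(t_0,x_0,\tau,n)$, that is, $u>0$, $u$ is differentiable in time (one-sidedly at the ends of the time interval) and $\partial_tu-\mathcal L^\omega u\le0$ in $Q_1(t_0,x_0,\tau,n)$. Then $$\|u\|_{L^\infty(Q_{1/2}(t_0,x_0,\tau,n))}\le c\,\mathcal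 C(\omega,B(x_0,n),\tau)^{\frac{2p}{p-1}}\,\|u\|_{\underline L^1(Q_1(t_0,x_0,\tau,n))}^{1-a}\,\|u\|_{L^\infty(Q_1(t_0,x_0,\tau,n))}^{a},$$ where $a:=\bigl(\tfrac12(1+\tfrac1p)\bigr)^{\hat k}$ and $\hat k:=\lfloor\frac14\log_2(3n)\rfloor$. -/

import Mathlib

noncomputable section

/-- The nearest-neighbour graph on `ℤ^d`: for integer vectors, `|x - y| = 1` in the Euclidean norm
means that the squares of the differences of the coordinates sum up to `1`. -/
def latticeGraph (d : ℕ) : SimpleGraph (Fin d → ℤ) where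
  Adj x y := ∑ i, (x i - y i) ^ 2 = 1
  symm := ⟨fun x y h => by
    rw [← h]
    exact Finset.sum_congr rfl fun i _ => by ring⟩
  loopless := ⟨fun x h => by simp at h⟩

/-- The set `𝔹^d` of non-oriented nearest-neighbour bonds. -/
abbrev Bond (d : ℕ) : Type := (latticeGraph d).edgeSet

open scoped Classical in
/-- `ω(x,y)`: the conductance of the bond `{x,y}`, and `0` if `{x,y}` is not a bond. -/
def conductance {d : ℕ} (ω : Bond d → ℝ) (x y : Fin d → ℤ) : ℝ :=
  if h : s(x, y) ∈ (latticeGraph d).edgeSet then ω ⟨s(x, y), h⟩ else 0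

/-- The operator `(𝓛^ω v)(x) = ∑_{y ∈ ℤ^d} ω(x,y) (v(y) - v(x))`
(a sum with finitely many nonzero terms). -/
def generator {d : ℕ} (ω : Bond d → ℝ) (v : (Fin d → ℤ) → ℝ) (x : Fin d → ℤ) : ℝ :=
  ∑ᶠ y : Fin d → ℤ, conductance ω x y * (v y - v x)

/-- The sum defining the generator has only finitely many nonzero terms. -/
theorem generator_support_finite {d : ℕ} (ω : Bond d → ℝ) (v : (Fin d → ℤ) → ℝ)
    (x : Fin d → ℤ) :
    (Function.support fun y : Fin d → ℤ => conductance ω x y * (v y - v x)).Finite := by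
  refine (Set.finite_Icc (fun i => x i - 1) (fun i => x i + 1)).subset ?_
  intro y hy
  have hadj : ∑ i, (x i - y i) ^ 2 = 1 := by
    by_contra hne
    apply hy
    have : ¬ s(x, y) ∈ (latticeGraph d).edgeSet := by
      rw [SimpleGraph.mem_edgeSet]
      exact hne
    simp [conductance, this]
  have hle : ∀ i, (x i - y i) ^ 2 ≤ 1 := fun i =>
    hadj ▸ Finset.single_le_sum (f := fun i => (x i - y i) ^ 2)
      (fun j _ => sq_nonneg _) (Finset.mem_univ i)
  have habs : ∀ i, |x i - y i| ≤ 1 := fun i => (sq_le_one_iff_abs_le_one _).1 (hle i)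
  refine ⟨fun i => ?_, fun i => ?_⟩
  · have := (abs_le.1 (habs i)).2
    show x i - 1 ≤ y i
    linarith
  · have := (abs_le.1 (habs i)).1
    show y i ≤ x i + 1
    linarith

/-- The lattice ball (cube) `B(y,r) = y + ([-r,r] ∩ ℤ)^d`, for a real radius `r`. -/
def latticeBall {d : ℕ} (y : Fin d → ℤ) (r : ℝ) : Finset (Fin d → ℤ) :=
  Fintype.piFinset fun i => Finset.Icc (y i - ⌊r⌋) (y i + ⌊r⌋)

theorem mem_latticeBall {d : ℕ} (y : Fin d → ℤ) (r : ℝ) (x : Fin d → ℤ) :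
    x ∈ latticeBall y r ↔ ∀ i, |(x i : ℝ) - (y i : ℝ)| ≤ r := by
  simp only [latticeBall, Fintype.mem_piFinset, Finset.mem_Icc]
  refine forall_congr' fun i => ?_
  have h : |(x i : ℝ) - (y i : ℝ)| = ((|x i - y i| : ℤ) : ℝ) := by push_cast; rfl
  rw [h, ← Int.le_floor, abs_le]
  constructor <;> rintro ⟨h1, h2⟩ <;> constructor <;> linarith

open scoped Classical in
/-- The set of all bonds with both end-points in `S`. -/
def bondsIn {d : ℕ} (S : Finset (Fin d → ℤ)) : Finset (Bond d) :=
  S.sym2.subtype fun e => e ∈ (latticeGraph d).edgeSet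

/-- The normalized norm of `F : 𝔹^d → ℝ` in `L^p`, over the bonds inside `S`, for `0 < p < ∞`. -/
def bondAvgNorm {d : ℕ} (p : ℝ) (S : Finset (Fin d → ℤ)) (F : Bond d → ℝ) : ℝ :=
  ((1 / ((bondsIn S).card : ℝ)) * ∑ e ∈ bondsIn S, |F e| ^ p) ^ (1 / p)

/-- `u` is subcaloric in `I × S`, that is `∂_t u - 𝓛^ω u ≤ 0` there. The time derivative is taken
within `I`, so it is one-sided at the end-points of an interval `I`. -/
def IsSubcaloric {d : ℕ} (ω : Bond d → ℝ) (I : Set ℝ) (S : Finset (Fin d → ℤ))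
    (u : ℝ → (Fin d → ℤ) → ℝ) : Prop :=
  ∀ t ∈ I, ∀ x ∈ S, DifferentiableWithinAt ℝ (fun s => u s x) I t ∧
    derivWithin (fun s => u s x) I t - generator ω (u t) x ≤ 0

/-- The time interval `[t₀ - σ τ n², t₀]` of the parabolic cylinder
`Q_σ(t₀,x₀,τ,n) = [t₀ - σ τ n², t₀] × B(x₀, σ n)`. -/
def cylTime (σ t₀ τ n : ℝ) : Set ℝ := Set.Icc (t₀ - σ * τ * n ^ 2) t₀

/-- The spatial part `B(x₀, σ n)` of the parabolic cylinder `Q_σ(t₀,x₀,τ,n)`. -/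
def cylSpace {d : ℕ} (σ : ℝ) (x₀ : Fin d → ℤ) (n : ℝ) : Finset (Fin d → ℤ) :=
  latticeBall x₀ (σ * n)

/-- The supremum norm of `u` over `I × S`. -/
def cylSupNorm {d : ℕ} (I : Set ℝ) (S : Finset (Fin d → ℤ)) (u : ℝ → (Fin d → ℤ) → ℝ) : ℝ :=
  sSup {r : ℝ | ∃ t ∈ I, ∃ x ∈ S, r = |u t x|}

/-- The normalized `L^1` norm of `u` over `I × S`: the average with respect to the product of the
Lebesgue measure on `I` and the counting measure on `S`. -/
def cylAvgL1 {d : ℕ} (I : Set ℝ) (S : Finset (Fin d → ℤ)) (u : ℝ → (Fin d → ℤ) → ℝ) : ℝ :=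
  (1 / (MeasureTheory.volume.real I * (S.card : ℝ))) * ∫ t in I, ∑ x ∈ S, |u t x|

/-- A subcaloric function is bounded on a cylinder, so that the supremum norm is a genuine one. -/
theorem IsSubcaloric.bddAbove {d : ℕ} {ω : Bond d → ℝ} {a b : ℝ} {S : Finset (Fin d → ℤ)}
    {u : ℝ → (Fin d → ℤ) → ℝ} (hu : IsSubcaloric ω (Set.Icc a b) S u) :
    BddAbove {r : ℝ | ∃ t ∈ Set.Icc a b, ∃ x ∈ S, r = |u t x|} := by
  have h : BddAbove (⋃ x ∈ (S : Set (Fin d → ℤ)), (fun t => |u t x|) '' Set.Icc a b) := by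
    rw [(Finset.finite_toSet S).bddAbove_biUnion]
    intro x hx
    exact isCompact_Icc.bddAbove_image
      (fun t ht => (hu t ht x hx).1.continuousWithinAt.abs)
  refine h.mono ?_
  rintro r ⟨t, ht, x, hx, rfl⟩
  simp only [Set.mem_iUnion]
  exact ⟨x, hx, t, ht, rfl⟩

/-- A subcaloric function is integrable on a cylinder, so that the averaged norm is a genuine
one. -/
theorem IsSubcaloric.integrableOn {d : ℕ} {ω : Bond d → ℝ} {a b : ℝ} {S : Finset (Fin d → ℤ)}
    {u : ℝ → (Fin d → ℤ) → ℝ} (hu : IsSubcaloric ω (Set.Icc a b) S u) :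
    MeasureTheory.IntegrableOn (fun t => ∑ x ∈ S, |u t x|) (Set.Icc a b) :=
  ContinuousOn.integrableOn_compact isCompact_Icc <|
    continuousOn_finsetSum S fun x hx t ht => (hu t ht x hx).1.continuousWithinAt.abs

/-- `δ₁ = 2/(d-1) - 1/p - 1/q`. -/
def deltaOne (d : ℕ) (p q : ℝ) : ℝ := 2 / ((d : ℝ) - 1) - 1 / p - 1 / q

/-- `δ₂ = 2/d - 1/q`. -/
def deltaTwo (d : ℕ) (q : ℝ) : ℝ := 2 / (d : ℝ) - 1 / q

/-- `θ = p` if `d = 2` and `θ = 1 + p δ₁` if `d ≥ 3`. -/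
def thetaExp (d : ℕ) (p q : ℝ) : ℝ := if d = 2 then p else 1 + p * deltaOne d p q

/-- `ν = 1 - δ₂ (1 - 1/θ)`. -/
def nuExp (d : ℕ) (p q : ℝ) : ℝ := 1 - deltaTwo d q * (1 - 1 / thetaExp d p q)

/-- The quantity
`𝓒(ω,B,τ) = max {1, τ^(1/2) (‖ω⁻¹‖_{L^q(B)} (‖ω‖_{L^p(B)} + τ⁻¹)^(2-ν))^(1/(2(1-ν)))}`,
with normalized norms. -/
def cylConst {d : ℕ} (p q : ℝ) (ω : Bond d → ℝ) (S : Finset (Fin d → ℤ)) (τ : ℝ) : ℝ :=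
  max 1 (τ ^ (1 / 2 : ℝ) *
    (bondAvgNorm q S (fun e => (ω e)⁻¹) *
      (bondAvgNorm p S ω + τ⁻¹) ^ (2 - nuExp d p q)) ^ (1 / (2 * (1 - nuExp d p q))))

/-- The exponent `(½ (1 + 1/p))^k̂` with `k̂ = ⌊¼ log₂ (3n)⌋`. -/
def smallExp (p n : ℝ) : ℝ := (1 / 2 * (1 + 1 / p)) ^ ⌊1 / 4 * Real.logb 2 (3 * n)⌋₊

end

/-! The proof is a Moser iteration in which only averages of `ω^p` and `ω^(-q)` are available. In
the energy inequality for `u^α` with cutoff `η`, the error is the sum over bonds of `ω |∇η|²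
u^(2α)`. For a fixed cutoff this would call for a Sobolev inequality in dimension `d`. The weaker
condition `1/p + 1/q < 2/(d-1)` suffices because `η` may be adapted to `ω` and `u`. It is a product
of functions of one coordinate, each dropping in equal steps across chosen layers of parallel bonds.
Chebyshev's inequality (`exists_good_indices`) leaves at least half of the layers on which the
crossing weights, the inverse weights, the mass and the energy are all comparable with their means.
On the slices next to such layers, Hölder's inequality and a weighted Sobolev inequality in
dimension `D = d - 1` (`exists_slice_inequality`) bound the error by `mass^λ (energy + mass)^(1-λ)`,
where `1 - λ = 1/θ < 1`; this is `exists_adapted_cutoff`.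

Since the energy enters the right-hand side with a power below one, it can be absorbed by passing
through nested cylinders (`absorb_iterate`). On a lattice the gaps between radii must not become too
small, so only about `¼ log₂ n` scales are used. What remains at the end is a polynomial in `n`
raised to the power `(1-λ)^J`, and this is bounded uniformly in `n`
(`exists_rpow_pow_stepCount_le`).

The resulting bounds on the mass at each time and on the energy, together with the Sobolev
inequality in dimension `d` for functions vanishing at the boundary, give a reverse Hölder
inequality from `u^(2α)` to `u^(2α(1+δ₂))` (`Exponents.exists_gain`). Iterating it finitely often
and bounding one value by the whole sum at the last scale gives a bound of `sup u²` by the mean of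
`u²` (`Exponents.exists_sq_bound`); the loss in `n` is again removed by a small exponent.

Finally, the mean of `u²` is at most `sup u` times the mean of `u`. A second absorption, with
exponent `1/2` and `k̂` steps, leaves the supremum over the full cylinder with exponent `2^(-k̂)`,
which may be enlarged to `a` (`Exponents.exists_sup_bound`). Comparing exponents turns the factor
produced by the iteration into the stated power of `𝓒` (`boundFactor_le_cylConst_rpow`). -/

noncomputable section

/-! ### Cubes, lines in cubes, and a discrete Loomis-Whitney inequality -/

/-- The centred cube of side length `2R+1` in `ℤ^D`. -/
def cube (D : ℕ) (R : ℤ) : Finset (Fin D → ℤ) := Fintype.piFinset fun _ => Finset.Icc (-R) R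

theorem mem_cube {D : ℕ} {R : ℤ} {x : Fin D → ℤ} : x ∈ cube D R ↔ ∀ i, -R ≤ x i ∧ x i ≤ R := by
  simp [cube]

/-- The unit vector in direction `j`. -/
def unitVec {D : ℕ} (j : Fin D) : Fin D → ℤ := Pi.single j 1

/-- Lower end-points of the bonds in direction `j` inside the cube. -/
def cubeEdges (D : ℕ) (R : ℤ) (j : Fin D) : Finset (Fin D → ℤ) := (cube D R).filter fun x => x j < R

theorem mem_cubeEdges {D : ℕ} {R : ℤ} {j : Fin D} {x : Fin D → ℤ} :
    x ∈ cubeEdges D R j ↔ x ∈ cube D R ∧ x j < R := by simp [cubeEdges]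

/-- The discrete Loomis-Whitney type inequality behind the Gagliardo-Nirenberg inequality. -/
theorem sum_rpow_le_of_le_line_sum {D : ℕ} (hD : 2 ≤ D) (R : ℤ) (h f : (Fin D → ℤ) → ℝ)
    (hh : ∀ x ∈ cube D R, 0 ≤ h x) (hf : ∀ x ∈ cube D R, 0 ≤ f x)
    (hle : ∀ x ∈ cube D R, ∀ i, h x ≤ ∑ z ∈ Finset.Icc (-R) R, f (Function.update x i z)) :
    ∑ x ∈ cube D R, h x ^ ((D : ℝ) / (D - 1)) ≤ (∑ x ∈ cube D R, f x) ^ ((D : ℝ) / (D - 1)) := by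
  classical
  have hD' : (2 : ℝ) ≤ D := by exact_mod_cast hD
  have hD1 : (0 : ℝ) < (D : ℝ) - 1 := by linarith
  let f' : (Fin D → ℤ) → ENNReal := fun x => if x ∈ cube D R then ENNReal.ofReal (f x) else 0
  have hconj : Real.HolderConjugate (Fintype.card (Fin D)) ((D : ℝ) / (D - 1)) := by
    rw [Fintype.card_fin, Real.holderConjugate_iff]
    refine ⟨by linarith, ?_⟩
    field_simp
    ring
  -- The power `h^(D/(D-1))` is a product of `D` factors `h^(1/(D-1))`, and each factor is bounded
  -- by a line sum in its own direction. The bound for products of line integrals is applied to the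
  -- counting measure, with `f` extended by zero off the cube.
  have key := MeasureTheory.lintegral_prod_lintegral_pow_le (fun _ : Fin D => (MeasureTheory.Measure.count : MeasureTheory.Measure ℤ))
    hconj (f := f') (measurable_of_countable _)
  have hsing : ∀ x : Fin D → ℤ, (MeasureTheory.Measure.pi fun _ : Fin D => (MeasureTheory.Measure.count : MeasureTheory.Measure ℤ)) {x} = 1 := by
    intro x
    simp [MeasureTheory.Measure.pi_singleton]
  rw [MeasureTheory.lintegral_countable', MeasureTheory.lintegral_countable'] at key
  simp only [hsing, mul_one, Fintype.card_fin] at key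
  have hR : ∑' x, f' x = ENNReal.ofReal (∑ x ∈ cube D R, f x) := by
    rw [tsum_eq_sum (s := cube D R) (fun x hx => by simp [f', hx]), ENNReal.ofReal_sum_of_nonneg hf]
    exact Finset.sum_congr rfl fun x hx => by simp [f', hx]
  rw [hR] at key
  have hL : ENNReal.ofReal (∑ x ∈ cube D R, h x ^ ((D : ℝ) / (D - 1))) ≤
      ENNReal.ofReal (∑ x ∈ cube D R, f x) ^ ((D : ℝ) / (D - 1)) := by
    refine le_trans ?_ key
    refine le_trans ?_ (ENNReal.sum_le_tsum (cube D R))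
    rw [ENNReal.ofReal_sum_of_nonneg (fun x hx => Real.rpow_nonneg (hh x hx) _)]
    refine Finset.sum_le_sum fun x hx => ?_
    have hline : ∀ i : Fin D, ENNReal.ofReal (h x) ^ (1 / ((D : ℝ) - 1)) ≤
        (∫⁻ z, f' (Function.update x i z) ∂MeasureTheory.Measure.count) ^ (1 / ((D : ℝ) - 1)) := by
      intro i
      refine ENNReal.rpow_le_rpow ?_ (by positivity)
      rw [MeasureTheory.lintegral_countable']
      refine le_trans ?_ (ENNReal.sum_le_tsum (Finset.Icc (-R) R))
      have hmem : ∀ z ∈ Finset.Icc (-R) R, Function.update x i z ∈ cube D R := by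
        intro z hz
        rw [mem_cube] at hx ⊢
        intro j
        by_cases hj : j = i
        · subst hj; simpa using Finset.mem_Icc.1 hz
        · simpa [hj] using hx j
      calc ENNReal.ofReal (h x) ≤ ENNReal.ofReal (∑ z ∈ Finset.Icc (-R) R, f (Function.update x i z)) :=
            ENNReal.ofReal_le_ofReal (hle x hx i)
        _ = _ := by
            rw [ENNReal.ofReal_sum_of_nonneg (fun z hz => hf _ (hmem z hz))]
            exact Finset.sum_congr rfl fun z hz => by simp [f', hmem z hz]
    calc ENNReal.ofReal (h x ^ ((D : ℝ) / (D - 1)))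
        = ∏ _i : Fin D, ENNReal.ofReal (h x) ^ (1 / ((D : ℝ) - 1)) := by
          rw [Finset.prod_const, Finset.card_univ, Fintype.card_fin, ← ENNReal.rpow_natCast,
            ← ENNReal.rpow_mul, ENNReal.ofReal_rpow_of_nonneg (hh x hx) (by positivity)]
          congr 2; field_simp
      _ ≤ _ := Finset.prod_le_prod' fun i _ => hline i
  rw [ENNReal.ofReal_rpow_of_nonneg (Finset.sum_nonneg hf) (by positivity)] at hL
  exact (ENNReal.ofReal_le_ofReal_iff (Real.rpow_nonneg (Finset.sum_nonneg hf) _)).1 hL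

/-- Oscillation along an interval is bounded by the total variation. -/
theorem le_sum_abs_sub_add (R : ℤ) (v : ℤ → ℝ) {x y : ℤ} (hx : x ∈ Finset.Icc (-R) R)
    (hy : y ∈ Finset.Icc (-R) R) :
    v x ≤ (∑ z ∈ Finset.Icc (-R) R, if z < R then |v (z + 1) - v z| else 0) + v y := by
  rw [Finset.mem_Icc] at hx hy
  have hnn : ∀ z ∈ Finset.Icc (-R) R, 0 ≤ (if z < R then |v (z + 1) - v z| else 0) := by
    intro z _; split_ifs <;> positivity
  have main : ∀ (n : ℕ) (a : ℤ), -R ≤ a → a + n ≤ R →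
      |v (a + n) - v a| ≤ ∑ z ∈ Finset.Ico a (a + n), |v (z + 1) - v z| := by
    intro n
    induction n with
    | zero => intro a _ _; simp
    | succ n ih =>
      intro a ha han
      push_cast at han ⊢
      have h1 := ih a ha (by linarith)
      have h2 : Finset.Ico a (a + (n + 1)) = insert (a + n) (Finset.Ico a (a + n)) := by
        ext z; simp only [Finset.mem_Ico, Finset.mem_insert]; omega
      rw [h2, Finset.sum_insert (by simp)]
      have h3 : v (a + (n + 1)) - v a = (v (a + n + 1) - v (a + n)) + (v (a + n) - v a) := by
        rw [← add_assoc]; ring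
      rw [h3]
      exact (abs_add_le _ _).trans (add_le_add le_rfl h1)
  have main2 : ∀ a b : ℤ, -R ≤ a → a ≤ b → b ≤ R →
      |v b - v a| ≤ ∑ z ∈ Finset.Icc (-R) R, if z < R then |v (z + 1) - v z| else 0 := by
    intro a b ha hab hb
    obtain ⟨n, rfl⟩ := Int.le.dest hab
    refine (main n a ha hb).trans ?_
    calc ∑ z ∈ Finset.Ico a (a + n), |v (z + 1) - v z|
        = ∑ z ∈ Finset.Ico a (a + n), (if z < R then |v (z + 1) - v z| else 0) := by
          refine Finset.sum_congr rfl fun z hz => ?_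
          rw [Finset.mem_Ico] at hz
          rw [if_pos (by omega)]
      _ ≤ _ := Finset.sum_le_sum_of_subset_of_nonneg (by
            intro z hz; rw [Finset.mem_Ico] at hz; rw [Finset.mem_Icc]; omega) (fun z hz _ => hnn z hz)
  rcases le_total x y with h | h
  · have := (abs_le.1 (main2 x y hx.1 h hy.2)).1; linarith
  · have := (abs_le.1 (main2 y x hy.1 h hx.2)).2; linarith

/-- Average `le_sum_abs_sub_add` over all `2R + 1` reference points: the variation is unchanged and
the reference value becomes the mean. -/
theorem le_sum_abs_sub_add_average {R : ℤ} (hR : 0 ≤ R) (v : ℤ → ℝ) {x : ℤ}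
    (hx : x ∈ Finset.Icc (-R) R) :
    v x ≤ ∑ z ∈ Finset.Icc (-R) R, ((if z < R then |v (z + 1) - v z| else 0) +
      (2 * (R : ℝ) + 1)⁻¹ * v z) := by
  have hcard : ((Finset.Icc (-R) R).card : ℝ) = 2 * R + 1 := by
    rw [Int.card_Icc]
    have : ((R + 1 - -R).toNat : ℤ) = R + 1 - -R := Int.toNat_of_nonneg (by omega)
    have h2 : (((R + 1 - -R).toNat : ℤ) : ℝ) = ((R + 1 - -R : ℤ) : ℝ) := by rw [this]
    push_cast at h2
    rw [h2]; ring
  have hRr : (0 : ℝ) ≤ R := by exact_mod_cast hR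
  have h := Finset.sum_le_sum fun y (hy : y ∈ Finset.Icc (-R) R) => le_sum_abs_sub_add R v hx hy
  rw [Finset.sum_const, nsmul_eq_mul, hcard, Finset.sum_add_distrib, Finset.sum_const, nsmul_eq_mul, hcard] at h
  rw [Finset.sum_add_distrib, ← Finset.mul_sum]
  have hpos : (0 : ℝ) < 2 * R + 1 := by linarith
  rw [← sub_le_iff_le_add', ← sub_nonneg]
  have : 0 ≤ (2 * (R:ℝ) + 1)⁻¹ * (((2 * (R : ℝ) + 1) * ∑ z ∈ Finset.Icc (-R) R, if z < R then |v (z + 1) - v z| else 0)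
      + ∑ z ∈ Finset.Icc (-R) R, v z - (2 * R + 1) * v x) := by
    apply mul_nonneg (by positivity); linarith
  have h2 : (2 * (R:ℝ) + 1)⁻¹ * (2 * R + 1) = 1 := inv_mul_cancel₀ hpos.ne'
  convert this using 1
  rw [mul_sub, mul_add, ← mul_assoc, ← mul_assoc, h2]
  ring
end

/-! ### Hölder's inequality and the discrete `W^{1,1}` embedding -/

noncomputable section

/-- Hölder's inequality with exponents `2q`, `2` and `2q/(q-1)`, as Cauchy-Schwarz followed by
Hölder with `q`. With `X = a^(-1/2)` and `Y = a^(1/2) |∇w|` it separates the inverse weights from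
the energy. -/
theorem sum_mul_mul_le_rpow {ι : Type*} (s : Finset ι) (X Y Z : ι → ℝ) {q : ℝ} (hq : 1 < q)
    (hX : ∀ i ∈ s, 0 ≤ X i) (hY : ∀ i ∈ s, 0 ≤ Y i) (hZ : ∀ i ∈ s, 0 ≤ Z i) :
    ∑ i ∈ s, X i * Y i * Z i ≤ (∑ i ∈ s, X i ^ (2 * q)) ^ (1 / (2 * q)) *
      (∑ i ∈ s, Y i ^ 2) ^ (1 / 2 : ℝ) *
      (∑ i ∈ s, Z i ^ (2 * (q / (q - 1)))) ^ (1 / (2 * (q / (q - 1)))) := by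
  have hq0 : 0 < q := by linarith
  have hq1 : 0 < q - 1 := by linarith
  have hc2 : Real.HolderConjugate 2 2 := Real.HolderConjugate.two_two
  have hcq : Real.HolderConjugate q (q / (q - 1)) := by
    rw [Real.holderConjugate_iff]; refine ⟨hq, ?_⟩; field_simp; ring
  have h1 := Real.inner_le_Lp_mul_Lq_of_nonneg s hc2 hY (g := fun i => X i * Z i)
    (fun i hi => mul_nonneg (hX i hi) (hZ i hi))
  have h2 := Real.inner_le_Lp_mul_Lq_of_nonneg s hcq (f := fun i => X i ^ (2:ℝ)) (g := fun i => Z i ^ (2:ℝ))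
    (fun i hi => Real.rpow_nonneg (hX i hi) _) (fun i hi => Real.rpow_nonneg (hZ i hi) _)
  have e1 : ∀ i ∈ s, (X i ^ (2:ℝ)) ^ q = X i ^ (2 * q) := fun i hi => by rw [← Real.rpow_mul (hX i hi)]
  have e2 : ∀ i ∈ s, (Z i ^ (2:ℝ)) ^ (q / (q - 1)) = Z i ^ (2 * (q / (q - 1))) :=
    fun i hi => by rw [← Real.rpow_mul (hZ i hi)]
  have e3 : ∀ i ∈ s, (X i * Z i) ^ (2:ℝ) = X i ^ (2:ℝ) * Z i ^ (2:ℝ) :=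
    fun i hi => by rw [Real.mul_rpow (hX i hi) (hZ i hi)]
  rw [Finset.sum_congr rfl e1, Finset.sum_congr rfl e2] at h2
  rw [Finset.sum_congr rfl e3] at h1
  have nX : 0 ≤ ∑ i ∈ s, X i ^ (2 * q) := Finset.sum_nonneg fun i hi => Real.rpow_nonneg (hX i hi) _
  have nZ : 0 ≤ ∑ i ∈ s, Z i ^ (2 * (q / (q - 1))) :=
    Finset.sum_nonneg fun i hi => Real.rpow_nonneg (hZ i hi) _
  have nXZ : 0 ≤ ∑ i ∈ s, X i ^ (2:ℝ) * Z i ^ (2:ℝ) := Finset.sum_nonneg fun i hi =>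
    mul_nonneg (Real.rpow_nonneg (hX i hi) _) (Real.rpow_nonneg (hZ i hi) _)
  have nY : 0 ≤ ∑ i ∈ s, Y i ^ 2 := Finset.sum_nonneg fun i hi => by positivity
  have h3 := Real.rpow_le_rpow nXZ h2 (by norm_num : (0:ℝ) ≤ 1 / 2)
  rw [Real.mul_rpow (Real.rpow_nonneg nX _) (Real.rpow_nonneg nZ _), ← Real.rpow_mul nX, ← Real.rpow_mul nZ] at h3
  have e4 : 1 / q * (1 / 2) = 1 / (2 * q) := by field_simp
  have e5 : 1 / (q / (q - 1)) * (1 / 2) = 1 / (2 * (q / (q - 1))) := by field_simp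
  rw [e4, e5] at h3
  calc ∑ i ∈ s, X i * Y i * Z i = ∑ i ∈ s, Y i * (X i * Z i) :=
        Finset.sum_congr rfl fun i _ => by ring
    _ ≤ _ := h1
    _ ≤ (∑ i ∈ s, Y i ^ (2:ℝ)) ^ (1 / 2 : ℝ) * ((∑ i ∈ s, X i ^ (2 * q)) ^ (1 / (2 * q)) *
        (∑ i ∈ s, Z i ^ (2 * (q / (q - 1)))) ^ (1 / (2 * (q / (q - 1))))) :=
        mul_le_mul_of_nonneg_left h3 (by
          apply Real.rpow_nonneg; exact Finset.sum_nonneg fun i hi => Real.rpow_nonneg (hY i hi) _)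
    _ = _ := by
      simp only [Real.rpow_two]; ring

/-- A mean value estimate: Bernoulli's inequality for the quotient of the smaller by the larger
number. -/
theorem abs_rpow_sub_rpow_le {a b s : ℝ} (ha : 0 ≤ a) (hb : 0 ≤ b) (hs : 1 ≤ s) :
    |b ^ s - a ^ s| ≤ s * (|b - a| * (a ^ (s - 1) + b ^ (s - 1))) := by
  have key : ∀ a b : ℝ, 0 ≤ a → a ≤ b → b ^ s - a ^ s ≤ s * ((b - a) * b ^ (s - 1)) := by
    intro a b ha hab
    rcases eq_or_lt_of_le (ha.trans hab) with h0 | hb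
    · have : a = 0 := by linarith
      subst h0; subst this; simp
    have h := one_add_mul_self_le_rpow_one_add (s := a / b - 1) (by
      have : 0 ≤ a / b := div_nonneg ha hb.le
      linarith) hs
    have h1 : 1 + (a / b - 1) = a / b := by ring
    rw [h1, Real.div_rpow ha hb.le] at h
    have hbs : 0 < b ^ s := Real.rpow_pos_of_pos hb s
    have h2 : (1 + s * (a / b - 1)) * b ^ s ≤ a ^ s := by
      rwa [le_div_iff₀ hbs] at h
    have h3 : b ^ s = b * b ^ (s - 1) := by
      rw [Real.rpow_sub_one hb.ne']; field_simp
    have h4 : (a / b - 1) * b ^ s = (a - b) * b ^ (s - 1) := by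
      rw [h3]; field_simp
    have h5 : (1 + s * (a / b - 1)) * b ^ s = b ^ s + s * ((a / b - 1) * b ^ s) := by ring
    rw [h5, h4] at h2
    linarith
  rcases le_total a b with h | h
  · rw [abs_of_nonneg (sub_nonneg.2 (Real.rpow_le_rpow ha h (by linarith))), abs_of_nonneg (sub_nonneg.2 h)]
    refine (key a b ha h).trans ?_
    have : 0 ≤ a ^ (s - 1) := Real.rpow_nonneg ha _
    have h' : 0 ≤ b - a := sub_nonneg.2 h
    gcongr; linarith
  · rw [abs_sub_comm, abs_sub_comm b a,
      abs_of_nonneg (sub_nonneg.2 (Real.rpow_le_rpow hb h (by linarith))), abs_of_nonneg (sub_nonneg.2 h)]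
    refine (key b a hb h).trans ?_
    have : 0 ≤ b ^ (s - 1) := Real.rpow_nonneg hb _
    have h' : 0 ≤ a - b := sub_nonneg.2 h
    gcongr; linarith

theorem update_add_unitVec {D : ℕ} (x : Fin D → ℤ) (i : Fin D) (z : ℤ) :
    Function.update x i (z + 1) = Function.update x i z + unitVec i := by
  ext j
  by_cases hj : j = i
  · subst hj; simp [unitVec]
  · simp [hj, unitVec]

theorem update_mem_cube {D : ℕ} {R : ℤ} {x : Fin D → ℤ} (hx : x ∈ cube D R) (i : Fin D) {z : ℤ}
    (hz : z ∈ Finset.Icc (-R) R) : Function.update x i z ∈ cube D R := by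
  rw [mem_cube] at hx ⊢
  intro j
  by_cases hj : j = i
  · subst hj; simpa using Finset.mem_Icc.1 hz
  · simpa [hj] using hx j

theorem add_unitVec_mem_cube {D : ℕ} {R : ℤ} {x : Fin D → ℤ} {j : Fin D} (hx : x ∈ cubeEdges D R j) :
    x + unitVec j ∈ cube D R := by
  rw [mem_cubeEdges, mem_cube] at hx
  rw [mem_cube]
  intro i
  have := hx.1 i
  by_cases hi : i = j
  · subst hi; have := hx.2; simp [unitVec]; omega
  · simpa [unitVec, hi] using this

/-- The discrete inequality `W^{1,1} ⊂ L^{D/(D-1)}` on a cube. -/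
theorem sum_rpow_le_grad {D : ℕ} (hD : 2 ≤ D) {R : ℤ} (V : (Fin D → ℤ) → ℝ) (κ : ℝ) (hκ : 0 ≤ κ)
    (hV : ∀ x ∈ cube D R, 0 ≤ V x)
    (hle : ∀ x ∈ cube D R, ∀ i, V x ≤ ∑ z ∈ Finset.Icc (-R) R,
      ((if z < R then |V (Function.update x i (z + 1)) - V (Function.update x i z)| else 0) +
        κ * V (Function.update x i z))) :
    ∑ x ∈ cube D R, V x ^ ((D : ℝ) / (D - 1)) ≤
      (∑ j, ∑ x ∈ cubeEdges D R j, |V (x + unitVec j) - V x| + κ * ∑ x ∈ cube D R, V x) ^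
        ((D : ℝ) / (D - 1)) := by
  have h := sum_rpow_le_of_le_line_sum hD R V
    (fun x => ∑ j, (if x j < R then |V (x + unitVec j) - V x| else 0) + κ * V x) hV
    (fun x hx => by
      refine add_nonneg (Finset.sum_nonneg fun j _ => ?_) (mul_nonneg hκ (hV x hx))
      split_ifs <;> positivity)
    (fun x hx i => by
      refine (hle x hx i).trans (Finset.sum_le_sum fun z hz => ?_)
      gcongr
      refine le_trans (le_of_eq ?_) (Finset.single_le_sum (f := fun j =>
        if Function.update x i z j < R then |V (Function.update x i z + unitVec j) - V (Function.update x i z)| else 0)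
        (fun j _ => by split_ifs <;> positivity) (Finset.mem_univ i))
      simp only [Function.update_self, update_add_unitVec])
  convert h using 2
  rw [Finset.sum_add_distrib, Finset.sum_comm, Finset.mul_sum]
  simp only [cubeEdges, Finset.sum_filter]

theorem line_bound_average {D : ℕ} {R : ℤ} (hR : 0 ≤ R) (V : (Fin D → ℤ) → ℝ) :
    ∀ x ∈ cube D R, ∀ i, V x ≤ ∑ z ∈ Finset.Icc (-R) R,
      ((if z < R then |V (Function.update x i (z + 1)) - V (Function.update x i z)| else 0) +
        (2 * (R : ℝ) + 1)⁻¹ * V (Function.update x i z)) := by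
  intro x hx i
  have := le_sum_abs_sub_add_average hR (fun z => V (Function.update x i z)) (x := x i)
    (Finset.mem_Icc.2 (mem_cube.1 hx i))
  simpa using this

/-- Comparing with the end-point `-R` of the line, where `V` vanishes, instead of with the mean
removes the zeroth order term. -/
theorem line_bound_zero {D : ℕ} {R : ℤ} (V : (Fin D → ℤ) → ℝ)
    (h0 : ∀ x ∈ cube D R, ∀ i, x i = -R → V x = 0) :
    ∀ x ∈ cube D R, ∀ i, V x ≤ ∑ z ∈ Finset.Icc (-R) R,
      ((if z < R then |V (Function.update x i (z + 1)) - V (Function.update x i z)| else 0) +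
        0 * V (Function.update x i z)) := by
  intro x hx i
  have hx' := mem_cube.1 hx i
  have hm : -R ∈ Finset.Icc (-R) R := Finset.mem_Icc.2 ⟨le_rfl, by omega⟩
  have := le_sum_abs_sub_add R (fun z => V (Function.update x i z)) (x := x i)
    (Finset.mem_Icc.2 hx') hm
  rw [h0 _ (update_mem_cube hx i hm) i (by simp)] at this
  simpa using this

end

/-! ### The weighted Sobolev inequality -/

noncomputable section

/-- The weighted Dirichlet energy on a cube. -/
def cubeEnergy {D : ℕ} (a : Fin D → (Fin D → ℤ) → ℝ) (R : ℤ) (w : (Fin D → ℤ) → ℝ) : ℝ :=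
  ∑ j, ∑ x ∈ cubeEdges D R j, a j x * (w (x + unitVec j) - w x) ^ 2

/-- The sum of a power of the weights of the bonds in a cube. -/
def weightSum {D : ℕ} (a : Fin D → (Fin D → ℤ) → ℝ) (R : ℤ) (r : ℝ) : ℝ :=
  ∑ j, ∑ x ∈ cubeEdges D R j, a j x ^ r

/-- In each direction a site is the lower end of at most one bond and the upper end of at most one.
-/
theorem sum_edges_le {D : ℕ} {R : ℤ} (F : (Fin D → ℤ) → ℝ) (hF : ∀ x ∈ cube D R, 0 ≤ F x) :
    ∑ j, ∑ x ∈ cubeEdges D R j, (F x + F (x + unitVec j)) ≤ 2 * D * ∑ x ∈ cube D R, F x := by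
  have : ∀ j : Fin D, ∑ x ∈ cubeEdges D R j, (F x + F (x + unitVec j)) ≤ 2 * ∑ x ∈ cube D R, F x := by
    intro j
    rw [Finset.sum_add_distrib, two_mul]
    refine add_le_add (Finset.sum_le_sum_of_subset_of_nonneg (Finset.filter_subset _ _) fun x hx _ => hF x hx) ?_
    rw [← Finset.sum_image (f := F) (g := fun x => x + unitVec j) (fun x _ y _ h => add_right_cancel h)]
    refine Finset.sum_le_sum_of_subset_of_nonneg ?_ fun x hx _ => hF x hx
    intro y hy
    obtain ⟨x, hx, rfl⟩ := Finset.mem_image.1 hy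
    exact add_unitVec_mem_cube hx
  calc _ ≤ ∑ _j : Fin D, 2 * ∑ x ∈ cube D R, F x := Finset.sum_le_sum fun j _ => this j
    _ = _ := by simp; ring

/-- The sum of the gradient of a power, by Hölder's inequality. -/
theorem sum_abs_grad_rpow_le {D : ℕ} {R : ℤ} (a : Fin D → (Fin D → ℤ) → ℝ)
    (ha : ∀ j x, 0 < a j x) (w : (Fin D → ℤ) → ℝ) (hw : ∀ x, 0 ≤ w x) {q s : ℝ} (hq : 1 < q) (hs : 1 < s) :
    ∑ j, ∑ x ∈ cubeEdges D R j, |w (x + unitVec j) ^ s - w x ^ s| ≤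
      s * (weightSum a R (-q) ^ (1 / (2 * q)) * cubeEnergy a R w ^ (1 / 2 : ℝ) *
        (2 ^ (2 * (q / (q - 1))) * (2 * D * ∑ x ∈ cube D R, w x ^ ((s - 1) * (2 * (q / (q - 1)))))) ^
          (1 / (2 * (q / (q - 1))))) := by
  have hq1 : 0 < q - 1 := by linarith
  set b := 2 * (q / (q - 1)) with hb
  have hb0 : 0 < b := by have : 0 < q := by linarith
                         positivity
  -- The factor `a^(-1/2) a^(1/2) = 1` is inserted in preparation for the three-factor Hölder
  -- inequality.
  have h1 : ∑ j, ∑ x ∈ cubeEdges D R j, |w (x + unitVec j) ^ s - w x ^ s| ≤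
      s * ∑ j, ∑ x ∈ cubeEdges D R j, a j x ^ (-(1 / 2) : ℝ) *
        (a j x ^ (1 / 2 : ℝ) * |w (x + unitVec j) - w x|) *
        (w x ^ (s - 1) + w (x + unitVec j) ^ (s - 1)) := by
    rw [Finset.mul_sum]
    refine Finset.sum_le_sum fun j _ => ?_
    rw [Finset.mul_sum]
    refine Finset.sum_le_sum fun x _ => (abs_rpow_sub_rpow_le (hw _) (hw _) hs.le).trans (le_of_eq ?_)
    have : a j x ^ (-(1 / 2) : ℝ) * a j x ^ (1 / 2 : ℝ) = 1 := by
      rw [← Real.rpow_add (ha j x)]; norm_num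
    rw [← mul_assoc (a j x ^ (-(1 / 2) : ℝ)), this, one_mul]
  refine h1.trans (mul_le_mul_of_nonneg_left ?_ (by linarith))
  have h2 := sum_mul_mul_le_rpow (Finset.univ.sigma fun j => cubeEdges D R j)
    (fun e => a e.1 e.2 ^ (-(1 / 2) : ℝ)) (fun e => a e.1 e.2 ^ (1 / 2 : ℝ) * |w (e.2 + unitVec e.1) - w e.2|)
    (fun e => w e.2 ^ (s - 1) + w (e.2 + unitVec e.1) ^ (s - 1)) hq
    (fun e _ => Real.rpow_nonneg (ha _ _).le _)
    (fun e _ => mul_nonneg (Real.rpow_nonneg (ha _ _).le _) (abs_nonneg _))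
    (fun e _ => add_nonneg (Real.rpow_nonneg (hw _) _) (Real.rpow_nonneg (hw _) _))
  simp only [Finset.sum_sigma] at h2
  refine h2.trans ?_
  have e1 : ∀ j x, (a j x ^ (-(1 / 2) : ℝ)) ^ (2 * q) = a j x ^ (-q) := fun j x => by
    rw [← Real.rpow_mul (ha j x).le]; congr 1; ring
  have e2 : ∀ j x, (a j x ^ (1 / 2 : ℝ) * |w (x + unitVec j) - w x|) ^ 2 = a j x * (w (x + unitVec j) - w x) ^ 2 :=
    fun j x => by
      rw [mul_pow, sq_abs, ← Real.rpow_natCast, ← Real.rpow_mul (ha j x).le]; norm_num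
  simp only [e1, e2]
  have hE : 0 ≤ cubeEnergy a R w := Finset.sum_nonneg fun j _ => Finset.sum_nonneg fun x _ =>
    mul_nonneg (ha _ _).le (sq_nonneg _)
  have hQ : 0 ≤ weightSum a R (-q) := Finset.sum_nonneg fun j _ => Finset.sum_nonneg fun x _ =>
    Real.rpow_nonneg (ha _ _).le _
  refine mul_le_mul_of_nonneg_left (Real.rpow_le_rpow ?_ ?_ (by positivity))
    (mul_nonneg (Real.rpow_nonneg hQ _) (Real.rpow_nonneg hE _))
  · exact Finset.sum_nonneg fun j _ => Finset.sum_nonneg fun x _ => Real.rpow_nonneg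
      (add_nonneg (Real.rpow_nonneg (hw _) _) (Real.rpow_nonneg (hw _) _)) _
  · refine le_trans ?_ (mul_le_mul_of_nonneg_left (sum_edges_le (R := R) (fun x => w x ^ ((s - 1) * b))
      (fun x _ => Real.rpow_nonneg (hw _) _)) (Real.rpow_nonneg (by norm_num) _))
    rw [Finset.mul_sum]
    refine Finset.sum_le_sum fun j _ => ?_
    rw [Finset.mul_sum]
    refine Finset.sum_le_sum fun x _ => ?_
    have key : ∀ A B : ℝ, 0 ≤ A → A ≤ B → (A + B) ^ b ≤ 2 ^ b * (A ^ b + B ^ b) := by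
      intro A B hA hAB
      calc (A + B) ^ b ≤ (2 * B) ^ b := Real.rpow_le_rpow (by linarith) (by linarith) hb0.le
        _ = 2 ^ b * B ^ b := Real.mul_rpow (by norm_num) (hA.trans hAB)
        _ ≤ _ := by
          have := Real.rpow_nonneg hA b
          gcongr; linarith
    rw [Real.rpow_mul (hw _), Real.rpow_mul (hw _)]
    rcases le_total (w x ^ (s - 1)) (w (x + unitVec j) ^ (s - 1)) with h | h
    · exact key _ _ (Real.rpow_nonneg (hw _) _) h
    · rw [add_comm, add_comm ((w x ^ (s - 1)) ^ b)]
      exact key _ _ (Real.rpow_nonneg (hw _) _) h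

/-- The zeroth order companion of `sum_abs_grad_rpow_le`. The same Hölder exponents with weight one
produce the same power of the same sum, which `exists_sobolev` can then divide out. -/
theorem sum_rpow_le_sq_mul {D : ℕ} {R : ℤ} (w : (Fin D → ℤ) → ℝ) (hw : ∀ x, 0 ≤ w x) {q s : ℝ}
    (hq : 1 < q) (hs : 1 < s) :
    ∑ x ∈ cube D R, w x ^ s ≤ ((cube D R).card : ℝ) ^ (1 / (2 * q)) *
      (∑ x ∈ cube D R, w x ^ 2) ^ (1 / 2 : ℝ) *
        (∑ x ∈ cube D R, w x ^ ((s - 1) * (2 * (q / (q - 1))))) ^ (1 / (2 * (q / (q - 1)))) := by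
  have h := sum_mul_mul_le_rpow (cube D R) (fun _ => 1) w (fun x => w x ^ (s - 1)) hq
    (fun _ _ => zero_le_one) (fun x _ => hw x) (fun x _ => Real.rpow_nonneg (hw x) _)
  simp only [Real.one_rpow, Finset.sum_const, nsmul_eq_mul, mul_one, one_mul] at h
  have e1 : ∀ x, w x * w x ^ (s - 1) = w x ^ s := fun x => by
    conv_rhs => rw [show s = (s - 1) + 1 by ring, Real.rpow_add_one' (hw x) (by linarith)]
    ring
  simp only [e1, ← Real.rpow_mul (hw _)] at h
  exact h

theorem add_sq_le_of_nonneg (c X κ Y : ℝ) :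
    (c * X + κ * Y) ^ 2 ≤ 2 * (c ^ 2 + 1) * (X ^ 2 + κ ^ 2 * Y ^ 2) := by
  have h1 : (c * X + κ * Y) ^ 2 ≤ 2 * ((c * X) ^ 2 + (κ * Y) ^ 2) := add_sq_le
  have h2 : 0 ≤ X ^ 2 + c ^ 2 * (κ ^ 2 * Y ^ 2) := by positivity
  linear_combination h1 + 2 * h2

/-- The weighted Sobolev inequality on a cube of dimension `D ≥ 2`, with a zeroth order term of
weight `κ` (which may be `0` for functions vanishing at the boundary). -/
theorem exists_sobolev {D : ℕ} (hD : 2 ≤ D) {q : ℝ} (hq : 1 < q) :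
    ∃ C : ℝ, 0 < C ∧ ∀ (R : ℤ) (a : Fin D → (Fin D → ℤ) → ℝ), (∀ j x, 0 < a j x) →
      ∀ w : (Fin D → ℤ) → ℝ, (∀ x, 0 ≤ w x) → ∀ κ : ℝ, 0 ≤ κ →
      (∀ V : (Fin D → ℤ) → ℝ, (∀ x ∈ cube D R, w x = 0 → V x = 0) →
        ∀ x ∈ cube D R, ∀ i, V x ≤ ∑ z ∈ Finset.Icc (-R) R,
      ((if z < R then |V (Function.update x i (z + 1)) - V (Function.update x i z)| else 0) +
        κ * V (Function.update x i z))) →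
      (∑ x ∈ cube D R, w x ^ (2 / (1 + 1 / q - 2 / D))) ^ (1 + 1 / q - 2 / (D : ℝ)) ≤
        C * (weightSum a R (-q) ^ (1 / q) * cubeEnergy a R w +
          κ ^ 2 * ((cube D R).card : ℝ) ^ (1 / q) * ∑ x ∈ cube D R, w x ^ 2) := by
  have hD' : (2 : ℝ) ≤ D := by exact_mod_cast hD
  have hq0 : 0 < q := by linarith
  have hq1 : 0 < q - 1 := by linarith
  set b := 2 * (q / (q - 1)) with hb
  have hb0 : 0 < b := by positivity
  set μ : ℝ := 1 + 1 / q - 2 / D with hμ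
  have hDle : 2 / (D : ℝ) ≤ 1 := by rw [div_le_one (by linarith)]; exact hD'
  have hμ0 : 0 < μ := by have : 0 < 1 / q := by positivity
                         linarith
  -- This `s` makes both `(s-1) b` and `s D/(D-1)` equal to `2/μ`, so that a single sum `S` occurs
  -- on the two sides of the embedding.
  set s : ℝ := (1 - 1 / q) / μ + 1 with hs
  have hqi : 1 / q < 1 := by rw [div_lt_one hq0]; exact hq
  have hs1 : 1 < s := by
    have : 0 < (1 - 1 / q) / μ := div_pos (by linarith) hμ0
    linarith
  have hsb : (s - 1) * b = 2 / μ := by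
    rw [hs, hb]; field_simp; ring
  have hsD : s * ((D : ℝ) / (D - 1)) = 2 / μ := by
    have h1 : (0:ℝ) < D - 1 := by linarith
    have : s = ((D - 1) / D) * (2 / μ) := by
      rw [hs]
      have : (1 - 1 / q) / μ + 1 = ((1 - 1 / q) + μ) / μ := by field_simp
      rw [this, hμ]; field_simp; ring
    rw [this]; field_simp
  set c1 : ℝ := s * (2 ^ b * (2 * D)) ^ (1 / b) with hc1
  have hc10 : 0 ≤ c1 := by positivity
  refine ⟨2 * (c1 ^ 2 + 1), by positivity, ?_⟩
  intro R a ha w hw κ hκ hline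
  have hE : 0 ≤ cubeEnergy a R w := Finset.sum_nonneg fun j _ => Finset.sum_nonneg fun x _ =>
    mul_nonneg (ha _ _).le (sq_nonneg _)
  have hQ : 0 ≤ weightSum a R (-q) := Finset.sum_nonneg fun j _ => Finset.sum_nonneg fun x _ =>
    Real.rpow_nonneg (ha _ _).le _
  set S := ∑ x ∈ cube D R, w x ^ (2 / μ) with hS
  have hS0 : 0 ≤ S := Finset.sum_nonneg fun x _ => Real.rpow_nonneg (hw x) _
  set G := ∑ x ∈ cube D R, w x ^ 2 with hG
  have hG0 : 0 ≤ G := Finset.sum_nonneg fun x _ => sq_nonneg _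
  set Q := weightSum a R (-q)
  set E := cubeEnergy a R w
  set N : ℝ := ((cube D R).card : ℝ)
  have hN : 0 ≤ N := Nat.cast_nonneg _
  rcases hS0.eq_or_lt with h0 | hSpos
  · rw [← h0, Real.zero_rpow hμ0.ne']
    positivity
  -- The line bound is needed for the power `w^s`; hence the hypothesis speaks of every `V` that
  -- vanishes together with `w`.
  have h1 := sum_rpow_le_grad hD (R := R) (fun x => w x ^ s) κ hκ
    (fun x _ => Real.rpow_nonneg (hw x) _)
    (hline (fun x => w x ^ s) (fun x _ h => by rw [h, Real.zero_rpow (by linarith)]))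
  have e0 : ∑ x ∈ cube D R, (w x ^ s) ^ ((D : ℝ) / (D - 1)) = S :=
    Finset.sum_congr rfl fun x _ => by rw [← Real.rpow_mul (hw x), hsD]
  rw [e0] at h1
  have h2 := sum_abs_grad_rpow_le (R := R) a ha w hw hq hs1
  have h3 := sum_rpow_le_sq_mul (R := R) w hw hq hs1
  rw [← hb, hsb] at h2 h3
  change _ ≤ s * (Q ^ (1 / (2 * q)) * E ^ (1 / 2 : ℝ) * (2 ^ b * (2 * D * S)) ^ (1 / b)) at h2
  change _ ≤ N ^ (1 / (2 * q)) * G ^ (1 / 2 : ℝ) * S ^ (1 / b) at h3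
  set T := ∑ j, ∑ x ∈ cubeEdges D R j, |w (x + unitVec j) ^ s - w x ^ s| with hT
  have hT0 : 0 ≤ T := Finset.sum_nonneg fun _ _ => Finset.sum_nonneg fun _ _ => abs_nonneg _
  set P := ∑ x ∈ cube D R, w x ^ s with hP
  have hP0 : 0 ≤ P := Finset.sum_nonneg fun x _ => Real.rpow_nonneg (hw x) _
  have hDD : (0:ℝ) < D / (D - 1) := by
    have : (0:ℝ) < D - 1 := by linarith
    positivity
  have h4 : S ^ (((D:ℝ) - 1) / D) ≤ T + κ * P := by
    have := Real.rpow_le_rpow hS0 h1 (z := ((D:ℝ) - 1) / D) (by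
      have : (0:ℝ) < D - 1 := by linarith
      positivity)
    rwa [← Real.rpow_mul (by positivity), show (D : ℝ) / (D - 1) * ((D - 1) / D) = 1 by
      have : (0:ℝ) < D - 1 := by linarith
      field_simp, Real.rpow_one] at this
  rw [← mul_assoc (2 ^ b), Real.mul_rpow (by positivity) hS0] at h2
  -- The left side is `S^((D-1)/D)`. Dividing by `S^(1/b)`, which is positive here, leaves
  -- `S^(μ/2)`, and squaring gives the claim.
  have h5 : S ^ (μ / 2) * S ^ (1 / b) ≤ (c1 * (Q ^ (1 / (2 * q)) * E ^ (1 / 2 : ℝ)) +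
      κ * (N ^ (1 / (2 * q)) * G ^ (1 / 2 : ℝ))) * S ^ (1 / b) := by
    rw [← Real.rpow_add hSpos]
    have : μ / 2 + 1 / b = ((D:ℝ) - 1) / D := by
      rw [hμ, hb]; field_simp; ring
    rw [this]
    refine h4.trans ((add_le_add h2 (mul_le_mul_of_nonneg_left h3 hκ)).trans (le_of_eq ?_))
    rw [hc1]; ring
  have h6 := le_of_mul_le_mul_right h5 (Real.rpow_pos_of_pos hSpos _)
  have h7 : S ^ μ = (S ^ (μ / 2)) ^ 2 := by
    rw [← Real.rpow_natCast, ← Real.rpow_mul hS0]; congr 1; push_cast; ring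
  have hsq : ∀ A B : ℝ, 0 ≤ A → 0 ≤ B → (A ^ (1 / (2 * q)) * B ^ (1 / 2 : ℝ)) ^ 2 = A ^ (1 / q) * B := by
    intro A B hA hB
    rw [mul_pow, ← Real.rpow_natCast, ← Real.rpow_mul hA, ← Real.rpow_natCast, ← Real.rpow_mul hB]
    congr 1
    · congr 1; push_cast; field_simp
    · norm_num
  have s1 := hsq Q E hQ hE
  have s2 := hsq N G hN hG0
  rw [h7]
  set X := Q ^ (1 / (2 * q)) * E ^ (1 / 2 : ℝ)
  set Y := N ^ (1 / (2 * q)) * G ^ (1 / 2 : ℝ)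
  calc (S ^ (μ / 2)) ^ 2 ≤ (c1 * X + κ * Y) ^ 2 := by gcongr
    _ ≤ 2 * (c1 ^ 2 + 1) * (X ^ 2 + κ ^ 2 * Y ^ 2) := add_sq_le_of_nonneg c1 X κ Y
    _ = _ := by rw [s1, s2]; ring
end

/-! ### Interpolation on the slices -/

noncomputable section

theorem sum_rpow_mul_rpow_le {ι : Type*} (s : Finset ι) (f g : ι → ℝ) {α β : ℝ} (hα : 0 < α) (hβ : 0 < β)
    (hαβ : α + β = 1) (hf : ∀ i ∈ s, 0 ≤ f i) (hg : ∀ i ∈ s, 0 ≤ g i) :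
    ∑ i ∈ s, f i ^ α * g i ^ β ≤ (∑ i ∈ s, f i) ^ α * (∑ i ∈ s, g i) ^ β := by
  have hc : Real.HolderConjugate (1 / α) (1 / β) := by
    rw [Real.holderConjugate_iff]
    refine ⟨by rw [lt_div_iff₀ hα]; linarith, ?_⟩
    simpa using hαβ
  have h := Real.inner_le_Lp_mul_Lq_of_nonneg s hc (f := fun i => f i ^ α) (g := fun i => g i ^ β)
    (fun i hi => Real.rpow_nonneg (hf i hi) _) (fun i hi => Real.rpow_nonneg (hg i hi) _)
  have e1 : ∀ i ∈ s, (f i ^ α) ^ (1 / α) = f i := fun i hi => by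
    rw [← Real.rpow_mul (hf i hi), mul_one_div_cancel hα.ne', Real.rpow_one]
  have e2 : ∀ i ∈ s, (g i ^ β) ^ (1 / β) = g i := fun i hi => by
    rw [← Real.rpow_mul (hg i hi), mul_one_div_cancel hβ.ne', Real.rpow_one]
  rw [Finset.sum_congr rfl e1, Finset.sum_congr rfl e2] at h
  simpa using h

theorem card_Icc_neg {R : ℤ} (hR : 0 ≤ R) : ((Finset.Icc (-R) R).card : ℝ) = 2 * R + 1 := by
  rw [Int.card_Icc]
  have : ((R + 1 - -R).toNat : ℤ) = R + 1 - -R := Int.toNat_of_nonneg (by omega)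
  have h2 : (((R + 1 - -R).toNat : ℤ) : ℝ) = ((R + 1 - -R : ℤ) : ℝ) := by rw [this]
  push_cast at h2
  rw [h2]; ring

theorem card_cube {D : ℕ} {R : ℤ} (hR : 0 ≤ R) : ((cube D R).card : ℝ) = (2 * R + 1) ^ D := by
  rw [cube, Fintype.card_piFinset_const]
  push_cast
  rw [card_Icc_neg hR]

theorem sum_cube_one {R : ℤ} (F : (Fin 1 → ℤ) → ℝ) (x : Fin 1 → ℤ) :
    ∑ z ∈ Finset.Icc (-R) R, F (Function.update x 0 z) = ∑ y ∈ cube 1 R, F y := by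
  refine Finset.sum_bij' (fun z _ => Function.update x 0 z) (fun y _ => y 0) ?_ ?_ ?_ ?_ ?_
  · intro z hz
    rw [mem_cube]; intro i; fin_cases i; simpa using hz
  · intro y hy; simpa using mem_cube.1 hy 0
  · intro z _; simp
  · intro y _; ext i; fin_cases i; simp
  · intro z _; rfl

theorem cubeEnergy_nonneg {D : ℕ} {a : Fin D → (Fin D → ℤ) → ℝ} (ha : ∀ j x, 0 < a j x) (R : ℤ)
    (w : (Fin D → ℤ) → ℝ) : 0 ≤ cubeEnergy a R w :=
  Finset.sum_nonneg fun _ _ => Finset.sum_nonneg fun _ _ => mul_nonneg (ha _ _).le (sq_nonneg _)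

theorem weightSum_nonneg {D : ℕ} {a : Fin D → (Fin D → ℤ) → ℝ} (ha : ∀ j x, 0 < a j x) (R : ℤ) (r : ℝ) :
    0 ≤ weightSum a R r :=
  Finset.sum_nonneg fun _ _ => Finset.sum_nonneg fun _ _ => Real.rpow_nonneg (ha _ _).le _

/-- The sup bound on a segment. -/
theorem sq_le_of_dim_one {q : ℝ} (hq : 1 < q) {R : ℤ} (hR : 0 ≤ R) (a : Fin 1 → (Fin 1 → ℤ) → ℝ)
    (ha : ∀ j x, 0 < a j x) (w : (Fin 1 → ℤ) → ℝ) (hw : ∀ x, 0 ≤ w x) {x : Fin 1 → ℤ} (hx : x ∈ cube 1 R) :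
    w x ^ 2 ≤ 2 * ((2 * (R : ℝ) + 1)⁻¹ * ((2 * (R : ℝ) + 1) ^ (2 - 1 / q) *
      weightSum a R (-q) ^ (1 / q) * cubeEnergy a R w + ∑ y ∈ cube 1 R, w y ^ 2)) := by
  have hq0 : 0 < q := by linarith
  have hq1 : 0 < q - 1 := by linarith
  have hRr : (0 : ℝ) ≤ R := by exact_mod_cast hR
  set L : ℝ := 2 * (R : ℝ) + 1 with hL
  have hL0 : 0 < L := by linarith
  have hcard : ((cube 1 R).card : ℝ) = L := by rw [card_cube hR, pow_one]
  have hE := cubeEnergy_nonneg ha R w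
  have hQ := weightSum_nonneg ha R (-q)
  have h1 := line_bound_average hR w x hx 0
  rw [Finset.sum_add_distrib, ← Finset.mul_sum, sum_cube_one w x] at h1
  have e1 : ∑ z ∈ Finset.Icc (-R) R, (if z < R then |w (Function.update x 0 (z + 1)) - w (Function.update x 0 z)| else 0)
      = ∑ y ∈ cubeEdges 1 R 0, |w (y + unitVec 0) - w y| := by
    rw [cubeEdges, Finset.sum_filter, ← sum_cube_one _ x]
    simp only [Function.update_self, update_add_unitVec]
  rw [e1] at h1
  have h2 := sum_mul_mul_le_rpow (cubeEdges 1 R 0)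
    (fun y => a 0 y ^ (-(1 / 2) : ℝ)) (fun y => a 0 y ^ (1 / 2 : ℝ) * |w (y + unitVec 0) - w y|)
    (fun _ => 1) hq (fun e _ => Real.rpow_nonneg (ha _ _).le _)
    (fun e _ => mul_nonneg (Real.rpow_nonneg (ha _ _).le _) (abs_nonneg _)) (fun _ _ => zero_le_one)
  have f1 : ∀ x, (a 0 x ^ (-(1 / 2) : ℝ)) ^ (2 * q) = a 0 x ^ (-q) := fun x => by
    rw [← Real.rpow_mul (ha 0 x).le]; congr 1; ring
  have f2 : ∀ x, (a 0 x ^ (1 / 2 : ℝ) * |w (x + unitVec 0) - w x|) ^ 2 = a 0 x * (w (x + unitVec 0) - w x) ^ 2 :=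
    fun x => by
      rw [mul_pow, sq_abs, ← Real.rpow_natCast, ← Real.rpow_mul (ha 0 x).le]; norm_num
  have f3 : ∀ x, a 0 x ^ (-(1 / 2) : ℝ) * (a 0 x ^ (1 / 2 : ℝ) * |w (x + unitVec 0) - w x|) =
      |w (x + unitVec 0) - w x| := fun x => by
    rw [← mul_assoc, ← Real.rpow_add (ha 0 x)]; norm_num
  simp only [f1, f2, f3, mul_one, Real.one_rpow, Finset.sum_const, nsmul_eq_mul] at h2
  have g1 : ∑ i ∈ cubeEdges 1 R 0, a 0 i ^ (-q) = weightSum a R (-q) := by simp [weightSum]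
  have g2 : ∑ x ∈ cubeEdges 1 R 0, a 0 x * (w (x + unitVec 0) - w x) ^ 2 = cubeEnergy a R w := by
    simp [cubeEnergy]
  rw [g1, g2] at h2
  have hle : ((cubeEdges 1 R 0).card : ℝ) ≤ L := by
    rw [← hcard]; exact_mod_cast Finset.card_le_card (Finset.filter_subset _ _)
  set Q := weightSum a R (-q)
  set E := cubeEnergy a R w
  set G := ∑ y ∈ cube 1 R, w y ^ 2 with hG
  have hG0 : 0 ≤ G := Finset.sum_nonneg fun _ _ => sq_nonneg _
  set T := ∑ y ∈ cubeEdges 1 R 0, |w (y + unitVec 0) - w y|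
  have hT0 : 0 ≤ T := Finset.sum_nonneg fun _ _ => abs_nonneg _
  set P := ∑ y ∈ cube 1 R, w y
  have hP0 : 0 ≤ P := Finset.sum_nonneg fun _ _ => hw _
  have h3 : T ^ 2 ≤ Q ^ (1 / q) * E * L ^ (1 - 1 / q) := by
    have : T ≤ Q ^ (1 / (2 * q)) * E ^ (1 / 2 : ℝ) * L ^ (1 / (2 * (q / (q - 1)))) := by
      refine h2.trans (mul_le_mul_of_nonneg_left (Real.rpow_le_rpow (Nat.cast_nonneg _) hle (by positivity)) ?_)
      positivity
    calc T ^ 2 ≤ (Q ^ (1 / (2 * q)) * E ^ (1 / 2 : ℝ) * L ^ (1 / (2 * (q / (q - 1))))) ^ 2 := by gcongr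
      _ = _ := by
        rw [mul_pow, mul_pow, ← Real.rpow_natCast, ← Real.rpow_mul hQ, ← Real.rpow_natCast, ← Real.rpow_mul hE,
          ← Real.rpow_natCast, ← Real.rpow_mul hL0.le]
        congr 1
        · congr 1
          · congr 1; push_cast; field_simp
          · norm_num
        · congr 1; push_cast; field_simp
  have h4 : P ^ 2 ≤ L * G := by
    have := sq_sum_le_card_mul_sum_sq (s := cube 1 R) (f := w)
    rwa [hcard] at this
  have h5 : L⁻¹ * L ^ (2 - 1 / q) = L ^ (1 - 1 / q) := by
    rw [← Real.rpow_neg_one, ← Real.rpow_add hL0]; congr 1; ring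
  calc w x ^ 2 ≤ (T + L⁻¹ * P) ^ 2 := by have := hw x; gcongr
    _ ≤ 2 * (T ^ 2 + (L⁻¹ * P) ^ 2) := add_sq_le
    _ ≤ 2 * (Q ^ (1 / q) * E * L ^ (1 - 1 / q) + L⁻¹ * L⁻¹ * (L * G)) := by
        rw [mul_pow, sq L⁻¹]; gcongr
    _ = _ := by
        rw [← h5]; field_simp

/-- Gagliardo-Nirenberg type interpolation on a cube of the dimension `D` of the slices. -/
theorem exists_slice_inequality {D : ℕ} (hD : 1 ≤ D) {p q lam : ℝ} (hp : 1 < p) (hq : 1 < q)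
    (hl0 : 0 < lam) (hl1 : lam < 1)
    (hlam : (D = 1 ∧ lam = 1 - 1 / p) ∨ (2 ≤ D ∧ 1 / p = (1 - lam) * (2 / D - 1 / q))) :
    ∃ C : ℝ, 0 < C ∧ ∀ R : ℤ, 0 ≤ R → ∀ a : Fin D → (Fin D → ℤ) → ℝ, (∀ j x, 0 < a j x) →
      ∀ w : (Fin D → ℤ) → ℝ, (∀ x, 0 ≤ w x) →
      (∑ x ∈ cube D R, w x ^ (2 * (p / (p - 1)))) ^ (1 - 1 / p) ≤
        C * (2 * (R : ℝ) + 1) ^ (-(D : ℝ) / p) * (∑ x ∈ cube D R, w x ^ 2) ^ lam *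
          ((2 * (R : ℝ) + 1) ^ (2 - D / q) * weightSum a R (-q) ^ (1 / q) * cubeEnergy a R w +
            ∑ x ∈ cube D R, w x ^ 2) ^ (1 - lam) := by
  have hp1 : 0 < p - 1 := by linarith
  have hp0 : 0 < p := by linarith
  have hq0 : 0 < q := by linarith
  have hpi : 1 / p < 1 := by rw [div_lt_one hp0]; exact hp
  rcases hlam with ⟨rfl, hl⟩ | ⟨hD2, hl⟩
  · refine ⟨2 ^ (1 - lam), by positivity, ?_⟩
    intro R hR a ha w hw
    have hRr : (0 : ℝ) ≤ R := by exact_mod_cast hR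
    have hsup := fun x hx => sq_le_of_dim_one hq hR a ha w hw (x := x) hx
    have hE := cubeEnergy_nonneg ha R w
    have hQ := weightSum_nonneg ha R (-q)
    have hG0 : 0 ≤ ∑ y ∈ cube 1 R, w y ^ 2 := Finset.sum_nonneg fun _ _ => sq_nonneg _
    set G := ∑ y ∈ cube 1 R, w y ^ 2 with hG
    set L : ℝ := 2 * (R : ℝ) + 1 with hL
    have hL0 : 0 < L := by linarith
    set Z := L ^ (2 - 1 / q) * weightSum a R (-q) ^ (1 / q) * cubeEnergy a R w + G with hZ
    have hZ0 : 0 ≤ Z := by positivity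
    have hM0 : 0 ≤ 2 * (L⁻¹ * Z) := by positivity
    -- On a segment the Sobolev inequality is a sup bound: write `w^(2p')` as `w²` times
    -- `(w²)^(1/(p-1))` and bound the second factor by its supremum.
    have h1 : ∑ x ∈ cube 1 R, w x ^ (2 * (p / (p - 1))) ≤ G * (2 * (L⁻¹ * Z)) ^ (1 / (p - 1)) := by
      rw [hG, Finset.sum_mul]
      refine Finset.sum_le_sum fun x hx => ?_
      calc w x ^ (2 * (p / (p - 1))) = w x ^ 2 * (w x ^ 2) ^ (1 / (p - 1)) := by
            rw [← Real.rpow_natCast (w x) 2, ← Real.rpow_mul (hw x), ← Real.rpow_add' (hw x) (by positivity)]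
            congr 1; push_cast; field_simp; ring
        _ ≤ _ := mul_le_mul_of_nonneg_left (Real.rpow_le_rpow (sq_nonneg _) (hsup x hx) (by positivity)) (sq_nonneg _)
    have h2 := Real.rpow_le_rpow (Finset.sum_nonneg fun x _ => Real.rpow_nonneg (hw x) _) h1
      (by linarith : 0 ≤ 1 - 1 / p)
    refine h2.trans (le_of_eq ?_)
    rw [Real.mul_rpow hG0 (Real.rpow_nonneg hM0 _), ← Real.rpow_mul hM0,
      Real.mul_rpow (by norm_num) (by positivity), Real.mul_rpow (by positivity) hZ0]
    have e1 : 1 / (p - 1) * (1 - 1 / p) = 1 - lam := by rw [hl]; field_simp; ring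
    have e2 : (L⁻¹) ^ (1 - lam) = L ^ (-((1:ℕ) : ℝ) / p) := by
      rw [← Real.rpow_neg_one, ← Real.rpow_mul hL0.le, hl]; congr 1; push_cast; ring
    rw [e1, e2, ← hl]
    rw [hZ]; push_cast
    ring
  · obtain ⟨C, hC, hS⟩ := exists_sobolev hD2 hq
    refine ⟨C ^ (1 - lam), by positivity, ?_⟩
    intro R hR a ha w hw
    have hRr : (0 : ℝ) ≤ R := by exact_mod_cast hR
    have hE := cubeEnergy_nonneg ha R w
    have hQ := weightSum_nonneg ha R (-q)
    have hG0 : 0 ≤ ∑ y ∈ cube D R, w y ^ 2 := Finset.sum_nonneg fun _ _ => sq_nonneg _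
    have hD' : (2 : ℝ) ≤ D := by exact_mod_cast hD2
    set L : ℝ := 2 * (R : ℝ) + 1 with hL
    have hL0 : 0 < L := by linarith
    -- No boundary condition is available on a slice, so `κ` is the inverse side length.
    have h1 := hS R a ha w hw L⁻¹ (by positivity) (fun V _ => line_bound_average hR V)
    rw [card_cube hR, ← hL] at h1
    set G := ∑ y ∈ cube D R, w y ^ 2 with hG
    set μ : ℝ := 1 + 1 / q - 2 / D with hμ
    have hμ0 : 0 < μ := by
      have : 0 < 1 / q := by positivity
      have : 2 / (D : ℝ) ≤ 1 := by rw [div_le_one (by linarith)]; exact hD'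
      linarith
    set S := ∑ x ∈ cube D R, w x ^ (2 / μ) with hSd
    have hS0 : 0 ≤ S := Finset.sum_nonneg fun x _ => Real.rpow_nonneg (hw x) _
    set Z := L ^ (2 - D / q) * weightSum a R (-q) ^ (1 / q) * cubeEnergy a R w + G with hZ
    have hZ0 : 0 ≤ Z := by positivity
    have h2 : S ^ μ ≤ C * (L ^ (-(2 - D / q)) * Z) := by
      refine h1.trans (le_of_eq ?_)
      have f1 : L ^ (-(2 - D / q)) * L ^ (2 - D / q) = 1 := by
        rw [← Real.rpow_add hL0, neg_add_cancel, Real.rpow_zero]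
      have f2 : L⁻¹ ^ 2 * (L ^ D) ^ (1 / q) = L ^ (-(2 - D / q)) := by
        rw [← Real.rpow_natCast L D, ← Real.rpow_mul hL0.le, inv_pow, ← Real.rpow_natCast L 2,
          ← Real.rpow_neg hL0.le, ← Real.rpow_add hL0]
        congr 1; push_cast; ring
      rw [f2, hZ]
      linear_combination (-(C * weightSum a R (-q) ^ (1 / q) * cubeEnergy a R w)) * f1
    set p' := p / (p - 1) with hp'
    have hp'0 : 0 < p' := by positivity
    have hpp : p' * (1 - 1 / p) = 1 := by rw [hp']; field_simp
    -- The Hölder exponents match because `lam + (1 - lam) μ = 1 - 1/p`, which is the assumed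
    -- relation `1/p = (1 - lam)(2/D - 1/q)` rewritten.
    have hsum : lam * p' + (1 - lam) * μ * p' = 1 := by
      have : lam + (1 - lam) * μ = 1 - 1 / p := by rw [hl, hμ]; ring
      rw [← add_mul, this, mul_comm]; exact hpp
    have h3 := sum_rpow_mul_rpow_le (cube D R) (fun x => w x ^ 2) (fun x => w x ^ (2 / μ))
      (mul_pos hl0 hp'0) (mul_pos (mul_pos (sub_pos.2 hl1) hμ0) hp'0) hsum (fun _ _ => sq_nonneg _)
      (fun x _ => Real.rpow_nonneg (hw x) _)
    have e1 : ∀ x, (w x ^ 2) ^ (lam * p') * (w x ^ (2 / μ)) ^ ((1 - lam) * μ * p') = w x ^ (2 * p') := by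
      intro x
      rw [← Real.rpow_natCast (w x) 2, ← Real.rpow_mul (hw x), ← Real.rpow_mul (hw x),
        ← Real.rpow_add_of_nonneg (hw x) (by positivity) (by have := sub_pos.2 hl1; positivity)]
      congr 1
      push_cast; field_simp; ring
    simp only [e1] at h3
    have h4 := Real.rpow_le_rpow (Finset.sum_nonneg fun x _ => Real.rpow_nonneg (hw x) _) h3
      (by linarith : 0 ≤ 1 - 1 / p)
    rw [Real.mul_rpow (Real.rpow_nonneg hG0 _) (Real.rpow_nonneg hS0 _), ← Real.rpow_mul hG0, ← Real.rpow_mul hS0,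
      mul_assoc, hpp, mul_one, mul_assoc, hpp, mul_one, mul_comm (1 - lam) μ, Real.rpow_mul hS0] at h4
    have h5 := Real.rpow_le_rpow (Real.rpow_nonneg hS0 _) h2 (sub_pos.2 hl1).le
    rw [Real.mul_rpow hC.le (by positivity), Real.mul_rpow (by positivity) hZ0, ← Real.rpow_mul hL0.le] at h5
    have e2 : -(2 - (D:ℝ) / q) * (1 - lam) = -(D : ℝ) / p := by
      have : -(D : ℝ) / p = -D * (1 / p) := by ring
      rw [this, hl]; field_simp
    rw [e2] at h5
    refine h4.trans ((mul_le_mul_of_nonneg_left h5 (Real.rpow_nonneg hG0 _)).trans (le_of_eq ?_))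
    ring
end

/-! ### Pointwise energy inequality and summation by parts -/

noncomputable section

/-- The first bound makes the test function `v^(2α-1)` control the squared gradient of `v^α`, the
second controls the term in which the gradient falls on the cutoff. Both follow from `b^(2α-1) = b^α
b^(α-1)`, the monotonicity of powers and, for the first, Bernoulli's inequality. -/
theorem mul_rpow_sub_bounds {a b α : ℝ} (ha : 0 < a) (hab : a ≤ b) (hα : 1 ≤ α) :
    (b ^ α - a ^ α) ^ 2 ≤ α * ((b - a) * (b ^ (2 * α - 1) - a ^ (2 * α - 1))) ∧
      (b - a) * (b ^ (2 * α - 1) + a ^ (2 * α - 1)) ≤ 2 * (b ^ α - a ^ α) * b ^ α ∧ a ^ α ≤ b ^ α := by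
  have hb : 0 < b := ha.trans_le hab
  have hba : 0 ≤ b - a := sub_nonneg.2 hab
  have hA1 : a ^ (α - 1) ≤ b ^ (α - 1) := Real.rpow_le_rpow ha.le hab (by linarith)
  have hA : a ^ α ≤ b ^ α := Real.rpow_le_rpow ha.le hab (by linarith)
  have eA : a ^ α = a * a ^ (α - 1) := by rw [Real.rpow_sub_one ha.ne']; field_simp
  have eB : b ^ α = b * b ^ (α - 1) := by rw [Real.rpow_sub_one hb.ne']; field_simp
  have eA' : a ^ (2 * α - 1) = a ^ α * a ^ (α - 1) := by rw [← Real.rpow_add ha]; congr 1; ring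
  have eB' : b ^ (2 * α - 1) = b ^ α * b ^ (α - 1) := by rw [← Real.rpow_add hb]; congr 1; ring
  have pA : 0 < a ^ (α - 1) := Real.rpow_pos_of_pos ha _
  have pB : 0 < b ^ (α - 1) := Real.rpow_pos_of_pos hb _
  have pA' : 0 < a ^ α := Real.rpow_pos_of_pos ha _
  have h1 : b ^ α - a ^ α ≤ α * ((b - a) * b ^ (α - 1)) := by
    rcases eq_or_lt_of_le hab with rfl | hlt
    · simp
    have h := one_add_mul_self_le_rpow_one_add (s := a / b - 1) (by
      have : 0 ≤ a / b := div_nonneg ha.le hb.le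
      linarith) hα
    rw [show 1 + (a / b - 1) = a / b by ring, Real.div_rpow ha.le hb.le,
      le_div_iff₀ (Real.rpow_pos_of_pos hb α)] at h
    have h4 : (a / b - 1) * b ^ α = (a - b) * b ^ (α - 1) := by
      rw [eB]; field_simp
    linear_combination h - α * h4
  have h2 : (b - a) * b ^ (α - 1) ≤ b ^ α - a ^ α := by
    rw [eA, eB]
    have := mul_le_mul_of_nonneg_left hA1 ha.le
    linarith
  refine ⟨?_, ?_, hA⟩
  · have h3 : (b ^ α - a ^ α) * b ^ (α - 1) ≤ b ^ (2 * α - 1) - a ^ (2 * α - 1) := by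
      rw [eA', eB']
      have := mul_le_mul_of_nonneg_left hA1 pA'.le
      linarith
    have hd : 0 ≤ b ^ α - a ^ α := sub_nonneg.2 hA
    calc (b ^ α - a ^ α) ^ 2 = (b ^ α - a ^ α) * (b ^ α - a ^ α) := sq _
      _ ≤ (b ^ α - a ^ α) * (α * ((b - a) * b ^ (α - 1))) := mul_le_mul_of_nonneg_left h1 hd
      _ = α * ((b - a) * ((b ^ α - a ^ α) * b ^ (α - 1))) := by ring
      _ ≤ _ := by gcongr
  · have h3 : a ^ (2 * α - 1) ≤ b ^ (2 * α - 1) := Real.rpow_le_rpow ha.le hab (by linarith)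
    calc (b - a) * (b ^ (2 * α - 1) + a ^ (2 * α - 1)) ≤ (b - a) * (b ^ (2 * α - 1) + b ^ (2 * α - 1)) := by gcongr
      _ = 2 * ((b - a) * b ^ (α - 1)) * b ^ α := by rw [eB']; ring
      _ ≤ _ := by have : 0 ≤ b ^ α := pA'.le.trans hA
                  gcongr

/-- The pointwise inequality behind the energy estimate for powers of subcaloric functions. -/
theorem energy_pointwise {a b α : ℝ} (ha : 0 < a) (hb : 0 < b) (hα : 1 ≤ α) (g h : ℝ) :
    1 / 2 * (h * b ^ α - g * a ^ α) ^ 2 - 5 * α ^ 2 * ((h - g) ^ 2 * ((a ^ α) ^ 2 + (b ^ α) ^ 2)) ≤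
      2 * α * ((b - a) * (h ^ 2 * b ^ (2 * α - 1) - g ^ 2 * a ^ (2 * α - 1))) := by
  have key : ∀ a b g h : ℝ, 0 < a → a ≤ b →
      1 / 2 * (h * b ^ α - g * a ^ α) ^ 2 - 5 * α ^ 2 * ((h - g) ^ 2 * ((a ^ α) ^ 2 + (b ^ α) ^ 2)) ≤
      2 * α * ((b - a) * (h ^ 2 * b ^ (2 * α - 1) - g ^ 2 * a ^ (2 * α - 1))) := by
    intro a b g h ha hab
    obtain ⟨h1, h2, h3⟩ := mul_rpow_sub_bounds ha hab hα
    have pA : 0 < a ^ α := Real.rpow_pos_of_pos ha _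
    have pA' : 0 < a ^ (2 * α - 1) := Real.rpow_pos_of_pos ha _
    have pB' : 0 < b ^ (2 * α - 1) := Real.rpow_pos_of_pos (ha.trans_le hab) _
    set A := a ^ α
    set B := b ^ α
    set A' := a ^ (2 * α - 1)
    set B' := b ^ (2 * α - 1)
    have hW : 0 ≤ (b - a) * (B' + A') := mul_nonneg (sub_nonneg.2 hab) (by linarith)
    -- The part symmetric in the cutoff values is the dissipation. The remainder carries the factor
    -- `h² - g² = (h+g)(h-g)` and has no sign.
    have e1 : 2 * α * ((b - a) * (h ^ 2 * B' - g ^ 2 * A')) =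
      (h ^ 2 + g ^ 2) * (α * ((b - a) * (B' - A'))) + α * ((h ^ 2 - g ^ 2) * ((b - a) * (B' + A'))) := by ring
    have e2 : -(|h ^ 2 - g ^ 2| * (2 * (B - A) * B)) ≤ (h ^ 2 - g ^ 2) * ((b - a) * (B' + A')) := by
      have := mul_le_mul_of_nonneg_left h2 (abs_nonneg (h ^ 2 - g ^ 2))
      have h5 := mul_le_mul_of_nonneg_right (neg_abs_le (h ^ 2 - g ^ 2)) hW
      linarith
    -- Young's inequality; the share `1/4` of `((h+g)(B-A))²` is at most half of the dissipation, by
    -- `e6`.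
    have e3 : α * (|h ^ 2 - g ^ 2| * (2 * (B - A) * B)) ≤
        1 / 4 * ((h + g) * (B - A)) ^ 2 + 4 * α ^ 2 * ((h - g) * B) ^ 2 := by
      have : |h ^ 2 - g ^ 2| * (2 * (B - A) * B) = 2 * (|(h + g) * (B - A)| * |(h - g) * B|) := by
        rw [← abs_mul, show (h + g) * (B - A) * ((h - g) * B) = (h ^ 2 - g ^ 2) * ((B - A) * B) by ring,
          abs_mul, abs_of_nonneg (mul_nonneg (sub_nonneg.2 h3) (pA.le.trans h3))]; ring
      rw [this, ← sq_abs ((h + g) * (B - A)), ← sq_abs ((h - g) * B)]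
      have := sq_nonneg (1 / 2 * |(h + g) * (B - A)| - 2 * α * |(h - g) * B|)
      linear_combination this
    have e4 : (h ^ 2 + g ^ 2) * (B - A) ^ 2 ≤ (h ^ 2 + g ^ 2) * (α * ((b - a) * (B' - A'))) :=
      mul_le_mul_of_nonneg_left h1 (by positivity)
    have e5 := mul_le_mul_of_nonneg_left e2 (by linarith : 0 ≤ α)
    have e6 : 1 / 4 * ((h + g) * (B - A)) ^ 2 ≤ 1 / 2 * ((h ^ 2 + g ^ 2) * (B - A) ^ 2) := by
      have : 0 ≤ ((h - g) * (B - A)) ^ 2 := sq_nonneg _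
      linear_combination (1 / 4) * this
    have e7 : (h * B - g * A) ^ 2 ≤ (h ^ 2 + g ^ 2) * (B - A) ^ 2 + (h - g) ^ 2 * (A ^ 2 + B ^ 2) := by
      have i1 : 0 ≤ ((h + g) * (B - A) - (h - g) * (A + B)) ^ 2 := sq_nonneg _
      have i2 : 0 ≤ ((h - g) * (B - A)) ^ 2 := sq_nonneg _
      linear_combination (1 / 4) * i1 + i2
    have e8 : 0 ≤ α ^ 2 * ((h - g) ^ 2 * A ^ 2) := by positivity
    have e9 : 0 ≤ (α ^ 2 - 1) * ((h - g) ^ 2 * (A ^ 2 + B ^ 2)) := by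
      have : 0 ≤ α ^ 2 - 1 := by nlinarith
      positivity
    rw [e1]
    linear_combination e4 + e5 + e3 + e6 + (1 / 2) * e7 + 4 * e8 + e9 + (1/2) * (mul_nonneg (sq_nonneg (h - g)) (add_nonneg (sq_nonneg A) (sq_nonneg B)))
  rcases le_total a b with hab | hab
  · exact key a b g h ha hab
  · have := key b a h g hb hab
    linear_combination this

/-- The generator in terms of the weights `a j x` of the bonds `{x, x + e_j}`. -/
def gen {d : ℕ} (a : Fin d → (Fin d → ℤ) → ℝ) (v : (Fin d → ℤ) → ℝ) (x : Fin d → ℤ) : ℝ :=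
  ∑ j, (a j x * (v (x + unitVec j) - v x) + a j (x - unitVec j) * (v (x - unitVec j) - v x))

/-- Summation by parts. Since `ψ` vanishes on the outermost layer of the cube, bonds leaving the
cube contribute nothing, and every bond inside is met once from each end. -/
theorem sum_mul_gen {d : ℕ} (a : Fin d → (Fin d → ℤ) → ℝ) {R : ℤ} (v ψ : (Fin d → ℤ) → ℝ)
    (hψ : ∀ x, x ∉ cube d (R - 1) → ψ x = 0) :
    ∑ x ∈ cube d R, ψ x * gen a v x =
      -∑ j, ∑ x ∈ cubeEdges d R j, a j x * ((v (x + unitVec j) - v x) * (ψ (x + unitVec j) - ψ x)) := by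
  simp only [gen, Finset.mul_sum]
  rw [Finset.sum_comm, ← Finset.sum_neg_distrib]
  refine Finset.sum_congr rfl fun j _ => ?_
  simp only [mul_add]
  rw [Finset.sum_add_distrib]
  have h1 : ∑ x ∈ cube d R, ψ x * (a j x * (v (x + unitVec j) - v x)) =
      ∑ x ∈ cubeEdges d R j, ψ x * (a j x * (v (x + unitVec j) - v x)) := by
    symm
    refine Finset.sum_subset (Finset.filter_subset _ _) fun x hx hx' => ?_
    rw [hψ x, zero_mul]
    intro hc
    apply hx'
    rw [mem_cubeEdges]
    have := mem_cube.1 hc j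
    exact ⟨hx, by omega⟩
  have h2 : ∑ x ∈ cube d R, ψ x * (a j (x - unitVec j) * (v (x - unitVec j) - v x)) =
      ∑ x ∈ cubeEdges d R j, ψ (x + unitVec j) * (a j x * (v x - v (x + unitVec j))) := by
    have h3 : ∑ x ∈ cubeEdges d R j, ψ (x + unitVec j) * (a j x * (v x - v (x + unitVec j))) =
        ∑ y ∈ (cubeEdges d R j).image (fun x => x + unitVec j), ψ y * (a j (y - unitVec j) * (v (y - unitVec j) - v y)) := by
      rw [Finset.sum_image (fun x _ y _ h => add_right_cancel h)]
      simp
    rw [h3]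
    symm
    refine Finset.sum_subset ?_ fun x hx hx' => ?_
    · intro y hy
      obtain ⟨x, hx, rfl⟩ := Finset.mem_image.1 hy
      exact add_unitVec_mem_cube hx
    · rw [hψ x, zero_mul]
      intro hc
      apply hx'
      rw [Finset.mem_image]
      refine ⟨x - unitVec j, ?_, by simp⟩
      rw [mem_cubeEdges, mem_cube]
      rw [mem_cube] at hx hc
      refine ⟨fun i => ?_, ?_⟩
      · have a1 := hx i
        have a2 := hc i
        by_cases hi : i = j
        · subst hi; simp [unitVec]; omega
        · simpa [unitVec, hi] using a1
      · have a1 := hx j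
        simp [unitVec]; omega
  rw [h1, h2, ← Finset.sum_add_distrib, ← Finset.sum_neg_distrib]
  exact Finset.sum_congr rfl fun x _ => by ring

/-- The error term of the energy estimate with a cutoff function `η`. -/
def cutoffError {d : ℕ} (a : Fin d → (Fin d → ℤ) → ℝ) (R : ℤ) (η w : (Fin d → ℤ) → ℝ) : ℝ :=
  ∑ j, ∑ x ∈ cubeEdges d R j, a j x * ((η (x + unitVec j) - η x) ^ 2 * (w x ^ 2 + w (x + unitVec j) ^ 2))

/-- Testing with `η² v^(2α-1)` and summing `energy_pointwise` over the bonds. The power `α` enters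
the error only polynomially, as Moser's iteration requires. -/
theorem cutoff_dissipation {d : ℕ} {a : Fin d → (Fin d → ℤ) → ℝ} (ha : ∀ j x, 0 < a j x) {R : ℤ}
    {v η : (Fin d → ℤ) → ℝ} (hv : ∀ x, 0 < v x) (hη : ∀ x, x ∉ cube d (R - 1) → η x = 0) {α : ℝ} (hα : 1 ≤ α) :
    2 * α * ∑ x ∈ cube d R, (η x ^ 2 * v x ^ (2 * α - 1)) * gen a v x ≤
      -(1 / 2) * cubeEnergy a R (fun x => η x * v x ^ α) + 5 * α ^ 2 * cutoffError a R η (fun x => v x ^ α) := by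
  rw [sum_mul_gen a v (fun x => η x ^ 2 * v x ^ (2 * α - 1)) (fun x hx => by simp [hη x hx])]
  rw [cubeEnergy, cutoffError, mul_neg, neg_mul, neg_add_eq_sub, Finset.mul_sum, Finset.mul_sum, Finset.mul_sum,
    ← Finset.sum_neg_distrib, ← Finset.sum_sub_distrib]
  refine Finset.sum_le_sum fun j _ => ?_
  rw [Finset.mul_sum, Finset.mul_sum, Finset.mul_sum, ← Finset.sum_neg_distrib, ← Finset.sum_sub_distrib]
  refine Finset.sum_le_sum fun x _ => ?_
  have := mul_le_mul_of_nonneg_left (energy_pointwise (hv x) (hv (x + unitVec j)) hα (η x) (η (x + unitVec j))) (ha j x).le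
  linear_combination this
end

/-! ### Energy estimates in space and time -/

noncomputable section

/-- Positive subcaloric functions on `[T₁, t₀]` times a cube, extended to continuous positive
functions on the whole space-time. -/
structure SubcaloricOn {d : ℕ} (a : Fin d → (Fin d → ℤ) → ℝ) (T₁ t₀ : ℝ) (R : ℤ)
    (u : ℝ → (Fin d → ℤ) → ℝ) : Prop where
  cont : ∀ x, Continuous fun t => u t x
  pos : ∀ t x, 0 < u t x
  sub : ∀ t ∈ Set.Ioo T₁ t₀, ∀ x ∈ cube d (R - 1), ∃ u' : ℝ,
    HasDerivAt (fun s => u s x) u' t ∧ u' ≤ gen a (u t) x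

variable {d : ℕ} {a : Fin d → (Fin d → ℤ) → ℝ} {T₁ t₀ : ℝ} {R : ℤ} {u : ℝ → (Fin d → ℤ) → ℝ}

theorem cube_mono {d : ℕ} {R S : ℤ} (h : R ≤ S) : cube d R ⊆ cube d S := by
  intro x hx
  rw [mem_cube] at hx ⊢
  intro i
  have := hx i
  omega

theorem SubcaloricOn.mono (hu : SubcaloricOn a T₁ t₀ R u) {S : ℤ} (hS : S ≤ R) {T₂ : ℝ} (hT : T₁ ≤ T₂) :
    SubcaloricOn a T₂ t₀ S u where
  cont := hu.cont
  pos := hu.pos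
  sub t ht x hx := hu.sub t ⟨hT.trans_lt ht.1, ht.2⟩ x (cube_mono (by omega) hx)

theorem continuous_cubeEnergy {f : ℝ → (Fin d → ℤ) → ℝ} (hf : ∀ x, Continuous fun t => f t x) :
    Continuous fun t => cubeEnergy a R (f t) := by
  unfold cubeEnergy
  exact continuous_finsetSum _ fun j _ => continuous_finsetSum _ fun x _ =>
    continuous_const.mul (((hf _).sub (hf _)).pow 2)

theorem continuous_cutoffError {f : ℝ → (Fin d → ℤ) → ℝ} (hf : ∀ x, Continuous fun t => f t x)
    (η : (Fin d → ℤ) → ℝ) : Continuous fun t => cutoffError a R η (f t) := by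
  unfold cutoffError
  exact continuous_finsetSum _ fun j _ => continuous_finsetSum _ fun x _ =>
    continuous_const.mul (continuous_const.mul (((hf _).pow 2).add ((hf _).pow 2)))

theorem SubcaloricOn.continuous_rpow (hu : SubcaloricOn a T₁ t₀ R u) (α : ℝ) (x : Fin d → ℤ) :
    Continuous fun t => u t x ^ α :=
  (hu.cont x).rpow_const fun t => Or.inl (hu.pos t x).ne'

theorem cutoffError_nonneg (ha : ∀ j x, 0 < a j x) (η w : (Fin d → ℤ) → ℝ) : 0 ≤ cutoffError a R η w :=
  Finset.sum_nonneg fun j _ => Finset.sum_nonneg fun x _ => mul_nonneg (ha _ _).le (by positivity)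

/-- The energy inequality between two times. -/
theorem SubcaloricOn.energy_step (hu : SubcaloricOn a T₁ t₀ R u) (ha : ∀ j x, 0 < a j x)
    {η : (Fin d → ℤ) → ℝ} (hη : ∀ x, x ∉ cube d (R - 1) → η x = 0) {α : ℝ} (hα : 1 ≤ α)
    {s t : ℝ} (hs : T₁ ≤ s) (hst : s ≤ t) (ht : t ≤ t₀) :
    (∑ x ∈ cube d R, (η x * u t x ^ α) ^ 2) +
        1 / 2 * ∫ r in s..t, cubeEnergy a R (fun x => η x * u r x ^ α) ≤
      (∑ x ∈ cube d R, (η x * u s x ^ α) ^ 2) +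
        5 * α ^ 2 * ∫ r in s..t, cutoffError a R η (fun x => u r x ^ α) := by
  have hcw := hu.continuous_rpow α
  have hcE : Continuous fun r => cubeEnergy a R (fun x => η x * u r x ^ α) :=
    continuous_cubeEnergy fun x => continuous_const.mul (hcw x)
  have hcR : Continuous fun r => cutoffError a R η (fun x => u r x ^ α) := continuous_cutoffError hcw η
  -- The energy inequality says that `Φ` does not increase from `s` to `t`.
  let Φ : ℝ → ℝ := fun r => (∑ x ∈ cube d R, (η x * u r x ^ α) ^ 2) +
    ((1 / 2 * ∫ z in s..r, cubeEnergy a R (fun x => η x * u z x ^ α)) -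
      5 * α ^ 2 * ∫ z in s..r, cutoffError a R η (fun x => u z x ^ α))
  have hcΦ : Continuous Φ := by
    refine (continuous_finsetSum _ fun x _ => (continuous_const.mul (hcw x)).pow 2).add (Continuous.sub ?_ ?_)
    · exact continuous_const.mul (intervalIntegral.continuous_primitive (fun _ _ => hcE.intervalIntegrable _ _) s)
    · exact continuous_const.mul (intervalIntegral.continuous_primitive (fun _ _ => hcR.intervalIntegrable _ _) s)
  have hanti : AntitoneOn Φ (Set.Icc s t) := by
    have hd : ∀ r ∈ Set.Ioo s t, ∃ m, HasDerivAt Φ m r ∧ m ≤ 0 := by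
      intro r hr
      have hr' : r ∈ Set.Ioo T₁ t₀ := ⟨hs.trans_lt hr.1, hr.2.trans_le ht⟩
      have hx : ∀ x, ∃ m, HasDerivAt (fun z => (η x * u z x ^ α) ^ 2) m r ∧
          m ≤ 2 * α * ((η x ^ 2 * u r x ^ (2 * α - 1)) * gen a (u r) x) := by
        intro x
        -- Where the differential inequality is not assumed, `η` vanishes and the term is constant
        -- in time.
        by_cases hxc : x ∈ cube d (R - 1)
        · obtain ⟨u', h1, h2⟩ := hu.sub r hr' x hxc
          have h3 := (h1.rpow_const (p := 2 * α) (Or.inl (hu.pos r x).ne')).const_mul (η x ^ 2)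
          have e : (fun z => (η x * u z x ^ α) ^ 2) = fun z => η x ^ 2 * u z x ^ (2 * α) := by
            funext z
            rw [mul_pow, ← Real.rpow_natCast (u z x ^ α) 2, ← Real.rpow_mul (hu.pos z x).le]
            congr 2; push_cast; ring
          rw [e]
          refine ⟨_, h3, ?_⟩
          have hp := Real.rpow_pos_of_pos (hu.pos r x) (2 * α - 1)
          have : 0 ≤ 2 * α * (η x ^ 2 * u r x ^ (2 * α - 1)) := by
            have : 0 ≤ α := by linarith
            positivity
          linear_combination mul_le_mul_of_nonneg_left h2 this
        · refine ⟨0, ?_, by simp [hη x hxc]⟩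
          simp only [hη x hxc, zero_mul]
          exact hasDerivAt_const _ _
      choose m hm1 hm2 using hx
      refine ⟨_, (HasDerivAt.fun_sum fun x _ => hm1 x).add
        (((hcE.integral_hasStrictDerivAt s r).hasDerivAt.const_mul (1 / 2)).sub
          ((hcR.integral_hasStrictDerivAt s r).hasDerivAt.const_mul (5 * α ^ 2))), ?_⟩
      have h1 : ∑ x ∈ cube d R, m x ≤ ∑ x ∈ cube d R, 2 * α * ((η x ^ 2 * u r x ^ (2 * α - 1)) * gen a (u r) x) :=
        Finset.sum_le_sum fun x _ => hm2 x
      rw [← Finset.mul_sum] at h1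
      have h2 := cutoff_dissipation ha (hu.pos r) hη hα
      linarith
    refine antitoneOn_of_deriv_nonpos (convex_Icc s t) hcΦ.continuousOn ?_ ?_
    · rw [interior_Icc]
      intro r hr
      obtain ⟨m, h1, _⟩ := hd r hr
      exact h1.differentiableAt.differentiableWithinAt
    · rw [interior_Icc]
      intro r hr
      obtain ⟨m, h1, h2⟩ := hd r hr
      rw [h1.deriv]; exact h2
  have := hanti (Set.left_mem_Icc.2 hst) (Set.right_mem_Icc.2 hst) hst
  simp only [Φ, intervalIntegral.integral_same] at this
  linarith

/-- The energy estimate for powers of a positive subcaloric function. -/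
theorem SubcaloricOn.energy_estimate (hu : SubcaloricOn a T₁ t₀ R u) (ha : ∀ j x, 0 < a j x)
    {η : (Fin d → ℤ) → ℝ} (hη : ∀ x, x ∉ cube d (R - 1) → η x = 0) {α : ℝ} (hα : 1 ≤ α)
    {T₂ t : ℝ} (hT : T₁ < T₂) (hTt : T₂ ≤ t) (ht : t ≤ t₀) :
    (∑ x ∈ cube d R, (η x * u t x ^ α) ^ 2) +
        1 / 2 * ∫ r in T₂..t, cubeEnergy a R (fun x => η x * u r x ^ α) ≤
      (T₂ - T₁)⁻¹ * (∫ r in T₁..t₀, ∑ x ∈ cube d R, (η x * u r x ^ α) ^ 2) +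
        5 * α ^ 2 * ∫ r in T₁..t₀, cutoffError a R η (fun x => u r x ^ α) := by
  have hcw := hu.continuous_rpow α
  have hcE : Continuous fun r => cubeEnergy a R (fun x => η x * u r x ^ α) :=
    continuous_cubeEnergy fun x => continuous_const.mul (hcw x)
  have hcR : Continuous fun r => cutoffError a R η (fun x => u r x ^ α) := continuous_cutoffError hcw η
  have hcF : Continuous fun r => ∑ x ∈ cube d R, (η x * u r x ^ α) ^ 2 :=
    continuous_finsetSum _ fun x _ => (continuous_const.mul (hcw x)).pow 2
  have hE0 : ∀ r, 0 ≤ cubeEnergy a R (fun x => η x * u r x ^ α) := fun r => cubeEnergy_nonneg ha _ _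
  have hR0 : ∀ r, 0 ≤ cutoffError a R η (fun x => u r x ^ α) := fun r => cutoffError_nonneg ha _ _
  have hF0 : ∀ r, 0 ≤ ∑ x ∈ cube d R, (η x * u r x ^ α) ^ 2 := fun r => Finset.sum_nonneg fun _ _ => sq_nonneg _
  set A := (∑ x ∈ cube d R, (η x * u t x ^ α) ^ 2) +
        1 / 2 * ∫ r in T₂..t, cubeEnergy a R (fun x => η x * u r x ^ α) with hA
  set B := 5 * α ^ 2 * ∫ r in T₁..t₀, cutoffError a R η (fun x => u r x ^ α) with hB
  -- The estimate holds from every starting time in `[T₁, T₂]`. Averaging over the starting time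
  -- replaces the initial mass by a time integral, so no cutoff in time is needed.
  have hstep : ∀ s ∈ Set.Icc T₁ T₂, A - B ≤ ∑ x ∈ cube d R, (η x * u s x ^ α) ^ 2 := by
    intro s hs
    have h1 := hu.energy_step ha hη hα hs.1 (hs.2.trans hTt) ht
    have h2 : ∫ r in T₂..t, cubeEnergy a R (fun x => η x * u r x ^ α) ≤
        ∫ r in s..t, cubeEnergy a R (fun x => η x * u r x ^ α) :=
      intervalIntegral.integral_mono_interval hs.2 hTt le_rfl (Filter.Eventually.of_forall hE0)
        (hcE.intervalIntegrable _ _)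
    have h3 : ∫ r in s..t, cutoffError a R η (fun x => u r x ^ α) ≤
        ∫ r in T₁..t₀, cutoffError a R η (fun x => u r x ^ α) :=
      intervalIntegral.integral_mono_interval hs.1 (hs.2.trans hTt) ht (Filter.Eventually.of_forall hR0)
        (hcR.intervalIntegrable _ _)
    have h4 : 5 * α ^ 2 * ∫ r in s..t, cutoffError a R η (fun x => u r x ^ α) ≤ B :=
      mul_le_mul_of_nonneg_left h3 (by positivity)
    linarith
  have h5 : ∫ _r in T₁..T₂, (A - B) ≤ ∫ r in T₁..T₂, ∑ x ∈ cube d R, (η x * u r x ^ α) ^ 2 :=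
    intervalIntegral.integral_mono_on hT.le (by simp) (hcF.intervalIntegrable _ _) hstep
  have h6 : ∫ r in T₁..T₂, ∑ x ∈ cube d R, (η x * u r x ^ α) ^ 2 ≤
      ∫ r in T₁..t₀, ∑ x ∈ cube d R, (η x * u r x ^ α) ^ 2 :=
    intervalIntegral.integral_mono_interval le_rfl hT.le (hTt.trans ht) (Filter.Eventually.of_forall hF0)
      (hcF.intervalIntegrable _ _)
  rw [intervalIntegral.integral_const, smul_eq_mul] at h5
  have h7 : A - B ≤ (T₂ - T₁)⁻¹ * ∫ r in T₁..t₀, ∑ x ∈ cube d R, (η x * u r x ^ α) ^ 2 := by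
    rw [← div_eq_inv_mul, le_div_iff₀ (sub_pos.2 hT), mul_comm]
    exact h5.trans h6
  linarith
end

/-! ### Good layers and layered cutoff functions -/

noncomputable section

/-- Hölder's inequality in time. As both integrals are positive, it suffices to integrate the
weighted arithmetic-geometric mean inequality for `f/F` and `g/G`. -/
theorem integral_rpow_mul_rpow_le {f g : ℝ → ℝ} (hf : Continuous f) (hg : Continuous g)
    (hf0 : ∀ t, 0 < f t) (hg0 : ∀ t, 0 < g t) {T₁ t₀ lam : ℝ} (hT : T₁ < t₀) (h0 : 0 ≤ lam) (h1 : lam ≤ 1) :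
    ∫ t in T₁..t₀, f t ^ lam * g t ^ (1 - lam) ≤
      (∫ t in T₁..t₀, f t) ^ lam * (∫ t in T₁..t₀, g t) ^ (1 - lam) := by
  have hF : 0 < ∫ t in T₁..t₀, f t :=
    intervalIntegral.intervalIntegral_pos_of_pos (hf.intervalIntegrable _ _) hf0 hT
  have hG : 0 < ∫ t in T₁..t₀, g t :=
    intervalIntegral.intervalIntegral_pos_of_pos (hg.intervalIntegrable _ _) hg0 hT
  set F := ∫ t in T₁..t₀, f t with hFd
  set G := ∫ t in T₁..t₀, g t with hGd
  have hle : ∀ t ∈ Set.Icc T₁ t₀, f t ^ lam * g t ^ (1 - lam) ≤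
      F ^ lam * G ^ (1 - lam) * (lam / F * f t + (1 - lam) / G * g t) := by
    intro t _
    have h := Real.geom_mean_le_arith_mean2_weighted h0 (sub_nonneg.2 h1)
      (div_nonneg (hf0 t).le hF.le) (div_nonneg (hg0 t).le hG.le) (by ring)
    rw [Real.div_rpow (hf0 t).le hF.le, Real.div_rpow (hg0 t).le hG.le, div_mul_div_comm,
      div_le_iff₀ (by positivity)] at h
    calc _ ≤ _ := h
      _ = _ := by ring
  have hcf : Continuous fun t => f t ^ lam * g t ^ (1 - lam) :=
    (hf.rpow_const fun t => Or.inl (hf0 t).ne').mul (hg.rpow_const fun t => Or.inl (hg0 t).ne')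
  refine (intervalIntegral.integral_mono_on hT.le (hcf.intervalIntegrable _ _)
    (Continuous.intervalIntegrable (by fun_prop) _ _) hle).trans (le_of_eq ?_)
  rw [intervalIntegral.integral_const_mul, intervalIntegral.integral_add
    (Continuous.intervalIntegrable (by fun_prop) _ _) (Continuous.intervalIntegrable (by fun_prop) _ _),
    intervalIntegral.integral_const_mul, intervalIntegral.integral_const_mul, ← hFd, ← hGd]
  field_simp
  ring

/-- Chebyshev: a large set of indices on which four quantities are bounded by their averages. -/
theorem exists_good_indices {ι : Type*} (s : Finset ι) (f : Fin 4 → ι → ℝ) (B : Fin 4 → ℝ)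
    (hf : ∀ k, ∀ i ∈ s, 0 ≤ f k i) (hB : ∀ k, ∑ i ∈ s, f k i ≤ B k) :
    ∃ G ⊆ s, (s.card : ℝ) ≤ 2 * G.card ∧ ∀ k, ∀ i ∈ G, f k i * s.card ≤ 8 * B k := by
  classical
  -- Each of the four exceptional sets contains at most an eighth of the indices, so at least half
  -- of the indices survive.
  let bad : Fin 4 → Finset ι := fun k => s.filter fun i => 8 * B k < f k i * s.card
  have hbad : ∀ k, 8 * ((bad k).card : ℝ) ≤ s.card := by
    intro k
    by_contra! hc
    have hne : (bad k).Nonempty := by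
      rw [Finset.nonempty_iff_ne_empty]; rintro h
      rw [h] at hc; simp at hc
      have : (0:ℝ) ≤ s.card := Nat.cast_nonneg _
      linarith
    have h1 : ((bad k).card : ℝ) * (8 * B k) < ∑ i ∈ bad k, f k i * s.card := by
      rw [← nsmul_eq_mul, ← Finset.sum_const]
      exact Finset.sum_lt_sum_of_nonempty hne fun i hi => (Finset.mem_filter.1 hi).2
    have h2 : ∑ i ∈ bad k, f k i * s.card ≤ B k * s.card := by
      rw [← Finset.sum_mul]
      refine mul_le_mul_of_nonneg_right (le_trans ?_ (hB k)) (Nat.cast_nonneg _)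
      exact Finset.sum_le_sum_of_subset_of_nonneg (Finset.filter_subset _ _) fun i hi _ => hf k i hi
    have hB0 : 0 ≤ B k := (Finset.sum_nonneg (hf k)).trans (hB k)
    have h3 := mul_le_mul_of_nonneg_right hc.le hB0
    linarith
  refine ⟨s \ Finset.univ.biUnion bad, Finset.sdiff_subset, ?_, ?_⟩
  · have h1 : s.card ≤ (s \ Finset.univ.biUnion bad).card + ∑ k, (bad k).card := by
      have := Finset.card_le_card_sdiff_add_card (s := s) (t := Finset.univ.biUnion bad)
      exact this.trans (Nat.add_le_add_left Finset.card_biUnion_le _)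
    have h2 : (s.card : ℝ) ≤ (s \ Finset.univ.biUnion bad).card + ∑ k, ((bad k).card : ℝ) := by
      exact_mod_cast h1
    have h3 : ∑ k, ((bad k).card : ℝ) ≤ ∑ _k : Fin 4, (s.card : ℝ) / 8 :=
      Finset.sum_le_sum fun k _ => by linarith [hbad k]
    simp at h3
    linarith
  · intro k i hi
    rw [Finset.mem_sdiff, Finset.mem_biUnion] at hi
    by_contra! hc
    exact hi.2 ⟨k, Finset.mem_univ _, Finset.mem_filter.2 ⟨hi.1, hc⟩⟩

/-- The index of the layer of the bond between the heights `h` and `h + 1`. -/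
def layer (h : ℤ) : ℤ := if 0 ≤ h then h else -h - 1

/-- One-dimensional cutoff function that drops, in equal parts, at the layers in `G`. -/
def layerCutoff (G : Finset ℤ) (h : ℤ) : ℝ := ((G.filter fun r => |h| ≤ r).card : ℝ) / G.card

theorem layerCutoff_nonneg (G : Finset ℤ) (h : ℤ) : 0 ≤ layerCutoff G h := by
  unfold layerCutoff; positivity

theorem layerCutoff_le_one (G : Finset ℤ) (h : ℤ) : layerCutoff G h ≤ 1 := by
  unfold layerCutoff
  exact div_le_one_of_le₀ (by exact_mod_cast Finset.card_le_card (Finset.filter_subset _ _)) (Nat.cast_nonneg _)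

theorem layerCutoff_eq_one {G : Finset ℤ} (hG : G.Nonempty) {h : ℤ} (hh : ∀ r ∈ G, |h| ≤ r) :
    layerCutoff G h = 1 := by
  unfold layerCutoff
  rw [Finset.filter_true_of_mem hh, div_self]
  exact_mod_cast hG.card_pos.ne'

theorem layerCutoff_eq_zero {G : Finset ℤ} {h : ℤ} (hh : ∀ r ∈ G, r < |h|) : layerCutoff G h = 0 := by
  unfold layerCutoff
  rw [Finset.filter_false_of_mem fun r hr => not_le.2 (hh r hr)]
  simp

/-- The numbers `|h|` and `|h+1|` are `layer h` and `layer h + 1` in some order. The two counts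
therefore differ only by the possible element `layer h` of `G`. -/
theorem sq_layerCutoff_sub_le (G : Finset ℤ) (h : ℤ) :
    (layerCutoff G (h + 1) - layerCutoff G h) ^ 2 ≤ if layer h ∈ G then ((G.card : ℝ) ^ 2)⁻¹ else 0 := by
  have key : ∀ k : ℤ, 0 ≤ k → (G.filter fun r => k ≤ r).card =
      (G.filter fun r => k + 1 ≤ r).card + if k ∈ G then 1 else 0 := by
    intro k hk
    have h1 : G.filter (fun r => k ≤ r) = G.filter (fun r => k + 1 ≤ r) ∪ G.filter (fun r => r = k) := by
      ext r; simp only [Finset.mem_filter, Finset.mem_union]; constructor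
      · rintro ⟨hr, h⟩
        rcases h.eq_or_lt with rfl | h
        · exact Or.inr ⟨hr, rfl⟩
        · exact Or.inl ⟨hr, h⟩
      · rintro (⟨hr, h⟩ | ⟨hr, h⟩)
        · exact ⟨hr, by omega⟩
        · exact ⟨hr, by omega⟩
    rw [h1, Finset.card_union_of_disjoint]
    · congr 1
      rw [Finset.filter_eq']
      split_ifs <;> simp
    · rw [Finset.disjoint_filter]
      intro r _ h2 h3; omega
  have hk : (layerCutoff G (h + 1) - layerCutoff G h) ^ 2 = (if layer h ∈ G then (1:ℝ) / G.card else 0) ^ 2 := by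
    unfold layer
    split_ifs with h0 h1 h1
    · unfold layerCutoff
      rw [abs_of_nonneg h0, abs_of_nonneg (by omega : 0 ≤ h + 1), key h h0, if_pos h1]
      push_cast; ring
    · unfold layerCutoff
      rw [abs_of_nonneg h0, abs_of_nonneg (by omega : 0 ≤ h + 1), key h h0, if_neg h1]
      push_cast; ring
    · unfold layerCutoff
      have := key (-h - 1) (by omega)
      rw [if_pos h1] at this
      rw [abs_of_nonpos (by omega : h ≤ 0), abs_of_nonpos (by omega : h + 1 ≤ 0), show -(h + 1) = -h - 1 by ring, this,
        show -h - 1 + 1 = -h by ring]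
      push_cast; ring
    · unfold layerCutoff
      have := key (-h - 1) (by omega)
      rw [if_neg h1] at this
      rw [abs_of_nonpos (by omega : h ≤ 0), abs_of_nonpos (by omega : h + 1 ≤ 0), show -(h + 1) = -h - 1 by ring, this,
        show -h - 1 + 1 = -h by ring]
      push_cast; ring
  rw [hk]
  split_ifs
  · rw [div_pow, one_pow, one_div]
  · simp

/-- Product cutoff function. -/
def productCutoff {d : ℕ} (G : Fin d → Finset ℤ) (x : Fin d → ℤ) : ℝ := ∏ i, layerCutoff (G i) (x i)

theorem productCutoff_nonneg {d : ℕ} (G : Fin d → Finset ℤ) (x : Fin d → ℤ) : 0 ≤ productCutoff G x :=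
  Finset.prod_nonneg fun _ _ => layerCutoff_nonneg _ _

theorem productCutoff_le_one {d : ℕ} (G : Fin d → Finset ℤ) (x : Fin d → ℤ) : productCutoff G x ≤ 1 :=
  Finset.prod_le_one (fun _ _ => layerCutoff_nonneg _ _) fun _ _ => layerCutoff_le_one _ _

/-- A step in direction `j` changes only the `j`-th factor; the other factors lie in `[0,1]`. -/
theorem sq_productCutoff_sub_le {d : ℕ} (G : Fin d → Finset ℤ) (x : Fin d → ℤ) (j : Fin d) :
    (productCutoff G (x + unitVec j) - productCutoff G x) ^ 2 ≤
      if layer (x j) ∈ G j then (((G j).card : ℝ) ^ 2)⁻¹ else 0 := by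
  refine le_trans ?_ (sq_layerCutoff_sub_le (G j) (x j))
  unfold productCutoff
  rw [← Finset.mul_prod_erase _ _ (Finset.mem_univ j), ← Finset.mul_prod_erase _ (fun i => layerCutoff (G i) (x i)) (Finset.mem_univ j)]
  have h1 : ∏ i ∈ Finset.univ.erase j, layerCutoff (G i) ((x + unitVec j) i) =
      ∏ i ∈ Finset.univ.erase j, layerCutoff (G i) (x i) := by
    refine Finset.prod_congr rfl fun i hi => ?_
    simp [unitVec, Finset.ne_of_mem_erase hi]
  rw [h1, ← sub_mul, mul_pow]
  have h2 : (∏ i ∈ Finset.univ.erase j, layerCutoff (G i) (x i)) ^ 2 ≤ 1 :=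
    pow_le_one₀ (Finset.prod_nonneg fun _ _ => layerCutoff_nonneg _ _)
      (Finset.prod_le_one (fun _ _ => layerCutoff_nonneg _ _) fun _ _ => layerCutoff_le_one _ _)
  have h3 : (x + unitVec j) j = x j + 1 := by simp [unitVec]
  rw [h3]
  exact mul_le_of_le_one_right (sq_nonneg _) h2

/-- The error produced by a single layer. -/
def layerError {d : ℕ} (a : Fin d → (Fin d → ℤ) → ℝ) (R : ℤ) (w : (Fin d → ℤ) → ℝ) (j : Fin d) (r : ℤ) : ℝ :=
  ∑ x ∈ cubeEdges d R j, if layer (x j) = r then a j x * (w x ^ 2 + w (x + unitVec j) ^ 2) else 0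

/-- The cutoff has steps of height `1/|G j|`, at the layers in `G j` only. A uniform bound on the
chosen layer errors thus yields `|G j|⁻¹` times that bound for each direction, and no layer outside
`G j` matters. -/
theorem cutoffError_productCutoff_le {d : ℕ} {a : Fin d → (Fin d → ℤ) → ℝ} (ha : ∀ j x, 0 < a j x) (R : ℤ)
    (G : Fin d → Finset ℤ) (w : (Fin d → ℤ) → ℝ) :
    cutoffError a R (productCutoff G) w ≤ ∑ j, (((G j).card : ℝ) ^ 2)⁻¹ * ∑ r ∈ G j, layerError a R w j r := by
  unfold cutoffError layerError
  refine Finset.sum_le_sum fun j _ => ?_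
  rw [Finset.sum_comm, Finset.mul_sum]
  refine Finset.sum_le_sum fun x _ => ?_
  rw [Finset.sum_ite_eq]
  have h := sq_productCutoff_sub_le G x j
  have hn : 0 ≤ a j x * (w x ^ 2 + w (x + unitVec j) ^ 2) := mul_nonneg (ha j x).le (by positivity)
  calc _ = (productCutoff G (x + unitVec j) - productCutoff G x) ^ 2 * (a j x * (w x ^ 2 + w (x + unitVec j) ^ 2)) := by ring
    _ ≤ _ := mul_le_mul_of_nonneg_right h hn
    _ = _ := by split_ifs <;> simp

theorem productCutoff_eq_one {d : ℕ} {G : Fin d → Finset ℤ} (hG : ∀ i, (G i).Nonempty) {R₁ R₂ : ℤ}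
    (hsub : ∀ i, G i ⊆ Finset.Ico R₁ R₂) {x : Fin d → ℤ} (hx : x ∈ cube d R₁) : productCutoff G x = 1 := by
  refine Finset.prod_eq_one fun i _ => layerCutoff_eq_one (hG i) fun r hr => ?_
  have h1 := Finset.mem_Ico.1 (hsub i hr)
  have h2 := mem_cube.1 hx i
  rw [abs_le]; omega

/-- The largest possible level is `R₂ - 1`. This provides the margin of one layer needed for the
summation by parts in the cube of radius `R₂`. -/
theorem productCutoff_eq_zero {d : ℕ} {G : Fin d → Finset ℤ} {R₁ R₂ : ℤ}
    (hsub : ∀ i, G i ⊆ Finset.Ico R₁ R₂) {x : Fin d → ℤ} (hx : x ∉ cube d (R₂ - 1)) : productCutoff G x = 0 := by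
  rw [mem_cube] at hx
  push Not at hx
  obtain ⟨i, hi⟩ := hx
  refine Finset.prod_eq_zero (Finset.mem_univ i) (layerCutoff_eq_zero fun r hr => ?_)
  have h1 := Finset.mem_Ico.1 (hsub i hr)
  rw [lt_abs]
  by_contra! hc
  have := hi (by omega)
  omega
end

/-! ### Decomposition of the cube into slices -/

noncomputable section

/-- The point with `j`-th coordinate `h` and remaining coordinates `y`. -/
def slicePt {D : ℕ} (j : Fin (D + 1)) (h : ℤ) (y : Fin D → ℤ) : Fin (D + 1) → ℤ :=
  Fin.insertNth (α := fun _ => ℤ) j h y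

theorem slicePt_same {D : ℕ} (j : Fin (D + 1)) (h : ℤ) (y : Fin D → ℤ) : slicePt j h y j = h := by
  simp [slicePt]

theorem slicePt_succAbove {D : ℕ} (j : Fin (D + 1)) (h : ℤ) (y : Fin D → ℤ) (k : Fin D) :
    slicePt j h y (j.succAbove k) = y k := by
  simp [slicePt]

theorem slicePt_add_unitVec {D : ℕ} (j : Fin (D + 1)) (h : ℤ) (y : Fin D → ℤ) :
    slicePt j h y + unitVec j = slicePt j (h + 1) y := by
  ext i
  rcases Fin.eq_self_or_eq_succAbove j i with rfl | ⟨k, rfl⟩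
  · simp [slicePt_same, unitVec]
  · simp [slicePt_succAbove, unitVec, Fin.succAbove_ne]

theorem slicePt_add_unitVec_succAbove {D : ℕ} (j : Fin (D + 1)) (h : ℤ) (y : Fin D → ℤ) (k : Fin D) :
    slicePt j h y + unitVec (j.succAbove k) = slicePt j h (y + unitVec k) := by
  ext i
  rcases Fin.eq_self_or_eq_succAbove j i with rfl | ⟨l, rfl⟩
  · simp [slicePt_same, unitVec, (Fin.succAbove_ne _ _).symm]
  · simp only [Pi.add_apply, slicePt_succAbove, unitVec, Pi.single_apply, Fin.succAbove_right_inj]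

theorem slicePt_mem_cube {D : ℕ} {j : Fin (D + 1)} {h : ℤ} {y : Fin D → ℤ} {R : ℤ} :
    slicePt j h y ∈ cube (D + 1) R ↔ h ∈ Finset.Icc (-R) R ∧ y ∈ cube D R := by
  simp only [mem_cube, Finset.mem_Icc, Fin.forall_iff_succAbove j, slicePt_same, slicePt_succAbove]

theorem sum_cube_slices {D : ℕ} (j : Fin (D + 1)) (R : ℤ) (F : (Fin (D + 1) → ℤ) → ℝ) :
    ∑ x ∈ cube (D + 1) R, F x = ∑ h ∈ Finset.Icc (-R) R, ∑ y ∈ cube D R, F (slicePt j h y) := by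
  rw [← Finset.sum_product']
  symm
  refine Finset.sum_bij' (fun z _ => slicePt j z.1 z.2) (fun x _ => (x j, fun k => x (j.succAbove k))) ?_ ?_ ?_ ?_ ?_
  · intro z hz
    rw [slicePt_mem_cube]
    exact Finset.mem_product.1 hz
  · intro x hx
    rw [mem_cube] at hx
    rw [Finset.mem_product, Finset.mem_Icc, mem_cube]
    exact ⟨hx j, fun k => hx _⟩
  · intro z _
    simp [slicePt_same, slicePt_succAbove]
  · intro x _
    ext i
    rcases Fin.eq_self_or_eq_succAbove j i with rfl | ⟨k, rfl⟩
    · simp [slicePt_same]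
    · simp [slicePt_succAbove]
  · intro z _; rfl

theorem sum_cubeEdges_slices {D : ℕ} (j : Fin (D + 1)) (R : ℤ) (F : (Fin (D + 1) → ℤ) → ℝ) :
    ∑ x ∈ cubeEdges (D + 1) R j, F x = ∑ h ∈ Finset.Ico (-R) R, ∑ y ∈ cube D R, F (slicePt j h y) := by
  rw [cubeEdges, Finset.sum_filter, sum_cube_slices j]
  have : Finset.Ico (-R) R = (Finset.Icc (-R) R).filter fun h => h < R := by
    ext h; simp only [Finset.mem_Ico, Finset.mem_filter, Finset.mem_Icc]; omega
  rw [this, Finset.sum_filter]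
  refine Finset.sum_congr rfl fun h _ => ?_
  simp only [slicePt_same]
  split_ifs <;> simp

theorem sum_cubeEdges_succAbove_slices {D : ℕ} (j : Fin (D + 1)) (k : Fin D) (R : ℤ) (F : (Fin (D + 1) → ℤ) → ℝ) :
    ∑ x ∈ cubeEdges (D + 1) R (j.succAbove k), F x =
      ∑ h ∈ Finset.Icc (-R) R, ∑ y ∈ cubeEdges D R k, F (slicePt j h y) := by
  rw [cubeEdges, Finset.sum_filter, sum_cube_slices j]
  refine Finset.sum_congr rfl fun h _ => ?_
  rw [cubeEdges, Finset.sum_filter]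
  simp only [slicePt_succAbove]

/-- The weights of the bonds inside a slice. -/
def sliceWeight {D : ℕ} (a : Fin (D + 1) → (Fin (D + 1) → ℤ) → ℝ) (j : Fin (D + 1)) (h : ℤ) :
    Fin D → (Fin D → ℤ) → ℝ := fun k y => a (j.succAbove k) (slicePt j h y)

/-- The slices orthogonal to direction `j` contain exactly the bonds in the other directions; the
bonds in direction `j` are discarded. -/
theorem sum_sliceWeight_le {D : ℕ} {a : Fin (D + 1) → (Fin (D + 1) → ℤ) → ℝ} (ha : ∀ j x, 0 < a j x)
    (j : Fin (D + 1)) (R : ℤ) (r : ℝ) :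
    ∑ h ∈ Finset.Icc (-R) R, weightSum (sliceWeight a j h) R r ≤ weightSum a R r := by
  unfold weightSum
  rw [Finset.sum_comm, Fin.sum_univ_succAbove _ j]
  refine le_add_of_nonneg_of_le (Finset.sum_nonneg fun x _ => Real.rpow_nonneg (ha _ _).le _)
    (Finset.sum_le_sum fun k _ => le_of_eq ?_)
  rw [sum_cubeEdges_succAbove_slices]
  rfl

theorem sum_sliceEnergy_le {D : ℕ} {a : Fin (D + 1) → (Fin (D + 1) → ℤ) → ℝ} (ha : ∀ j x, 0 < a j x)
    (j : Fin (D + 1)) (R : ℤ) (w : (Fin (D + 1) → ℤ) → ℝ) :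
    ∑ h ∈ Finset.Icc (-R) R, cubeEnergy (sliceWeight a j h) R (fun y => w (slicePt j h y)) ≤ cubeEnergy a R w := by
  unfold cubeEnergy
  rw [Finset.sum_comm, Fin.sum_univ_succAbove _ j]
  refine le_add_of_nonneg_of_le (Finset.sum_nonneg fun x _ => mul_nonneg (ha _ _).le (sq_nonneg _))
    (Finset.sum_le_sum fun k _ => le_of_eq ?_)
  rw [sum_cubeEdges_succAbove_slices]
  simp only [slicePt_add_unitVec_succAbove, sliceWeight]

theorem sum_sliceRadial_le {D : ℕ} {a : Fin (D + 1) → (Fin (D + 1) → ℤ) → ℝ} (ha : ∀ j x, 0 < a j x)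
    (j : Fin (D + 1)) (R : ℤ) (r : ℝ) :
    ∑ h ∈ Finset.Ico (-R) R, ∑ y ∈ cube D R, a j (slicePt j h y) ^ r ≤ weightSum a R r := by
  rw [← sum_cubeEdges_slices j R (fun x => a j x ^ r)]
  exact Finset.single_le_sum (f := fun j => ∑ x ∈ cubeEdges (D + 1) R j, a j x ^ r)
    (fun j _ => Finset.sum_nonneg fun x _ => Real.rpow_nonneg (ha _ _).le _) (Finset.mem_univ j)

/-- A layer consists of two sheets of parallel bonds, exchanged by reflection. Their end-points fill
the four slices at heights `r`, `r + 1`, `-r - 1` and `-r`. -/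
theorem layerError_eq {D : ℕ} (a : Fin (D + 1) → (Fin (D + 1) → ℤ) → ℝ) {R : ℤ}
    (w : (Fin (D + 1) → ℤ) → ℝ) (j : Fin (D + 1)) {r : ℤ} (hr : r ∈ Finset.Ico 0 R) :
    layerError a R w j r =
      ∑ y ∈ cube D R, a j (slicePt j r y) * (w (slicePt j r y) ^ 2 + w (slicePt j (r + 1) y) ^ 2) +
      ∑ y ∈ cube D R, a j (slicePt j (-r - 1) y) * (w (slicePt j (-r - 1) y) ^ 2 + w (slicePt j (-r) y) ^ 2) := by
  rw [Finset.mem_Ico] at hr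
  unfold layerError
  rw [sum_cubeEdges_slices j]
  simp only [slicePt_same, slicePt_add_unitVec]
  have h1 : ∑ h ∈ Finset.Ico (-R) R, ∑ y ∈ cube D R, (if layer h = r then a j (slicePt j h y) *
        (w (slicePt j h y) ^ 2 + w (slicePt j (h + 1) y) ^ 2) else 0) =
      ∑ h ∈ (Finset.Ico (-R) R).filter (fun h => layer h = r), ∑ y ∈ cube D R, a j (slicePt j h y) *
        (w (slicePt j h y) ^ 2 + w (slicePt j (h + 1) y) ^ 2) := by
    rw [Finset.sum_filter]
    refine Finset.sum_congr rfl fun h _ => ?_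
    split_ifs <;> simp
  have h2 : (Finset.Ico (-R) R).filter (fun h => layer h = r) = {r, -r - 1} := by
    ext h
    rw [Finset.mem_filter, Finset.mem_Ico, Finset.mem_insert, Finset.mem_singleton]
    unfold layer
    split_ifs <;> omega
  rw [h1, h2, Finset.sum_pair (by omega), show -r - 1 + 1 = -r by ring]

/-- Summation over the four heights belonging to a layer. -/
theorem sum_four_heights_le {R₁ R : ℤ} (h0 : 0 ≤ R₁) (X : ℤ → ℝ) (hX : ∀ h, 0 ≤ X h) :
    ∑ r ∈ Finset.Ico R₁ R, (X r + X (r + 1) + X (-r - 1) + X (-r)) ≤ 4 * ∑ h ∈ Finset.Icc (-R) R, X h := by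
  have key : ∀ f : ℤ → ℤ, Function.Injective f → (∀ r ∈ Finset.Ico R₁ R, f r ∈ Finset.Icc (-R) R) →
      ∑ r ∈ Finset.Ico R₁ R, X (f r) ≤ ∑ h ∈ Finset.Icc (-R) R, X h := by
    intro f hf hm
    rw [← Finset.sum_image (f := X) (g := f) (fun x _ y _ h => hf h)]
    refine Finset.sum_le_sum_of_subset_of_nonneg ?_ fun h _ _ => hX h
    intro y hy
    obtain ⟨x, hx, rfl⟩ := Finset.mem_image.1 hy
    exact hm x hx
  rw [Finset.sum_add_distrib, Finset.sum_add_distrib, Finset.sum_add_distrib]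
  have k1 := key (fun r => r) (fun _ _ h => h) (fun r hr => by
    rw [Finset.mem_Ico] at hr; rw [Finset.mem_Icc]; omega)
  have k2 := key (fun r => r + 1) (fun _ _ h => by simpa using h) (fun r hr => by
    rw [Finset.mem_Ico] at hr; rw [Finset.mem_Icc]; omega)
  have k3 := key (fun r => -r - 1) (fun _ _ h => by simpa using h) (fun r hr => by
    rw [Finset.mem_Ico] at hr; rw [Finset.mem_Icc]; omega)
  have k4 := key (fun r => -r) (fun _ _ h => by simpa using h) (fun r hr => by
    rw [Finset.mem_Ico] at hr; rw [Finset.mem_Icc]; omega)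
  linarith

theorem sum_two_heights_le {R₁ R : ℤ} (h0 : 0 ≤ R₁) (X : ℤ → ℝ) (hX : ∀ h, 0 ≤ X h) :
    ∑ r ∈ Finset.Ico R₁ R, (X r + X (-r - 1)) ≤ 2 * ∑ h ∈ Finset.Ico (-R) R, X h := by
  have key : ∀ f : ℤ → ℤ, Function.Injective f → (∀ r ∈ Finset.Ico R₁ R, f r ∈ Finset.Ico (-R) R) →
      ∑ r ∈ Finset.Ico R₁ R, X (f r) ≤ ∑ h ∈ Finset.Ico (-R) R, X h := by
    intro f hf hm
    rw [← Finset.sum_image (f := X) (g := f) (fun x _ y _ h => hf h)]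
    refine Finset.sum_le_sum_of_subset_of_nonneg ?_ fun h _ _ => hX h
    intro y hy
    obtain ⟨x, hx, rfl⟩ := Finset.mem_image.1 hy
    exact hm x hx
  rw [Finset.sum_add_distrib]
  have k1 := key (fun r => r) (fun _ _ h => h) (fun r hr => by
    rw [Finset.mem_Ico] at hr ⊢; omega)
  have k3 := key (fun r => -r - 1) (fun _ _ h => by simpa using h) (fun r hr => by
    rw [Finset.mem_Ico] at hr ⊢; omega)
  linarith
end

/-! ### The cutoff adapted to the weights and the solution -/

noncomputable section

/-- The interpolation inequality on cubes of dimension `D` with constant `C`. -/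
def SliceInequality (D : ℕ) (p q lam C : ℝ) : Prop :=
  ∀ R : ℤ, 0 ≤ R → ∀ a : Fin D → (Fin D → ℤ) → ℝ, (∀ j x, 0 < a j x) →
      ∀ w : (Fin D → ℤ) → ℝ, (∀ x, 0 ≤ w x) →
      (∑ x ∈ cube D R, w x ^ (2 * (p / (p - 1)))) ^ (1 - 1 / p) ≤
        C * (2 * (R : ℝ) + 1) ^ (-(D : ℝ) / p) * (∑ x ∈ cube D R, w x ^ 2) ^ lam *
          ((2 * (R : ℝ) + 1) ^ (2 - D / q) * weightSum a R (-q) ^ (1 / q) * cubeEnergy a R w +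
            ∑ x ∈ cube D R, w x ^ 2) ^ (1 - lam)

/-- Takes a constant out of a power at most one without keeping track of the exponent. -/
theorem mul_rpow_le_mul_rpow {c X e : ℝ} (hc : 1 ≤ c) (hX : 0 ≤ X) (he : e ≤ 1) :
    (c * X) ^ e ≤ c * X ^ e := by
  rw [Real.mul_rpow (by linarith) hX]
  refine mul_le_mul_of_nonneg_right ?_ (Real.rpow_nonneg hX _)
  calc c ^ e ≤ c ^ (1:ℝ) := Real.rpow_le_rpow_of_exponent_le hc he
    _ = c := Real.rpow_one c

variable {D : ℕ} {p q lam C : ℝ}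

/-- Here `b` stands for the weights of bonds leaving the slice and `a` for those inside it. Hölder's
inequality with `p` and `p/(p-1)` separates `b` from `w`. -/
theorem SliceInequality.sum_weight_mul_sq_le (hS : SliceInequality D p q lam C) (hp : 1 < p)
    {R : ℤ} (hR : 0 ≤ R) {a : Fin D → (Fin D → ℤ) → ℝ} (ha : ∀ j x, 0 < a j x) {b w : (Fin D → ℤ) → ℝ}
    (hb : ∀ x, 0 < b x) (hw : ∀ x, 0 ≤ w x) :
    ∑ y ∈ cube D R, b y * w y ^ 2 ≤ (∑ y ∈ cube D R, b y ^ p) ^ (1 / p) *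
      (C * (2 * (R : ℝ) + 1) ^ (-(D : ℝ) / p) * ((∑ x ∈ cube D R, w x ^ 2) ^ lam *
          ((2 * (R : ℝ) + 1) ^ (2 - D / q) * weightSum a R (-q) ^ (1 / q) * cubeEnergy a R w +
            ∑ x ∈ cube D R, w x ^ 2) ^ (1 - lam))) := by
  have hp1 : 0 < p - 1 := by linarith
  have hcq : Real.HolderConjugate p (p / (p - 1)) := by
    rw [Real.holderConjugate_iff]; refine ⟨hp, ?_⟩; field_simp; ring
  have h := Real.inner_le_Lp_mul_Lq_of_nonneg (cube D R) hcq (f := b) (g := fun y => w y ^ 2)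
    (fun x _ => (hb x).le) (fun x _ => sq_nonneg _)
  have e1 : ∀ x, (w x ^ 2) ^ (p / (p - 1)) = w x ^ (2 * (p / (p - 1))) := fun x => by
    rw [← Real.rpow_natCast (w x) 2, ← Real.rpow_mul (hw x)]; norm_num
  have e2 : 1 / (p / (p - 1)) = 1 - 1 / p := by field_simp
  simp only [e1, e2] at h
  refine h.trans (mul_le_mul_of_nonneg_left ?_ (Real.rpow_nonneg
    (Finset.sum_nonneg fun x _ => Real.rpow_nonneg (hb x).le _) _))
  rw [← mul_assoc]
  exact hS R hR a ha w hw

/-- The time-integrated version on a slice, with upper bounds for all the quantities. -/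
theorem SliceInequality.integral_sum_weight_mul_sq_le (hS : SliceInequality D p q lam C) (hp : 1 < p)
    (hq : 1 < q) (hC : 0 < C) (hl0 : 0 < lam) (hl1 : lam < 1)
    {R : ℤ} (hR : 0 ≤ R) {a : Fin D → (Fin D → ℤ) → ℝ} (ha : ∀ j x, 0 < a j x) {b : (Fin D → ℤ) → ℝ}
    (hb : ∀ x, 0 < b x) {w : ℝ → (Fin D → ℤ) → ℝ} (hw : ∀ t x, 0 < w t x) (hc : ∀ x, Continuous fun t => w t x)
    {T₁ t₀ : ℝ} (hT : T₁ < t₀) {A Q g E : ℝ} (hA : ∑ y ∈ cube D R, b y ^ p ≤ A)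
    (hQ : weightSum a R (-q) ≤ Q) (hg : ∫ t in T₁..t₀, ∑ x ∈ cube D R, w t x ^ 2 ≤ g)
    (hE : ∫ t in T₁..t₀, cubeEnergy a R (w t) ≤ E) :
    ∫ t in T₁..t₀, ∑ y ∈ cube D R, b y * w t y ^ 2 ≤ A ^ (1 / p) *
      (C * (2 * (R : ℝ) + 1) ^ (-(D : ℝ) / p) * (g ^ lam *
          ((2 * (R : ℝ) + 1) ^ (2 - D / q) * Q ^ (1 / q) * E + g) ^ (1 - lam))) := by
  have hRr : (0 : ℝ) ≤ R := by exact_mod_cast hR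
  set L : ℝ := 2 * (R : ℝ) + 1 with hL
  have hL0 : 0 < L := by linarith
  have hne : (cube D R).Nonempty := ⟨0, by rw [mem_cube]; intro i; simp [hR]⟩
  have hG0 : ∀ t, 0 < ∑ x ∈ cube D R, w t x ^ 2 := fun t => Finset.sum_pos (fun x _ => pow_pos (hw t x) 2) hne
  have hcG : Continuous fun t => ∑ x ∈ cube D R, w t x ^ 2 := continuous_finsetSum _ fun x _ => (hc x).pow 2
  have hcE : Continuous fun t => cubeEnergy a R (w t) := continuous_cubeEnergy hc
  have hQ0 := weightSum_nonneg ha R (-q)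
  set c := L ^ (2 - D / q) * weightSum a R (-q) ^ (1 / q) with hcd
  have hc0 : 0 ≤ c := mul_nonneg (Real.rpow_nonneg hL0.le _) (Real.rpow_nonneg hQ0 _)
  have hE0 : ∀ t, 0 ≤ cubeEnergy a R (w t) := fun t => cubeEnergy_nonneg ha R _
  have hZ0 : ∀ t, 0 < c * cubeEnergy a R (w t) + ∑ x ∈ cube D R, w t x ^ 2 := fun t =>
    add_pos_of_nonneg_of_pos (mul_nonneg hc0 (hE0 t)) (hG0 t)
  have hcZ : Continuous fun t => c * cubeEnergy a R (w t) + ∑ x ∈ cube D R, w t x ^ 2 :=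
    (continuous_const.mul hcE).add hcG
  have hA0 : 0 ≤ ∑ y ∈ cube D R, b y ^ p := Finset.sum_nonneg fun x _ => Real.rpow_nonneg (hb x).le _
  have h1 : ∫ t in T₁..t₀, ∑ y ∈ cube D R, b y * w t y ^ 2 ≤
      ∫ t in T₁..t₀, ((∑ y ∈ cube D R, b y ^ p) ^ (1 / p) * (C * L ^ (-(D : ℝ) / p))) *
        ((∑ x ∈ cube D R, w t x ^ 2) ^ lam * (c * cubeEnergy a R (w t) + ∑ x ∈ cube D R, w t x ^ 2) ^ (1 - lam)) := by
    refine intervalIntegral.integral_mono_on hT.le (Continuous.intervalIntegrable ?_ _ _)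
      (Continuous.intervalIntegrable ?_ _ _) fun t _ => ?_
    · exact continuous_finsetSum _ fun x _ => continuous_const.mul ((hc x).pow 2)
    · exact continuous_const.mul ((hcG.rpow_const fun t => Or.inl (hG0 t).ne').mul
        (hcZ.rpow_const fun t => Or.inl (hZ0 t).ne'))
    · rw [mul_assoc]
      exact hS.sum_weight_mul_sq_le hp hR ha hb fun x => (hw t x).le
  rw [intervalIntegral.integral_const_mul] at h1
  have h2 := integral_rpow_mul_rpow_le hcG hcZ hG0 hZ0 hT hl0.le hl1.le
  have hccE : Continuous fun t => c * cubeEnergy a R (w t) := continuous_const.mul hcE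
  rw [intervalIntegral.integral_add (hccE.intervalIntegrable _ _) (hcG.intervalIntegrable _ _),
    intervalIntegral.integral_const_mul] at h2
  have iG : 0 ≤ ∫ t in T₁..t₀, ∑ x ∈ cube D R, w t x ^ 2 :=
    intervalIntegral.integral_nonneg hT.le fun t _ => (hG0 t).le
  have iE : 0 ≤ ∫ t in T₁..t₀, cubeEnergy a R (w t) :=
    intervalIntegral.integral_nonneg hT.le fun t _ => hE0 t
  have hl : 0 < 1 - lam := sub_pos.2 hl1
  have hq0 : 0 < q := by linarith
  have hp0 : 0 < p := by linarith
  refine h1.trans ?_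
  rw [mul_assoc]
  refine mul_le_mul (Real.rpow_le_rpow hA0 hA (by positivity)) (mul_le_mul_of_nonneg_left (h2.trans ?_) (by positivity))
    (mul_nonneg (by positivity) (intervalIntegral.integral_nonneg hT.le fun t _ =>
      mul_nonneg (Real.rpow_nonneg (hG0 t).le _) (Real.rpow_nonneg (hZ0 t).le _)))
    (Real.rpow_nonneg (hA0.trans hA) _)
  refine mul_le_mul (Real.rpow_le_rpow iG hg hl0.le) (Real.rpow_le_rpow (by positivity) ?_ hl.le)
    (by positivity) (Real.rpow_nonneg (iG.trans hg) _)
  refine add_le_add (mul_le_mul ?_ hE iE ?_) hg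
  · exact mul_le_mul_of_nonneg_left (Real.rpow_le_rpow hQ0 hQ (by positivity)) (by positivity)
  · exact mul_nonneg (by positivity) (Real.rpow_nonneg (hQ0.trans hQ) _)

/-- Existence of a cutoff function adapted to the weights and to the function `w`. -/
theorem exists_adapted_cutoff (hS : SliceInequality D p q lam C) (hp : 1 < p)
    (hq : 1 < q) (hC : 0 < C) (hl0 : 0 < lam) (hl1 : lam < 1)
    {R₁ R : ℤ} (hR₁ : 0 ≤ R₁) (hR : R₁ < R) {a : Fin (D + 1) → (Fin (D + 1) → ℤ) → ℝ} (ha : ∀ j x, 0 < a j x)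
    {w : ℝ → (Fin (D + 1) → ℤ) → ℝ} (hw : ∀ t x, 0 < w t x) (hc : ∀ x, Continuous fun t => w t x)
    {T₁ t₀ : ℝ} (hT : T₁ < t₀) {P Q g E m : ℝ} (hP : weightSum a R p ≤ P)
    (hQ : weightSum a R (-q) ≤ Q) (hg : ∫ t in T₁..t₀, ∑ x ∈ cube (D + 1) R, w t x ^ 2 ≤ g)
    (hE : ∫ t in T₁..t₀, cubeEnergy a R (w t) ≤ E) (hm : m = (R : ℝ) - R₁) :
    ∃ η : (Fin (D + 1) → ℤ) → ℝ, (∀ x, 0 ≤ η x) ∧ (∀ x, η x ≤ 1) ∧ (∀ x ∈ cube (D + 1) R₁, η x = 1) ∧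
      (∀ x, x ∉ cube (D + 1) (R - 1) → η x = 0) ∧
      ∫ t in T₁..t₀, cutoffError a R η (w t) ≤ (D + 1) * 2 ^ 23 * C * (m⁻¹ * ((P / m) ^ (1 / p) *
        ((2 * (R : ℝ) + 1) ^ (-(D : ℝ) / p) * ((g / m) ^ lam *
          ((2 * (R : ℝ) + 1) ^ (2 - D / q) * (Q / m) ^ (1 / q) * (E / m) + g / m) ^ (1 - lam))))) := by
  have hR0 : 0 ≤ R := hR₁.trans hR.le
  have hRr : (0 : ℝ) ≤ R := by exact_mod_cast hR0
  have hm0 : 0 < m := by rw [hm, sub_pos]; exact_mod_cast hR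
  have hq0 : 0 < q := by linarith
  have hp0 : 0 < p := by linarith
  have hcard : ((Finset.Ico R₁ R).card : ℝ) = m := by
    rw [Int.card_Ico, hm]
    have : ((R - R₁).toNat : ℤ) = R - R₁ := Int.toNat_of_nonneg (by omega)
    have h2 : (((R - R₁).toNat : ℤ) : ℝ) = ((R - R₁ : ℤ) : ℝ) := by rw [this]
    push_cast at h2
    exact h2
  set L : ℝ := 2 * (R : ℝ) + 1 with hL
  have hL0 : 0 < L := by linarith
  have hP0 : 0 ≤ P := (weightSum_nonneg ha _ _).trans hP
  have hQ0 : 0 ≤ Q := (weightSum_nonneg ha _ _).trans hQ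
  have hg0 : 0 ≤ g := le_trans (intervalIntegral.integral_nonneg hT.le fun t _ =>
    Finset.sum_nonneg fun _ _ => sq_nonneg _) hg
  have hE0 : 0 ≤ E := le_trans (intervalIntegral.integral_nonneg hT.le fun t _ => cubeEnergy_nonneg ha _ _) hE
  have hl : 0 < 1 - lam := sub_pos.2 hl1
  set M := (P / m) ^ (1 / p) * (L ^ (-(D : ℝ) / p) * ((g / m) ^ lam *
    (L ^ (2 - D / q) * (Q / m) ^ (1 / q) * (E / m) + g / m) ^ (1 - lam))) with hM
  have hM0 : 0 ≤ M := by positivity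
  have hcs : ∀ j h y, Continuous fun t => w t (slicePt j h y) := fun j h y => hc _
  have hlay : ∀ j : Fin (D + 1), ∃ G ⊆ Finset.Ico R₁ R, m ≤ 2 * (G.card : ℝ) ∧
      ∀ r ∈ G, ∫ t in T₁..t₀, layerError a R (w t) j r ≤ 2 ^ 22 * C * M := by
    intro j
    let A : ℤ → ℝ := fun h => ∑ y ∈ cube D R, a j (slicePt j h y) ^ p
    let B : ℤ → ℝ := fun h => weightSum (sliceWeight a j h) R (-q)
    let g' : ℤ → ℝ := fun h => ∫ t in T₁..t₀, ∑ y ∈ cube D R, w t (slicePt j h y) ^ 2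
    let e : ℤ → ℝ := fun h => ∫ t in T₁..t₀, cubeEnergy (sliceWeight a j h) R (fun y => w t (slicePt j h y))
    have hsw : ∀ h k y, 0 < sliceWeight a j h k y := fun h k y => ha _ _
    have hA0 : ∀ h, 0 ≤ A h := fun h => Finset.sum_nonneg fun _ _ => Real.rpow_nonneg (ha _ _).le _
    have hB0 : ∀ h, 0 ≤ B h := fun h => weightSum_nonneg (hsw h) _ _
    have hg'0 : ∀ h, 0 ≤ g' h := fun h => intervalIntegral.integral_nonneg hT.le fun t _ =>
      Finset.sum_nonneg fun _ _ => sq_nonneg _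
    have he0 : ∀ h, 0 ≤ e h := fun h => intervalIntegral.integral_nonneg hT.le fun t _ =>
      cubeEnergy_nonneg (hsw h) _ _
    have sA : ∑ h ∈ Finset.Ico (-R) R, A h ≤ P := (sum_sliceRadial_le ha j R p).trans hP
    have sB : ∑ h ∈ Finset.Icc (-R) R, B h ≤ Q := (sum_sliceWeight_le ha j R (-q)).trans hQ
    have sg : ∑ h ∈ Finset.Icc (-R) R, g' h ≤ g := by
      have hcg : ∀ h, Continuous fun t => ∑ y ∈ cube D R, w t (slicePt j h y) ^ 2 := fun h =>
        continuous_finsetSum _ fun y _ => (hcs j h y).pow 2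
      rw [← intervalIntegral.integral_finsetSum fun h _ => (hcg h).intervalIntegrable _ _]
      refine le_trans (le_of_eq ?_) hg
      simp only [sum_cube_slices j]
    have se : ∑ h ∈ Finset.Icc (-R) R, e h ≤ E := by
      rw [← intervalIntegral.integral_finsetSum fun h _ => Continuous.intervalIntegrable
        (continuous_cubeEnergy fun y => hcs j h y) _ _]
      refine le_trans (intervalIntegral.integral_mono_on hT.le (Continuous.intervalIntegrable
        (continuous_finsetSum _ fun h _ => continuous_cubeEnergy fun y => hcs j h y) _ _)
        (Continuous.intervalIntegrable (continuous_cubeEnergy hc) _ _) fun t _ => ?_) hE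
      exact sum_sliceEnergy_le ha j R (w t)
    let four : (ℤ → ℝ) → ℤ → ℝ := fun X r => X r + X (r + 1) + X (-r - 1) + X (-r)
    -- The four quantities attached to a layer are the `p`-th powers of its bonds, and the inverse
    -- weights, the mass and the energy of the four adjacent slices.
    obtain ⟨G, hGs, hGc, hGb⟩ := exists_good_indices (Finset.Ico R₁ R)
      ![fun r => A r + A (-r - 1), four B, four g', four e] ![4 * P, 4 * Q, 4 * g, 4 * E]
      (by
        intro k r _
        fin_cases k
        · exact add_nonneg (hA0 _) (hA0 _)
        · exact add_nonneg (add_nonneg (add_nonneg (hB0 _) (hB0 _)) (hB0 _)) (hB0 _)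
        · exact add_nonneg (add_nonneg (add_nonneg (hg'0 _) (hg'0 _)) (hg'0 _)) (hg'0 _)
        · exact add_nonneg (add_nonneg (add_nonneg (he0 _) (he0 _)) (he0 _)) (he0 _))
      (by
        intro k
        fin_cases k
        · exact (sum_two_heights_le hR₁ A hA0).trans (by dsimp; linarith)
        · exact (sum_four_heights_le hR₁ B hB0).trans (by dsimp; linarith)
        · exact (sum_four_heights_le hR₁ g' hg'0).trans (by dsimp; linarith)
        · exact (sum_four_heights_le hR₁ e he0).trans (by dsimp; linarith))
    rw [hcard] at hGc
    refine ⟨G, hGs, hGc, fun r hr => ?_⟩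
    have hr' : r ∈ Finset.Ico 0 R := by
      have := Finset.mem_Ico.1 (hGs hr)
      rw [Finset.mem_Ico]; omega
    have bA : A r + A (-r - 1) ≤ 32 * (P / m) := by
      have := hGb 0 r hr
      rw [hcard] at this
      rw [← mul_div_assoc, le_div_iff₀ hm0]
      exact this.trans (le_of_eq (by simp; ring))
    have bB : four B r ≤ 32 * (Q / m) := by
      have := hGb 1 r hr
      rw [hcard] at this
      rw [← mul_div_assoc, le_div_iff₀ hm0]
      exact this.trans (le_of_eq (by simp; ring))
    have bg : four g' r ≤ 32 * (g / m) := by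
      have := hGb 2 r hr
      rw [hcard] at this
      rw [← mul_div_assoc, le_div_iff₀ hm0]
      exact this.trans (le_of_eq (by simp; ring))
    have be : four e r ≤ 32 * (E / m) := by
      have := hGb 3 r hr
      rw [hcard] at this
      rw [← mul_div_assoc, le_div_iff₀ hm0]
      exact this.trans (le_of_eq (by simp; ring))
    -- The factor `32` is `8` from Chebyshev's inequality times `4` from the four heights.
    -- Extracting the constants from the powers costs at most `32 · 32 · 1024 = 2^20`. The four
    -- terms of a layer then give `2^22`, and `|G|⁻¹ ≤ 2/m` gives the final `2^23`.
    have hterm : ∀ h h' : ℤ, A h ≤ 32 * (P / m) → B h' ≤ 32 * (Q / m) → g' h' ≤ 32 * (g / m) → e h' ≤ 32 * (E / m) →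
        ∫ t in T₁..t₀, ∑ y ∈ cube D R, a j (slicePt j h y) * w t (slicePt j h' y) ^ 2 ≤ 2 ^ 20 * C * M := by
      intro h h' iA iB ig ie
      refine (hS.integral_sum_weight_mul_sq_le hp hq hC hl0 hl1 hR0 (hsw h') (fun y => ha j (slicePt j h y))
        (fun t y => hw t _) (fun y => hcs j h' y) hT iA iB ig ie).trans ?_
      have k1 : (32 * (P / m)) ^ (1 / p) ≤ 32 * (P / m) ^ (1 / p) :=
        mul_rpow_le_mul_rpow (by norm_num) (by positivity) (by rw [div_le_one hp0]; exact hp.le)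
      have k2 : (32 * (g / m)) ^ lam ≤ 32 * (g / m) ^ lam :=
        mul_rpow_le_mul_rpow (by norm_num) (by positivity) hl1.le
      have k3 : (32 * (Q / m)) ^ (1 / q) ≤ 32 * (Q / m) ^ (1 / q) :=
        mul_rpow_le_mul_rpow (by norm_num) (by positivity) (by rw [div_le_one hq0]; exact hq.le)
      have k4 : (L ^ (2 - D / q) * (32 * (Q / m)) ^ (1 / q) * (32 * (E / m)) + 32 * (g / m)) ^ (1 - lam) ≤
          1024 * (L ^ (2 - D / q) * (Q / m) ^ (1 / q) * (E / m) + g / m) ^ (1 - lam) := by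
        refine le_trans (Real.rpow_le_rpow (by positivity) ?_ hl.le)
          (mul_rpow_le_mul_rpow (by norm_num) (by positivity) (by linarith))
        calc _ ≤ L ^ (2 - D / q) * (32 * (Q / m) ^ (1 / q)) * (32 * (E / m)) + 1024 * (g / m) := by
              have : 0 ≤ g / m := by positivity
              gcongr
              norm_num
          _ = _ := by ring
      calc _ ≤ (32 * (P / m) ^ (1 / p)) * (C * L ^ (-(D : ℝ) / p) * ((32 * (g / m) ^ lam) *
            (1024 * (L ^ (2 - D / q) * (Q / m) ^ (1 / q) * (E / m) + g / m) ^ (1 - lam)))) := by gcongr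
        _ = _ := by rw [hM]; ring
    have c1 : ∀ h h', Continuous fun t => ∑ y ∈ cube D R, a j (slicePt j h y) * w t (slicePt j h' y) ^ 2 :=
      fun h h' => continuous_finsetSum _ fun y _ => continuous_const.mul ((hcs j h' y).pow 2)
    have c2 : ∀ h h' k k', Continuous fun t => ∑ y ∈ cube D R, a j (slicePt j h y) * w t (slicePt j h' y) ^ 2 +
        ∑ y ∈ cube D R, a j (slicePt j k y) * w t (slicePt j k' y) ^ 2 := fun h h' k k' => (c1 h h').add (c1 k k')
    have hsplit : ∫ t in T₁..t₀, layerError a R (w t) j r =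
        (∫ t in T₁..t₀, ∑ y ∈ cube D R, a j (slicePt j r y) * w t (slicePt j r y) ^ 2) +
        (∫ t in T₁..t₀, ∑ y ∈ cube D R, a j (slicePt j r y) * w t (slicePt j (r + 1) y) ^ 2) +
        ((∫ t in T₁..t₀, ∑ y ∈ cube D R, a j (slicePt j (-r - 1) y) * w t (slicePt j (-r - 1) y) ^ 2) +
        (∫ t in T₁..t₀, ∑ y ∈ cube D R, a j (slicePt j (-r - 1) y) * w t (slicePt j (-r) y) ^ 2)) := by
      rw [← intervalIntegral.integral_add ((c1 _ _).intervalIntegrable _ _) ((c1 _ _).intervalIntegrable _ _),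
        ← intervalIntegral.integral_add ((c1 _ _).intervalIntegrable _ _) ((c1 _ _).intervalIntegrable _ _),
        ← intervalIntegral.integral_add ((c2 _ _ _ _).intervalIntegrable _ _) ((c2 _ _ _ _).intervalIntegrable _ _)]
      refine intervalIntegral.integral_congr fun t _ => ?_
      simp only [layerError_eq a (w t) j hr', mul_add, Finset.sum_add_distrib]
    rw [hsplit]
    simp only [four] at bB bg be
    have a1 := hA0 r
    have a2 := hA0 (-r - 1)
    have b1 := hB0 r
    have b2 := hB0 (r + 1)
    have b3 := hB0 (-r - 1)
    have b4 := hB0 (-r)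
    have d1 := hg'0 r
    have d2 := hg'0 (r + 1)
    have d3 := hg'0 (-r - 1)
    have d4 := hg'0 (-r)
    have f1 := he0 r
    have f2 := he0 (r + 1)
    have f3 := he0 (-r - 1)
    have f4 := he0 (-r)
    have t1 := hterm r r (by linarith) (by linarith) (by linarith) (by linarith)
    have t2 := hterm r (r + 1) (by linarith) (by linarith) (by linarith) (by linarith)
    have t3 := hterm (-r - 1) (-r - 1) (by linarith) (by linarith) (by linarith) (by linarith)
    have t4 := hterm (-r - 1) (-r) (by linarith) (by linarith) (by linarith) (by linarith)
    linarith
  choose G hGs hGc hGb using hlay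
  have hGpos : ∀ j, (0 : ℝ) < (G j).card := fun j => by have := hGc j; linarith
  have hGne : ∀ j, (G j).Nonempty := fun j => Finset.card_pos.1 (by exact_mod_cast hGpos j)
  refine ⟨productCutoff G, productCutoff_nonneg G, productCutoff_le_one G,
    fun x hx => productCutoff_eq_one hGne hGs hx, fun x hx => productCutoff_eq_zero hGs hx, ?_⟩
  have cl : ∀ j r, Continuous fun t => layerError a R (w t) j r := by
    intro j r
    unfold layerError
    refine continuous_finsetSum _ fun x _ => ?_
    split_ifs
    · exact continuous_const.mul (((hc _).pow 2).add ((hc _).pow 2))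
    · exact continuous_const
  have h1 : ∫ t in T₁..t₀, cutoffError a R (productCutoff G) (w t) ≤
      ∫ t in T₁..t₀, ∑ j, (((G j).card : ℝ) ^ 2)⁻¹ * ∑ r ∈ G j, layerError a R (w t) j r :=
    intervalIntegral.integral_mono_on hT.le ((continuous_cutoffError hc _).intervalIntegrable _ _)
      (Continuous.intervalIntegrable (continuous_finsetSum _ fun j _ => continuous_const.mul
        (continuous_finsetSum _ fun r _ => cl j r)) _ _) fun t _ => cutoffError_productCutoff_le ha R G (w t)
  refine h1.trans ?_
  have cl' : ∀ j, Continuous fun t => (((G j).card : ℝ) ^ 2)⁻¹ * ∑ r ∈ G j, layerError a R (w t) j r := fun j =>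
    continuous_const.mul (continuous_finsetSum _ fun r _ => cl j r)
  rw [intervalIntegral.integral_finsetSum fun j _ => (cl' j).intervalIntegrable _ _]
  have h2 : ∀ j, ∫ t in T₁..t₀, (((G j).card : ℝ) ^ 2)⁻¹ * ∑ r ∈ G j, layerError a R (w t) j r ≤
      2 ^ 23 * C * (m⁻¹ * M) := by
    intro j
    rw [intervalIntegral.integral_const_mul, intervalIntegral.integral_finsetSum fun r _ => (cl j r).intervalIntegrable _ _]
    have h3 : ∑ r ∈ G j, ∫ t in T₁..t₀, layerError a R (w t) j r ≤ (G j).card * (2 ^ 22 * C * M) := by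
      rw [← nsmul_eq_mul]; exact Finset.sum_le_card_nsmul _ _ _ (hGb j)
    have h4 : ((G j).card : ℝ)⁻¹ ≤ 2 * m⁻¹ := by
      rw [← div_eq_mul_inv, inv_le_comm₀ (hGpos j) (by positivity), inv_div, div_le_iff₀ (by norm_num)]
      linarith [hGc j]
    calc _ ≤ (((G j).card : ℝ) ^ 2)⁻¹ * ((G j).card * (2 ^ 22 * C * M)) := by gcongr
      _ = ((G j).card : ℝ)⁻¹ * (2 ^ 22 * C * M) := by
        have := (hGpos j).ne'
        field_simp
      _ ≤ 2 * m⁻¹ * (2 ^ 22 * C * M) := by gcongr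
      _ = _ := by ring
  refine (Finset.sum_le_sum fun j _ => h2 j).trans (le_of_eq ?_)
  simp
  ring
end

/-! ### Scaling: the energy estimate on cylinders of relative size `σ` -/

noncomputable section

theorem cubeEdges_mono {d : ℕ} {R S : ℤ} (h : R ≤ S) (j : Fin d) : cubeEdges d R j ⊆ cubeEdges d S j := by
  intro x hx
  rw [mem_cubeEdges] at hx ⊢
  exact ⟨cube_mono h hx.1, hx.2.trans_le h⟩

theorem weightSum_mono {d : ℕ} {a : Fin d → (Fin d → ℤ) → ℝ} (ha : ∀ j x, 0 < a j x) {R S : ℤ} (h : R ≤ S)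
    (r : ℝ) : weightSum a R r ≤ weightSum a S r :=
  Finset.sum_le_sum fun j _ => Finset.sum_le_sum_of_subset_of_nonneg (cubeEdges_mono h j)
    fun _ _ _ => Real.rpow_nonneg (ha _ _).le _

theorem cubeEnergy_mono {d : ℕ} {a : Fin d → (Fin d → ℤ) → ℝ} (ha : ∀ j x, 0 < a j x) {R S : ℤ} (h : R ≤ S)
    (w : (Fin d → ℤ) → ℝ) : cubeEnergy a R w ≤ cubeEnergy a S w :=
  Finset.sum_le_sum fun j _ => Finset.sum_le_sum_of_subset_of_nonneg (cubeEdges_mono h j)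
    fun _ _ _ => mul_nonneg (ha _ _).le (sq_nonneg _)

/-- Admissible exponents, together with the interpolation inequality on the slices. -/
structure Exponents (D : ℕ) (p q lam C c₀ : ℝ) : Prop where
  one_le_dim : 1 ≤ D
  one_lt_p : 1 < p
  one_lt_q : 1 < q
  dim_lt : ((D : ℝ) + 1) / 2 < q
  lam_pos : 0 < lam
  lam_lt : lam < 1
  const_pos : 0 < C
  one_le_const : 1 ≤ c₀
  slice : SliceInequality D p q lam C

/-- A positive subcaloric function on the cylinder of size `n`, with averaged bounds `M` and `Λ` for
the weights and their inverses. -/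
structure Setting (D : ℕ) (p q c₀ n τ t₀ M Λ : ℝ) (a : Fin (D + 1) → (Fin (D + 1) → ℤ) → ℝ)
    (u : ℝ → (Fin (D + 1) → ℤ) → ℝ) : Prop where
  large : 2 ^ 20 ≤ n
  scale_pos : 0 < τ
  M_pos : 0 < M
  Λ_pos : 0 < Λ
  weight_pos : ∀ j x, 0 < a j x
  weight_le : weightSum a ⌊n⌋ p ≤ c₀ * n ^ (D + 1) * M ^ p
  inv_weight_le : weightSum a ⌊n⌋ (-q) ≤ c₀ * n ^ (D + 1) * Λ ^ q
  one_le : 1 ≤ Λ * (M + τ⁻¹)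
  sub : SubcaloricOn a (t₀ - τ * n ^ 2) t₀ ⌊n⌋ u

/-- The integral of `u^(2α)` over the cylinder of relative size `σ`. -/
def massInt {d : ℕ} (u : ℝ → (Fin d → ℤ) → ℝ) (n τ t₀ α σ : ℝ) : ℝ :=
  ∫ t in (t₀ - σ * (τ * n ^ 2))..t₀, ∑ x ∈ cube d ⌊σ * n⌋, (u t x ^ α) ^ 2

/-- The integral of the energy density of `u^α` over the cylinder of relative size `σ`. -/
def energyInt {d : ℕ} (a : Fin d → (Fin d → ℤ) → ℝ) (u : ℝ → (Fin d → ℤ) → ℝ) (n τ t₀ α σ : ℝ) : ℝ :=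
  ∫ t in (t₀ - σ * (τ * n ^ 2))..t₀, cubeEnergy a ⌊σ * n⌋ fun x => u t x ^ α

/-- The quantity that is estimated by absorption. -/
def totalInt {d : ℕ} (a : Fin d → (Fin d → ℤ) → ℝ) (u : ℝ → (Fin d → ℤ) → ℝ) (n τ t₀ Λ α σ : ℝ) : ℝ :=
  n ^ 2 * Λ * energyInt a u n τ t₀ α σ + massInt u n τ t₀ α σ

variable {D : ℕ} {p q lam C c₀ n τ t₀ M Λ : ℝ} {a : Fin (D + 1) → (Fin (D + 1) → ℤ) → ℝ}
    {u : ℝ → (Fin (D + 1) → ℤ) → ℝ}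

namespace Setting

theorem n_pos (S : Setting D p q c₀ n τ t₀ M Λ a u) : 0 < n := by
  have := S.large; linarith [show (0:ℝ) < 2 ^ 20 by norm_num]

theorem time_pos (S : Setting D p q c₀ n τ t₀ M Λ a u) : 0 < τ * n ^ 2 := by
  have := S.n_pos; have := S.scale_pos; positivity

theorem continuous_mass (S : Setting D p q c₀ n τ t₀ M Λ a u) (α : ℝ) (R : ℤ) :
    Continuous fun t => ∑ x ∈ cube (D + 1) R, (u t x ^ α) ^ 2 :=
  continuous_finsetSum _ fun x _ => (S.sub.continuous_rpow α x).pow 2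

theorem continuous_energy (S : Setting D p q c₀ n τ t₀ M Λ a u) (α : ℝ) (R : ℤ) :
    Continuous fun t => cubeEnergy a R fun x => u t x ^ α :=
  continuous_cubeEnergy fun x => S.sub.continuous_rpow α x

theorem time_lt (S : Setting D p q c₀ n τ t₀ M Λ a u) {σ : ℝ} (hσ : 0 < σ) : t₀ - σ * (τ * n ^ 2) < t₀ := by
  have := mul_pos hσ S.time_pos
  linarith

theorem massInt_pos (S : Setting D p q c₀ n τ t₀ M Λ a u) (α : ℝ) {σ : ℝ} (hσ : 0 < σ) :
    0 < massInt u n τ t₀ α σ := by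
  refine intervalIntegral.intervalIntegral_pos_of_pos ((S.continuous_mass α _).intervalIntegrable _ _)
    (fun t => Finset.sum_pos (fun x _ => pow_pos (Real.rpow_pos_of_pos (S.sub.pos t x) _) 2) ⟨0, ?_⟩) (S.time_lt hσ)
  rw [mem_cube]
  have : 0 ≤ ⌊σ * n⌋ := Int.floor_nonneg.2 (mul_pos hσ S.n_pos).le
  intro i; simp [this]

theorem energyInt_nonneg (S : Setting D p q c₀ n τ t₀ M Λ a u) (α : ℝ) {σ : ℝ} (hσ : 0 < σ) :
    0 ≤ energyInt a u n τ t₀ α σ :=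
  intervalIntegral.integral_nonneg (S.time_lt hσ).le fun _ _ => cubeEnergy_nonneg S.weight_pos _ _

theorem massInt_le_totalInt (S : Setting D p q c₀ n τ t₀ M Λ a u) (α : ℝ) {σ : ℝ} (hσ : 0 < σ) :
    massInt u n τ t₀ α σ ≤ totalInt a u n τ t₀ Λ α σ := by
  have := S.energyInt_nonneg α hσ
  have := S.Λ_pos
  unfold totalInt
  have : 0 ≤ n ^ 2 * Λ * energyInt a u n τ t₀ α σ := by positivity
  linarith

theorem massInt_mono (S : Setting D p q c₀ n τ t₀ M Λ a u) (α : ℝ) {ρ σ : ℝ} (hρ : 0 < ρ) (h : ρ ≤ σ) :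
    massInt u n τ t₀ α ρ ≤ massInt u n τ t₀ α σ := by
  have hT := S.time_pos
  have h1 : massInt u n τ t₀ α ρ ≤ ∫ t in (t₀ - ρ * (τ * n ^ 2))..t₀, ∑ x ∈ cube (D + 1) ⌊σ * n⌋, (u t x ^ α) ^ 2 :=
    intervalIntegral.integral_mono_on (S.time_lt hρ).le ((S.continuous_mass α _).intervalIntegrable _ _)
      ((S.continuous_mass α _).intervalIntegrable _ _) fun t _ =>
      Finset.sum_le_sum_of_subset_of_nonneg (cube_mono (Int.floor_le_floor (by have := S.n_pos; gcongr)))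
        fun _ _ _ => sq_nonneg _
  refine h1.trans (intervalIntegral.integral_mono_interval (by gcongr) (S.time_lt hρ).le le_rfl
    (Filter.Eventually.of_forall fun t => Finset.sum_nonneg fun _ _ => sq_nonneg _)
    ((S.continuous_mass α _).intervalIntegrable _ _))

theorem sub_level (S : Setting D p q c₀ n τ t₀ M Λ a u) {σ : ℝ} (h1 : σ ≤ 1) :
    SubcaloricOn a (t₀ - σ * (τ * n ^ 2)) t₀ ⌊σ * n⌋ u :=
  S.sub.mono (Int.floor_le_floor (by have := S.n_pos; nlinarith)) (by have := S.time_pos; nlinarith)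

end Setting

/-- Passing from the cube to a typical slice lowers the power of `n` by one, at the price of the
factor `n/m`, with `m` the number of layers. -/
theorem rpow_div_le_scaled {D : ℕ} {c₀ n m r Y : ℝ} (hc : 1 ≤ c₀) (hn : 0 < n) (hm : 0 < m) (hmn : m ≤ n)
    (hr : 1 < r) (hY : 0 < Y) :
    (c₀ * n ^ (D + 1) * Y ^ r / m) ^ (1 / r) ≤ c₀ * (n / m) * (n ^ ((D : ℝ) / r) * Y) := by
  have hr0 : 0 < r := by linarith
  have h1 : 1 ≤ n / m := by rw [one_le_div hm]; exact hmn
  have : c₀ * n ^ (D + 1) * Y ^ r / m = c₀ * (n / m) * (n ^ D * Y ^ r) := by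
    rw [pow_succ]; field_simp
  rw [this]
  refine (mul_rpow_le_mul_rpow (by nlinarith) (by positivity) (by rw [div_le_one hr0]; exact hr.le)).trans (le_of_eq ?_)
  rw [Real.mul_rpow (by positivity) (by positivity), ← Real.rpow_natCast n D, ← Real.rpow_mul hn.le, ← Real.rpow_mul hY.le,
    mul_one_div_cancel hr0.ne', Real.rpow_one, mul_one_div]

/-- The powers `n^(2-D/q)` and `n^(D/q)` combine to the diffusive factor `n²`. The constant `9` is
`3²`, from `L ≤ 3n`. -/
theorem scaled_inner_le {D : ℕ} {q lam c₀ n ν m L Λ B g E : ℝ} (hc : 1 ≤ c₀) (hn : 0 < n) (hν : 1 ≤ ν)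
    (hm : 0 < m) (hL0 : 0 < L) (hLn : L ≤ 3 * n) (hDq : 0 ≤ 2 - (D : ℝ) / q) (hq : 0 < q) (hΛ : 0 < Λ)
    (hl0 : 0 ≤ 1 - lam) (hl1 : 1 - lam ≤ 1) (hB0 : 0 ≤ B) (hB : B ≤ c₀ * ν * (n ^ ((D : ℝ) / q) * Λ)) (hg : 0 ≤ g) (hE : 0 ≤ E) :
    (L ^ (2 - (D : ℝ) / q) * B * (E / m) + g / m) ^ (1 - lam) ≤
      (9 * (c₀ * ν)) * ((n ^ 2 * Λ * E + g) / m) ^ (1 - lam) := by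
  have b4 : L ^ (2 - (D : ℝ) / q) ≤ 9 * n ^ (2 - (D : ℝ) / q) := by
    calc L ^ (2 - (D : ℝ) / q) ≤ (3 * n) ^ (2 - (D : ℝ) / q) := by gcongr
      _ = 3 ^ (2 - (D : ℝ) / q) * n ^ (2 - (D : ℝ) / q) := Real.mul_rpow (by norm_num) hn.le
      _ ≤ 3 ^ (2 : ℝ) * n ^ (2 - (D : ℝ) / q) := by
        gcongr
        · norm_num
        · have : 0 ≤ (D : ℝ) / q := by positivity
          linarith
      _ = _ := by norm_num
  have h9 : 1 ≤ 9 * (c₀ * ν) := by nlinarith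
  refine le_trans (Real.rpow_le_rpow (by positivity) ?_ hl0) (mul_rpow_le_mul_rpow h9 (by positivity) hl1)
  calc L ^ (2 - (D : ℝ) / q) * B * (E / m) + g / m
      ≤ (9 * n ^ (2 - (D : ℝ) / q)) * (c₀ * ν * (n ^ ((D : ℝ) / q) * Λ)) * (E / m) + 9 * (c₀ * ν) * (g / m) := by
        refine add_le_add (by gcongr) ?_
        exact le_mul_of_one_le_left (by positivity) h9
    _ = 9 * (c₀ * ν) * ((n ^ (2 - (D : ℝ) / q) * n ^ ((D : ℝ) / q)) * Λ * (E / m) + g / m) := by ring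
    _ = 9 * (c₀ * ν) * ((n ^ 2 * Λ * E + g) / m) := by
      rw [← Real.rpow_add hn, sub_add_cancel, Real.rpow_two]; ring

/-- Power counting. One factor `m⁻¹` comes from the cutoff, another from the interpolation, whose
exponents add up to one; together they are `(n/m)² n⁻²`. The powers `n^(D/p)` and `n^(-D/p)` cancel.
The bounds for `A` and `B` contribute one factor `n/m` each, and `(n/m)^4 ≤ 16 δ^(-4)`. -/
theorem scaled_cutoff_bound {D : ℕ} {p q lam c₀ n m L M Λ δ g E A B : ℝ} (hc : 1 ≤ c₀) (hn : 0 < n)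
    (hp : 1 < p) (hm : 0 < m) (hmn : m ≤ n) (hδ : 0 < δ) (hmδ : δ * n / 2 ≤ m) (hnL : n / 2 ≤ L) (hLn : L ≤ 3 * n)
    (hDq : 0 ≤ 2 - (D : ℝ) / q) (hq : 0 < q) (hM : 0 < M) (hΛ : 0 < Λ) (hl0 : 0 ≤ 1 - lam) (hl1 : 1 - lam ≤ 1)
    (hA : A ≤ c₀ * (n / m) * (n ^ ((D : ℝ) / p) * M))
    (hB0 : 0 ≤ B) (hB : B ≤ c₀ * (n / m) * (n ^ ((D : ℝ) / q) * Λ)) (hg : 0 < g) (hE : 0 ≤ E) :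
    m⁻¹ * (A * (L ^ (-(D : ℝ) / p) * ((g / m) ^ lam * (L ^ (2 - (D : ℝ) / q) * B * (E / m) + g / m) ^ (1 - lam)))) ≤
      9 * 2 ^ D * c₀ ^ 2 * 16 * (δ⁻¹ ^ 4 * (n⁻¹ ^ 2 * (M * (g ^ lam * (n ^ 2 * Λ * E + g) ^ (1 - lam))))) := by
  have hL0 : 0 < L := lt_of_lt_of_le (by positivity) hnL
  have hν1 : 1 ≤ n / m := by rw [one_le_div hm]; exact hmn
  have hν2 : n / m ≤ 2 * δ⁻¹ := by
    rw [div_le_iff₀ hm]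
    calc n = 2 * δ⁻¹ * (δ * n / 2) := by field_simp
      _ ≤ _ := by gcongr
  have hp0 : 0 < p := by linarith
  have b3 : L ^ (-(D : ℝ) / p) ≤ 2 ^ D * n ^ (-(D : ℝ) / p) := by
    calc L ^ (-(D : ℝ) / p) ≤ (n / 2) ^ (-(D : ℝ) / p) :=
          Real.rpow_le_rpow_of_nonpos (by positivity) hnL (by rw [neg_div]; simp; positivity)
      _ = 2 ^ ((D : ℝ) / p) * n ^ (-(D : ℝ) / p) := by
        rw [Real.div_rpow hn.le (by norm_num), div_eq_mul_inv, ← Real.rpow_neg (by norm_num), neg_div, neg_neg, mul_comm]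
      _ ≤ 2 ^ (D : ℝ) * n ^ (-(D : ℝ) / p) := by
        gcongr
        · norm_num
        · exact div_le_self (Nat.cast_nonneg _) hp.le
      _ = _ := by rw [Real.rpow_natCast]
  have b5 := scaled_inner_le hc hn hν1 hm hL0 hLn hDq hq hΛ hl0 hl1 hB0 hB hg.le hE
  have hZ0 : 0 < n ^ 2 * Λ * E + g := by positivity
  have hm1 : m⁻¹ = n / m * n⁻¹ := by field_simp
  have hν0 : 0 < n / m := by positivity
  have hin : 0 ≤ L ^ (2 - (D : ℝ) / q) * B * (E / m) + g / m := by positivity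
  generalize hνd : n / m = ν at *
  generalize n ^ 2 * Λ * E + g = Z at *
  generalize L ^ (2 - (D : ℝ) / q) * B * (E / m) + g / m = I at *
  have h1 : n ^ ((D : ℝ) / p) * n ^ (-(D : ℝ) / p) = 1 := by
    rw [← Real.rpow_add hn, neg_div, add_neg_cancel, Real.rpow_zero]
  have h2 : (g / m) ^ lam * (Z / m) ^ (1 - lam) = m⁻¹ * (g ^ lam * Z ^ (1 - lam)) := by
    rw [Real.div_rpow hg.le hm.le, Real.div_rpow hZ0.le hm.le, div_mul_div_comm, ← Real.rpow_add hm]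
    rw [add_sub_cancel, Real.rpow_one, div_eq_inv_mul]
  have hI : 0 ≤ I ^ (1 - lam) := Real.rpow_nonneg hin _
  calc _ ≤ m⁻¹ * ((c₀ * ν * (n ^ ((D : ℝ) / p) * M)) * ((2 ^ D * n ^ (-(D : ℝ) / p)) * ((g / m) ^ lam *
        ((9 * (c₀ * ν)) * (Z / m) ^ (1 - lam))))) := by gcongr
    _ = 9 * 2 ^ D * c₀ ^ 2 * ν ^ 2 * M * (n ^ ((D : ℝ) / p) * n ^ (-(D : ℝ) / p)) * (m⁻¹ * ((g / m) ^ lam * (Z / m) ^ (1 - lam))) := by ring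
    _ = 9 * 2 ^ D * c₀ ^ 2 * ν ^ 4 * (n⁻¹ ^ 2 * (M * (g ^ lam * Z ^ (1 - lam)))) := by
      rw [h1, h2, hm1]; ring
    _ ≤ 9 * 2 ^ D * c₀ ^ 2 * (2 * δ⁻¹) ^ 4 * (n⁻¹ ^ 2 * (M * (g ^ lam * Z ^ (1 - lam)))) := by gcongr
    _ = _ := by ring


/-- The energy estimate with an adapted cutoff function. -/
theorem Exponents.exists_cutoff_estimate (X : Exponents D p q lam C c₀) :
    ∃ K : ℝ, 1 ≤ K ∧ ∀ {n τ t₀ M Λ : ℝ} {a : Fin (D + 1) → (Fin (D + 1) → ℤ) → ℝ}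
      {u : ℝ → (Fin (D + 1) → ℤ) → ℝ} (_ : Setting D p q c₀ n τ t₀ M Λ a u) {α ρ σ : ℝ},
      1 ≤ α → 1 / 2 ≤ ρ → ρ < σ → σ ≤ 1 → 2 ≤ (σ - ρ) * n →
      ∃ η : (Fin (D + 1) → ℤ) → ℝ, (∀ x ∈ cube (D + 1) ⌊ρ * n⌋, η x = 1) ∧
        (∀ x, x ∉ cube (D + 1) (⌊σ * n⌋ - 1) → η x = 0) ∧ (∀ x, 0 ≤ η x) ∧
        (∀ t ∈ Set.Icc (t₀ - ρ * (τ * n ^ 2)) t₀, ∑ x ∈ cube (D + 1) ⌊σ * n⌋, (η x * u t x ^ α) ^ 2 ≤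
          K * (α ^ 2 * ((σ - ρ)⁻¹ ^ 4 * (n⁻¹ ^ 2 * ((M + τ⁻¹) * (massInt u n τ t₀ α σ ^ lam *
            totalInt a u n τ t₀ Λ α σ ^ (1 - lam))))))) ∧
        ∫ t in (t₀ - ρ * (τ * n ^ 2))..t₀, cubeEnergy a ⌊σ * n⌋ (fun x => η x * u t x ^ α) ≤
          K * (α ^ 2 * ((σ - ρ)⁻¹ ^ 4 * (n⁻¹ ^ 2 * ((M + τ⁻¹) * (massInt u n τ t₀ α σ ^ lam *
            totalInt a u n τ t₀ Λ α σ ^ (1 - lam)))))) := by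
  have hp0 : 0 < p := by have := X.one_lt_p; linarith
  have hq0 : 0 < q := by have := X.one_lt_q; linarith
  have hc0 := X.one_le_const
  have hC := X.const_pos
  have hl0 := X.lam_pos
  have hl : 0 < 1 - lam := sub_pos.2 X.lam_lt
  set K₀ : ℝ := 5 * ((D + 1) * 2 ^ 23 * C) * (9 * 2 ^ D * c₀ ^ 2 * 16) with hK₀
  have hK₀0 : 0 ≤ K₀ := by positivity
  refine ⟨2 * (K₀ + 1), by linarith, ?_⟩
  intro n τ t₀ M Λ a u S α ρ σ hα hρ hρσ hσ hgap
  have hn := S.n_pos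
  have hnl := S.large
  have hτ := S.scale_pos
  have hM := S.M_pos
  have hΛ := S.Λ_pos
  have hσ0 : 0 < σ := by linarith
  have hT := S.time_lt hσ0
  set R₁ : ℤ := ⌊ρ * n⌋ with hR₁
  set R : ℤ := ⌊σ * n⌋ with hR
  have f1 : (R₁ : ℝ) ≤ ρ * n := Int.floor_le _
  have f2 : ρ * n < R₁ + 1 := Int.lt_floor_add_one _
  have f3 : (R : ℝ) ≤ σ * n := Int.floor_le _
  have f4 : σ * n < R + 1 := Int.lt_floor_add_one _
  have hR₁0 : 0 ≤ R₁ := Int.floor_nonneg.2 (by positivity)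
  have hRR : R₁ < R := by
    have : (R₁ : ℝ) < R := by linarith
    exact_mod_cast this
  set m : ℝ := (R : ℝ) - R₁ with hm
  have hδ : 0 < σ - ρ := sub_pos.2 hρσ
  -- Rounding the two radii loses at most one layer, while the gap is at least two.
  have hm1 : (σ - ρ) * n / 2 ≤ m := by rw [hm]; linarith
  have hm0 : 0 < m := lt_of_lt_of_le (by positivity) hm1
  have hmn : m ≤ n := by
    have : (σ - ρ) * n ≤ 1 / 2 * n := by gcongr; linarith
    have h20 : (2:ℝ) ≤ n := le_trans (by norm_num) hnl
    rw [hm]; linarith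
  set w : ℝ → (Fin (D + 1) → ℤ) → ℝ := fun t x => u t x ^ α with hw
  have hw0 : ∀ t x, 0 < w t x := fun t x => Real.rpow_pos_of_pos (S.sub.pos t x) _
  have hwc : ∀ x, Continuous fun t => w t x := fun x => S.sub.continuous_rpow α x
  set g := massInt u n τ t₀ α σ with hg
  set E := energyInt a u n τ t₀ α σ with hE
  set Z := totalInt a u n τ t₀ Λ α σ with hZ
  have hg0 : 0 < g := S.massInt_pos α hσ0
  have hE0 : 0 ≤ E := S.energyInt_nonneg α hσ0
  have hgZ : g ≤ Z := S.massInt_le_totalInt α hσ0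
  have hZ0 : 0 < Z := hg0.trans_le hgZ
  have hRn : R ≤ ⌊n⌋ := Int.floor_le_floor (mul_le_of_le_one_left hn.le hσ)
  obtain ⟨η, e1, e2, e3, e4, e5⟩ := exists_adapted_cutoff X.slice X.one_lt_p X.one_lt_q hC hl0 X.lam_lt hR₁0 hRR
    S.weight_pos hw0 hwc hT ((weightSum_mono S.weight_pos hRn p).trans S.weight_le)
    ((weightSum_mono S.weight_pos hRn (-q)).trans S.inv_weight_le) (le_refl g) (le_refl E) hm
  refine ⟨η, e3, e4, e1, ?_⟩
  set L : ℝ := 2 * (R : ℝ) + 1 with hL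
  have hnL : n / 2 ≤ L := by
    have : 1 / 2 * n ≤ σ * n := by gcongr; linarith
    rw [hL]; linarith
  have hLn : L ≤ 3 * n := by
    have : σ * n ≤ 1 * n := by gcongr
    rw [hL]; linarith [show (1:ℝ) ≤ 2 ^ 20 by norm_num]
  have hL0 : 0 < L := lt_of_lt_of_le (by positivity) hnL
  have hDq : 0 ≤ 2 - (D : ℝ) / q := by
    rw [sub_nonneg, div_le_iff₀ hq0]
    have := X.dim_lt; linarith
  have b6 := scaled_cutoff_bound (D := D) (lam := lam) (q := q) hc0 hn X.one_lt_p hm0 hmn hδ hm1 hnL hLn hDq hq0 hM hΛ hl.le (by linarith)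
    (rpow_div_le_scaled hc0 hn hm0 hmn X.one_lt_p hM) (Real.rpow_nonneg (by positivity) _)
    (rpow_div_le_scaled hc0 hn hm0 hmn X.one_lt_q hΛ) hg0 hE0
  change _ ≤ 9 * 2 ^ D * c₀ ^ 2 * 16 * ((σ - ρ)⁻¹ ^ 4 * (n⁻¹ ^ 2 * (M * (g ^ lam * Z ^ (1 - lam))))) at b6
  have b7 : ∫ t in (t₀ - σ * (τ * n ^ 2))..t₀, cutoffError a R η (w t) ≤
      (D + 1) * 2 ^ 23 * C * (9 * 2 ^ D * c₀ ^ 2 * 16 * ((σ - ρ)⁻¹ ^ 4 * (n⁻¹ ^ 2 * (M * (g ^ lam * Z ^ (1 - lam)))))) :=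
    e5.trans (mul_le_mul_of_nonneg_left b6 (by positivity))
  -- This puts the term from averaging in time into the same form as the cutoff error.
  have b8 : g ≤ g ^ lam * Z ^ (1 - lam) := by
    calc g = g ^ lam * g ^ (1 - lam) := by rw [← Real.rpow_add hg0, add_sub_cancel, Real.rpow_one]
      _ ≤ _ := by gcongr
  have b9 : ∫ t in (t₀ - σ * (τ * n ^ 2))..t₀, ∑ x ∈ cube (D + 1) R, (η x * w t x) ^ 2 ≤ g := by
    refine intervalIntegral.integral_mono_on hT.le (Continuous.intervalIntegrable
      (continuous_finsetSum _ fun x _ => (continuous_const.mul (hwc x)).pow 2) _ _)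
      ((S.continuous_mass α _).intervalIntegrable _ _) fun t _ => Finset.sum_le_sum fun x _ => ?_
    rw [mul_pow]
    exact mul_le_of_le_one_left (sq_nonneg _) (pow_le_one₀ (e1 x) (e2 x))
  set Y := (σ - ρ)⁻¹ ^ 4 * (n⁻¹ ^ 2 * ((M + τ⁻¹) * (g ^ lam * Z ^ (1 - lam)))) with hY
  have hGZ : 0 ≤ g ^ lam * Z ^ (1 - lam) := by positivity
  have hδ1 : 1 ≤ (σ - ρ)⁻¹ := by rw [one_le_inv₀ hδ]; linarith
  have b10 : ∀ t ∈ Set.Icc (t₀ - ρ * (τ * n ^ 2)) t₀, (∑ x ∈ cube (D + 1) R, (η x * u t x ^ α) ^ 2) +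
        1 / 2 * ∫ r in (t₀ - ρ * (τ * n ^ 2))..t, cubeEnergy a R (fun x => η x * u r x ^ α) ≤ (K₀ + 1) * (α ^ 2 * Y) := by
    intro t ht
    have hTT : t₀ - σ * (τ * n ^ 2) < t₀ - ρ * (τ * n ^ 2) := by
      have := mul_lt_mul_of_pos_right hρσ S.time_pos; linarith
    refine ((S.sub_level hσ).energy_estimate S.weight_pos e4 hα hTT ht.1 ht.2).trans ?_
    have h1 : (t₀ - ρ * (τ * n ^ 2) - (t₀ - σ * (τ * n ^ 2)))⁻¹ = (σ - ρ)⁻¹ * (n⁻¹ ^ 2 * τ⁻¹) := by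
      rw [show t₀ - ρ * (τ * n ^ 2) - (t₀ - σ * (τ * n ^ 2)) = (σ - ρ) * (τ * n ^ 2) by ring]
      field_simp
    rw [h1]
    have h2 : (σ - ρ)⁻¹ * (n⁻¹ ^ 2 * τ⁻¹) * (∫ r in (t₀ - σ * (τ * n ^ 2))..t₀, ∑ x ∈ cube (D + 1) R, (η x * u r x ^ α) ^ 2) ≤
        α ^ 2 * Y := by
      calc _ ≤ (σ - ρ)⁻¹ ^ 4 * (n⁻¹ ^ 2 * (M + τ⁻¹)) * (g ^ lam * Z ^ (1 - lam)) := by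
            refine mul_le_mul ?_ (b9.trans b8) ?_ (by positivity)
            · refine mul_le_mul (le_self_pow₀ hδ1 (by norm_num)) ?_ (by positivity) (by positivity)
              gcongr; linarith
            · exact intervalIntegral.integral_nonneg hT.le fun t _ => Finset.sum_nonneg fun _ _ => sq_nonneg _
        _ = Y := by rw [hY]; ring
        _ ≤ α ^ 2 * Y := le_mul_of_one_le_left (by positivity) (one_le_pow₀ hα)
    have h3 : 5 * α ^ 2 * (∫ r in (t₀ - σ * (τ * n ^ 2))..t₀, cutoffError a R η (fun x => u r x ^ α)) ≤ K₀ * (α ^ 2 * Y) := by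
      calc _ ≤ 5 * α ^ 2 * ((D + 1) * 2 ^ 23 * C * (9 * 2 ^ D * c₀ ^ 2 * 16 *
            ((σ - ρ)⁻¹ ^ 4 * (n⁻¹ ^ 2 * ((M + τ⁻¹) * (g ^ lam * Z ^ (1 - lam))))))) := by
            refine mul_le_mul_of_nonneg_left (b7.trans ?_) (by positivity)
            gcongr
            have : 0 < τ⁻¹ := by positivity
            linarith
        _ = _ := by rw [hK₀, hY]; ring
    linarith
  have hY0 : 0 ≤ Y := by positivity
  have hE0' : ∀ r, 0 ≤ cubeEnergy a R (fun x => η x * u r x ^ α) := fun r => cubeEnergy_nonneg S.weight_pos _ _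
  constructor
  · intro t ht
    have h1 := b10 t ht
    have h2 : 0 ≤ ∫ r in (t₀ - ρ * (τ * n ^ 2))..t, cubeEnergy a R (fun x => η x * u r x ^ α) :=
      intervalIntegral.integral_nonneg ht.1 fun r _ => hE0' r
    have h3 : 0 ≤ (K₀ + 1) * (α ^ 2 * Y) := by positivity
    linarith
  · have h1 := b10 t₀ ⟨(S.time_lt (by linarith)).le, le_rfl⟩
    have h2 : 0 ≤ ∑ x ∈ cube (D + 1) R, (η x * u t₀ x ^ α) ^ 2 := Finset.sum_nonneg fun _ _ => sq_nonneg _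
    linarith
end

/-! ### Absorption of the energy over finitely many scales -/

noncomputable section

/-- The number of steps of the iterations at scale `n`. -/
def stepCount (n : ℝ) : ℕ := ⌊1 / 4 * Real.logb 2 n⌋₊

/-- A scale-dependent factor with exponentially decaying exponent is bounded. -/
theorem exists_rpow_pow_stepCount_le {β e : ℝ} (hβ0 : 0 < β) (hβ1 : β < 1) (he : 0 ≤ e) :
    ∃ K : ℝ, 1 ≤ K ∧ ∀ n : ℝ, 1 ≤ n → (n ^ e) ^ (β ^ stepCount n) ≤ K := by
  set s : ℝ := 1 / 4 * Real.logb 2 β⁻¹ with hs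
  have hs0 : 0 < s := by
    have : 0 < Real.logb 2 β⁻¹ := Real.logb_pos (by norm_num) ((one_lt_inv₀ hβ0).2 hβ1)
    positivity
  refine ⟨Real.exp (e * β⁻¹ / s), Real.one_le_exp (by positivity), ?_⟩
  intro n hn
  have hn0 : 0 < n := by linarith
  -- The number of steps is logarithmic in `n`, so the exponent decays like a negative power of `n`
  -- and outweighs `log n`.
  have h1 : β ^ stepCount n ≤ β⁻¹ * n ^ (-s) := by
    have h2 : 1 / 4 * Real.logb 2 n - 1 ≤ stepCount n := by
      have := Nat.lt_floor_add_one (1 / 4 * Real.logb 2 n)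
      unfold stepCount; linarith
    rw [← Real.rpow_natCast]
    calc β ^ (stepCount n : ℝ) ≤ β ^ (1 / 4 * Real.logb 2 n - 1) :=
          Real.rpow_le_rpow_of_exponent_ge hβ0 hβ1.le h2
      _ = β⁻¹ * β ^ (1 / 4 * Real.logb 2 n) := by
        rw [Real.rpow_sub_one hβ0.ne', div_eq_inv_mul]
      _ = β⁻¹ * n ^ (-s) := by
        congr 1
        rw [Real.rpow_def_of_pos hβ0, Real.rpow_def_of_pos hn0, hs, Real.logb, Real.logb, Real.log_inv]
        congr 1; ring
  rw [← Real.rpow_mul hn0.le, Real.rpow_def_of_pos hn0]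
  refine Real.exp_le_exp.2 ?_
  have h3 : Real.log n ≤ n ^ s / s := Real.log_le_rpow_div hn0.le hs0
  have hlog : 0 ≤ Real.log n := Real.log_nonneg hn
  calc Real.log n * (e * β ^ stepCount n) ≤ n ^ s / s * (e * (β⁻¹ * n ^ (-s))) := by gcongr
    _ = e * β⁻¹ / s * (n ^ s * n ^ (-s)) := by ring
    _ = e * β⁻¹ / s := by rw [← Real.rpow_add hn0, add_neg_cancel, Real.rpow_zero, mul_one]

/-- Absorption of a fraction of the right-hand side by iteration over finitely many scales. -/
theorem absorb_iterate {lam c : ℝ} (hl0 : 0 < lam) (hl1 : lam < 1) (hc : 1 ≤ c) {G N : ℝ} (hG : 0 < G) (hN : 1 ≤ N) :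
    ∀ (J : ℕ) (B : ℝ) (z : ℕ → ℝ), 1 ≤ B → (∀ j, 0 ≤ z j) →
      (∀ j < J, z j ≤ B * c ^ j * (G ^ lam * z (j + 1) ^ (1 - lam))) → z J ≤ N * G →
      z 0 ≤ B ^ (1 / lam) * c ^ ((1 - lam) / lam ^ 2) * N ^ ((1 - lam) ^ J) * G := by
  have hl : 0 < 1 - lam := sub_pos.2 hl1
  have hc0 : 0 < c := by linarith
  have hN0 : 0 < N := by linarith
  intro J
  induction J with
  | zero =>
    intro B z hB _ _ hz
    rw [pow_zero, Real.rpow_one]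
    refine hz.trans ?_
    have h1 : 1 ≤ B ^ (1 / lam) * c ^ ((1 - lam) / lam ^ 2) :=
      one_le_mul_of_one_le_of_one_le (Real.one_le_rpow hB (by positivity)) (Real.one_le_rpow hc (by positivity))
    rw [mul_assoc]
    exact le_mul_of_one_le_left (by positivity) h1
  | succ J ih =>
    intro B z hB hz h hJ
    have hB0 : 0 < B := by linarith
    -- Dropping the first scale replaces `B` by `B c`. The exponents of `B` and `c` in the
    -- conclusion solve `x = 1 + (1-lam) x` and `y = (1-lam)(x + y)`, so they reproduce themselves.
    have h1 := ih (B * c) (fun j => z (j + 1)) (one_le_mul_of_one_le_of_one_le hB hc) (fun j => hz _)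
      (fun j hj => (h (j + 1) (by omega)).trans (le_of_eq (by ring))) hJ
    have h0 := h 0 (by omega)
    rw [pow_zero, mul_one, zero_add] at h0
    refine h0.trans ?_
    have h2 := Real.rpow_le_rpow (hz 1) h1 hl.le
    refine (mul_le_mul_of_nonneg_left (mul_le_mul_of_nonneg_left h2 (by positivity)) hB0.le).trans (le_of_eq ?_)
    rw [Real.mul_rpow (by positivity) hG.le, Real.mul_rpow (by positivity) (by positivity),
      Real.mul_rpow (by positivity) (by positivity), Real.mul_rpow hB0.le hc0.le, Real.mul_rpow (by positivity) (by positivity),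
      ← Real.rpow_mul hB0.le, ← Real.rpow_mul hc0.le, ← Real.rpow_mul hc0.le, ← Real.rpow_mul hN0.le, ← pow_succ]
    have e1 : B * B ^ (1 / lam * (1 - lam)) = B ^ (1 / lam) := by
      conv_lhs => rw [← Real.rpow_one B, ← Real.rpow_mul hB0.le, ← Real.rpow_add hB0]
      congr 1; field_simp; ring
    have e2 : c ^ (1 / lam * (1 - lam)) * c ^ ((1 - lam) / lam ^ 2 * (1 - lam)) = c ^ ((1 - lam) / lam ^ 2) := by
      rw [← Real.rpow_add hc0]; congr 1; field_simp; ring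
    have e3 : G ^ lam * G ^ (1 - lam) = G := by
      rw [← Real.rpow_add hG, add_sub_cancel, Real.rpow_one]
    calc _ = (B * B ^ (1 / lam * (1 - lam))) * (c ^ (1 / lam * (1 - lam)) * c ^ ((1 - lam) / lam ^ 2 * (1 - lam))) *
          N ^ ((1 - lam) ^ (J + 1)) * (G ^ lam * G ^ (1 - lam)) := by ring
      _ = _ := by rw [e1, e2, e3]

variable {D : ℕ} {p q lam C c₀ n τ t₀ M Λ : ℝ} {a : Fin (D + 1) → (Fin (D + 1) → ℤ) → ℝ}
    {u : ℝ → (Fin (D + 1) → ℤ) → ℝ}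

/-- A single weight is controlled by the whole `p`-sum; the loss in `n` is polynomial. -/
theorem Setting.weight_bound (S : Setting D p q c₀ n τ t₀ M Λ a u) (hp : 1 < p) (hc : 1 ≤ c₀) {R : ℤ} (hR : R ≤ ⌊n⌋)
    {j : Fin (D + 1)} {x : Fin (D + 1) → ℤ} (hx : x ∈ cubeEdges (D + 1) R j) : a j x ≤ c₀ * n ^ (D + 1) * M := by
  have hn := S.n_pos
  have hM := S.M_pos
  have hn1 : 1 ≤ n := le_trans (by norm_num) S.large
  have hp0 : 0 < p := by linarith
  have h1 : a j x ^ p ≤ c₀ * n ^ (D + 1) * M ^ p := by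
    refine le_trans ?_ S.weight_le
    refine le_trans ?_ (Finset.single_le_sum (f := fun j => ∑ x ∈ cubeEdges (D + 1) ⌊n⌋ j, a j x ^ p)
      (fun j _ => Finset.sum_nonneg fun x _ => Real.rpow_nonneg (S.weight_pos _ _).le _) (Finset.mem_univ j))
    exact Finset.single_le_sum (f := fun x => a j x ^ p) (fun x _ => Real.rpow_nonneg (S.weight_pos _ _).le _)
      (cubeEdges_mono hR j hx)
  have h2 := Real.rpow_le_rpow (Real.rpow_nonneg (S.weight_pos _ _).le _) h1 (by positivity : 0 ≤ 1 / p)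
  rw [← Real.rpow_mul (S.weight_pos _ _).le, mul_one_div_cancel hp0.ne', Real.rpow_one] at h2
  have hcn : 1 ≤ c₀ * n ^ (D + 1) := one_le_mul_of_one_le_of_one_le hc (one_le_pow₀ hn1)
  refine h2.trans ((mul_rpow_le_mul_rpow hcn (by positivity) (by rw [div_le_one hp0]; exact hp.le)).trans (le_of_eq ?_))
  rw [← Real.rpow_mul hM.le, mul_one_div_cancel hp0.ne', Real.rpow_one]

/-- On a lattice the energy is at most a multiple of the largest weight times the mass. The
polynomial loss is harmless, as this bound only starts the absorption at its last scale and then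
carries the exponent `(1 - lam)^J`. -/
theorem Setting.crude_bound (S : Setting D p q c₀ n τ t₀ M Λ a u) (hp : 1 < p) (hc : 1 ≤ c₀) (α : ℝ) {σ : ℝ}
    (hσ : 0 < σ) (hσ1 : σ ≤ 1) :
    totalInt a u n τ t₀ Λ α σ ≤ 8 * (D + 1) * c₀ * n ^ (D + 3) * (Λ * (M + τ⁻¹)) * massInt u n τ t₀ α σ := by
  have hn := S.n_pos
  have hM := S.M_pos
  have hΛ := S.Λ_pos
  have hτ := S.scale_pos
  have hn1 : 1 ≤ n := le_trans (by norm_num) S.large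
  have hR : ⌊σ * n⌋ ≤ ⌊n⌋ := Int.floor_le_floor (mul_le_of_le_one_left hn.le hσ1)
  have h1 : ∀ t, cubeEnergy a ⌊σ * n⌋ (fun x => u t x ^ α) ≤
      4 * (D + 1) * (c₀ * n ^ (D + 1) * M) * ∑ x ∈ cube (D + 1) ⌊σ * n⌋, (u t x ^ α) ^ 2 := by
    intro t
    calc cubeEnergy a ⌊σ * n⌋ (fun x => u t x ^ α)
        ≤ ∑ j, ∑ x ∈ cubeEdges (D + 1) ⌊σ * n⌋ j, (2 * (c₀ * n ^ (D + 1) * M)) * ((u t x ^ α) ^ 2 + (u t (x + unitVec j) ^ α) ^ 2) := by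
          refine Finset.sum_le_sum fun j _ => Finset.sum_le_sum fun x hx => ?_
          have hw := S.weight_bound hp hc hR hx
          have : (u t (x + unitVec j) ^ α - u t x ^ α) ^ 2 ≤ 2 * ((u t x ^ α) ^ 2 + (u t (x + unitVec j) ^ α) ^ 2) := by
            have := sq_nonneg (u t (x + unitVec j) ^ α + u t x ^ α)
            linear_combination this
          calc _ ≤ (c₀ * n ^ (D + 1) * M) * (2 * ((u t x ^ α) ^ 2 + (u t (x + unitVec j) ^ α) ^ 2)) :=
                mul_le_mul hw this (sq_nonneg _) (by positivity)
            _ = _ := by ring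
      _ = (2 * (c₀ * n ^ (D + 1) * M)) * ∑ j, ∑ x ∈ cubeEdges (D + 1) ⌊σ * n⌋ j, ((u t x ^ α) ^ 2 + (u t (x + unitVec j) ^ α) ^ 2) := by
          simp only [Finset.mul_sum]
      _ ≤ (2 * (c₀ * n ^ (D + 1) * M)) * (2 * ((D + 1 : ℕ) : ℝ) * ∑ x ∈ cube (D + 1) ⌊σ * n⌋, (u t x ^ α) ^ 2) := by
          refine mul_le_mul_of_nonneg_left (sum_edges_le (fun x => (u t x ^ α) ^ 2) fun x _ => sq_nonneg _) (by positivity)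
      _ = _ := by push_cast; ring
  have h2 : energyInt a u n τ t₀ α σ ≤ 4 * (D + 1) * (c₀ * n ^ (D + 1) * M) * massInt u n τ t₀ α σ := by
    unfold energyInt massInt
    rw [← intervalIntegral.integral_const_mul]
    exact intervalIntegral.integral_mono_on (S.time_lt hσ).le ((S.continuous_energy α _).intervalIntegrable _ _)
      ((continuous_const.mul (S.continuous_mass α _)).intervalIntegrable _ _) fun t _ => h1 t
  have hg := S.massInt_pos α hσ
  have hK := S.one_le
  have hA : M ≤ M + τ⁻¹ := by have : 0 < τ⁻¹ := by positivity
                              linarith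
  have hA0 : 0 < M + τ⁻¹ := by positivity
  unfold totalInt
  have h3 : n ^ 2 * Λ * energyInt a u n τ t₀ α σ ≤
      4 * (D + 1) * c₀ * n ^ (D + 3) * (Λ * (M + τ⁻¹)) * massInt u n τ t₀ α σ := by
    calc n ^ 2 * Λ * energyInt a u n τ t₀ α σ ≤ n ^ 2 * Λ * (4 * (D + 1) * (c₀ * n ^ (D + 1) * (M + τ⁻¹)) * massInt u n τ t₀ α σ) := by
          refine mul_le_mul_of_nonneg_left (h2.trans ?_) (by positivity)
          gcongr
      _ = _ := by ring
  have h4 : massInt u n τ t₀ α σ ≤ 4 * (D + 1) * c₀ * n ^ (D + 3) * (Λ * (M + τ⁻¹)) * massInt u n τ t₀ α σ := by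
    refine le_mul_of_one_le_left hg.le ?_
    refine one_le_mul_of_one_le_of_one_le (one_le_mul_of_one_le_of_one_le (one_le_mul_of_one_le_of_one_le ?_ hc)
      (one_le_pow₀ hn1)) hK
    have : (0:ℝ) ≤ D := Nat.cast_nonneg _
    linarith
  linarith

theorem energyInt_le_of_cutoff (S : Setting D p q c₀ n τ t₀ M Λ a u) {α ρ σ : ℝ} (hρ : 0 < ρ) (hρσ : ρ ≤ σ)
    {η : (Fin (D + 1) → ℤ) → ℝ} (hη : ∀ x ∈ cube (D + 1) ⌊ρ * n⌋, η x = 1) :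
    energyInt a u n τ t₀ α ρ ≤
      ∫ t in (t₀ - ρ * (τ * n ^ 2))..t₀, cubeEnergy a ⌊σ * n⌋ (fun x => η x * u t x ^ α) := by
  have hn := S.n_pos
  refine intervalIntegral.integral_mono_on (S.time_lt hρ).le ((S.continuous_energy α _).intervalIntegrable _ _)
    (Continuous.intervalIntegrable (continuous_cubeEnergy fun x =>
      continuous_const.mul (S.sub.continuous_rpow α x)) _ _) fun t _ => ?_
  refine le_trans (le_of_eq ?_) (cubeEnergy_mono S.weight_pos
    (Int.floor_le_floor (mul_le_mul_of_nonneg_right hρσ hn.le) : ⌊ρ * n⌋ ≤ ⌊σ * n⌋) _)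
  refine Finset.sum_congr rfl fun j _ => Finset.sum_congr rfl fun x hx => ?_
  dsimp only
  rw [hη x (mem_cubeEdges.1 hx).1, hη _ (add_unitVec_mem_cube hx), one_mul, one_mul]

/-- One step of the absorption. -/
theorem Exponents.exists_total_step (X : Exponents D p q lam C c₀) :
    ∃ K : ℝ, 1 ≤ K ∧ ∀ {n τ t₀ M Λ : ℝ} {a : Fin (D + 1) → (Fin (D + 1) → ℤ) → ℝ}
      {u : ℝ → (Fin (D + 1) → ℤ) → ℝ} (_ : Setting D p q c₀ n τ t₀ M Λ a u) {α ρ σ : ℝ},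
      1 ≤ α → 1 / 2 ≤ ρ → ρ < σ → σ ≤ 1 → 2 ≤ (σ - ρ) * n →
      totalInt a u n τ t₀ Λ α ρ ≤ K * (α ^ 2 * ((σ - ρ)⁻¹ ^ 4 * ((Λ * (M + τ⁻¹)) *
        (massInt u n τ t₀ α σ ^ lam * totalInt a u n τ t₀ Λ α σ ^ (1 - lam))))) := by
  obtain ⟨K, hK, h⟩ := X.exists_cutoff_estimate
  refine ⟨K + 1, by linarith, ?_⟩
  intro n τ t₀ M Λ a u S α ρ σ hα hρ hρσ hσ hgap
  obtain ⟨η, h1, -, -, -, h2⟩ := h S hα hρ hρσ hσ hgap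
  have h3 := (energyInt_le_of_cutoff S (α := α) (by linarith) hρσ.le h1).trans h2
  have hn := S.n_pos
  have hΛ := S.Λ_pos
  have hM := S.M_pos
  have hτ := S.scale_pos
  have hl : 0 < 1 - lam := sub_pos.2 X.lam_lt
  have hg : 0 < massInt u n τ t₀ α σ := S.massInt_pos α (by linarith)
  have hgZ := S.massInt_le_totalInt α (show 0 < σ by linarith)
  have hgm := S.massInt_mono α (show 0 < ρ by linarith) hρσ.le
  have hδ : 1 ≤ (σ - ρ)⁻¹ := by rw [one_le_inv₀ (sub_pos.2 hρσ)]; linarith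
  unfold totalInt at *
  set Z := n ^ 2 * Λ * energyInt a u n τ t₀ α σ + massInt u n τ t₀ α σ
  set g := massInt u n τ t₀ α σ
  have hgG : g ≤ g ^ lam * Z ^ (1 - lam) := by
    calc g = g ^ lam * g ^ (1 - lam) := by rw [← Real.rpow_add hg, add_sub_cancel, Real.rpow_one]
      _ ≤ _ := by gcongr
  set Y := g ^ lam * Z ^ (1 - lam)
  have hY : 0 < Y := hg.trans_le hgG
  have h4 : n ^ 2 * Λ * energyInt a u n τ t₀ α ρ ≤ K * (α ^ 2 * ((σ - ρ)⁻¹ ^ 4 * ((Λ * (M + τ⁻¹)) * Y))) := by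
    refine (mul_le_mul_of_nonneg_left h3 (by positivity)).trans (le_of_eq ?_)
    field_simp
  have h5 : massInt u n τ t₀ α ρ ≤ α ^ 2 * ((σ - ρ)⁻¹ ^ 4 * ((Λ * (M + τ⁻¹)) * Y)) := by
    refine hgm.trans (hgG.trans ?_)
    rw [← mul_assoc, ← mul_assoc]
    refine le_mul_of_one_le_left hY.le ?_
    exact one_le_mul_of_one_le_of_one_le (one_le_mul_of_one_le_of_one_le (one_le_pow₀ hα) (one_le_pow₀ hδ)) S.one_le
  linarith

/-- The absorbed estimate. -/
theorem Exponents.exists_absorbed (X : Exponents D p q lam C c₀) :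
    ∃ K : ℝ, 1 ≤ K ∧ ∀ {n τ t₀ M Λ : ℝ} {a : Fin (D + 1) → (Fin (D + 1) → ℤ) → ℝ}
      {u : ℝ → (Fin (D + 1) → ℤ) → ℝ} (_ : Setting D p q c₀ n τ t₀ M Λ a u) {α ρ σ : ℝ},
      1 ≤ α → 1 / 2 ≤ ρ → ρ < σ → σ ≤ 1 → 2 * 2 ^ stepCount n ≤ (σ - ρ) * n →
      totalInt a u n τ t₀ Λ α ρ ≤ K * (α * (σ - ρ)⁻¹) ^ (4 / lam) *
        ((Λ * (M + τ⁻¹)) ^ (1 / lam) * massInt u n τ t₀ α σ) := by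
  obtain ⟨K, hK, hstep⟩ := X.exists_total_step
  have hl0 := X.lam_pos
  have hl : 0 < 1 - lam := sub_pos.2 X.lam_lt
  have hc := X.one_le_const
  obtain ⟨K', hK', hn'⟩ := exists_rpow_pow_stepCount_le hl (by linarith : 1 - lam < 1) (by positivity : (0:ℝ) ≤ (D + 3 : ℕ))
  set N₀ : ℝ := 8 * (D + 1) * c₀ with hN₀
  have hN₀1 : 1 ≤ N₀ := by
    have : (0:ℝ) ≤ D := Nat.cast_nonneg _
    exact one_le_mul_of_one_le_of_one_le (by linarith) hc
  refine ⟨(K * 16) ^ (1 / lam) * 16 ^ ((1 - lam) / lam ^ 2) * (N₀ * K'), ?_, ?_⟩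
  · refine one_le_mul_of_one_le_of_one_le (one_le_mul_of_one_le_of_one_le (Real.one_le_rpow (by linarith) (by positivity))
      (Real.one_le_rpow (by norm_num) (by positivity))) (one_le_mul_of_one_le_of_one_le hN₀1 hK')
  intro n τ t₀ M Λ a u S α ρ σ hα hρ hρσ hσ hgap
  have hn := S.n_pos
  have hn1 : 1 ≤ n := le_trans (by norm_num) S.large
  have hδ0 : 0 < σ - ρ := sub_pos.2 hρσ
  have hδ : 1 ≤ (σ - ρ)⁻¹ := by rw [one_le_inv₀ hδ0]; linarith
  have hA : 1 ≤ Λ * (M + τ⁻¹) := S.one_le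
  set A := Λ * (M + τ⁻¹)
  have hg : 0 < massInt u n τ t₀ α σ := S.massInt_pos α (by linarith)
  set g := massInt u n τ t₀ α σ with hgd
  let r : ℕ → ℝ := fun j => σ - (σ - ρ) * (2 ^ j)⁻¹
  have hr0 : r 0 = ρ := by simp [r]
  have hrσ : ∀ j, r j < σ := fun j => by simp only [r]; have : 0 < (σ - ρ) * (2 ^ j)⁻¹ := by positivity
                                         linarith
  have hrρ : ∀ j, ρ ≤ r j := fun j => by
    have : (σ - ρ) * (2 ^ j)⁻¹ ≤ σ - ρ := mul_le_of_le_one_right hδ0.le (inv_le_one_of_one_le₀ (one_le_pow₀ (by norm_num)))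
    simp only [r]; linarith
  have hrr : ∀ j, r (j + 1) - r j = (σ - ρ) * (2 ^ (j + 1))⁻¹ := fun j => by
    simp only [r, pow_succ]; field_simp; ring
  have hz0 : ∀ j, 0 ≤ totalInt a u n τ t₀ Λ α (r j) := fun j =>
    (S.massInt_pos α (by linarith [hrρ j])).le.trans (S.massInt_le_totalInt α (by linarith [hrρ j]))
  -- This quantity plays the role of `G` in `absorb_iterate`: its power `lam` is the prefactor `A
  -- g^lam`. The gaps halve at each scale and enter with power `-4`, whence the ratio `16`.
  have hG : 0 < A ^ (1 / lam) * g := by positivity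
  have hGl : (A ^ (1 / lam) * g) ^ lam = A * g ^ lam := by
    rw [Real.mul_rpow (by positivity) hg.le, ← Real.rpow_mul (by linarith), one_div_mul_cancel hl0.ne', Real.rpow_one]
  have key := absorb_iterate hl0 X.lam_lt (by norm_num : (1:ℝ) ≤ 16) hG (N := N₀ * n ^ (D + 3))
    (one_le_mul_of_one_le_of_one_le hN₀1 (one_le_pow₀ hn1)) (stepCount n) (K * 16 * (α ^ 2 * (σ - ρ)⁻¹ ^ 4))
    (fun j => totalInt a u n τ t₀ Λ α (r j))
    (one_le_mul_of_one_le_of_one_le (by linarith) (one_le_mul_of_one_le_of_one_le (one_le_pow₀ hα) (one_le_pow₀ hδ)))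
    hz0
    (by
      intro j hj
      have hgapj : 2 ≤ (r (j + 1) - r j) * n := by
        rw [hrr]
        have h2 : (2:ℝ) ^ (j + 1) ≤ 2 ^ stepCount n := pow_le_pow_right₀ (by norm_num) hj
        have h3 : 2 * 2 ^ (j + 1) ≤ (σ - ρ) * n := by linarith
        rw [mul_right_comm, ← div_eq_mul_inv, le_div_iff₀ (by positivity)]
        exact h3
      have h1 := hstep S hα (hρ.trans (hrρ j)) (by
        have : 0 < r (j + 1) - r j := by rw [hrr]; positivity
        linarith) ((hrσ (j + 1)).le.trans hσ) hgapj
      refine h1.trans ?_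
      rw [hGl, hrr]
      have hm := S.massInt_mono α (show 0 < r (j + 1) by linarith [hrρ (j + 1)]) (hrσ (j + 1)).le
      have hm0 : 0 < massInt u n τ t₀ α (r (j + 1)) := S.massInt_pos α (by linarith [hrρ (j + 1)])
      have e : ((σ - ρ) * (2 ^ (j + 1))⁻¹)⁻¹ ^ 4 = 16 * 16 ^ j * (σ - ρ)⁻¹ ^ 4 := by
        rw [mul_inv, inv_inv, mul_pow, ← pow_mul, mul_comm (j + 1) 4, pow_mul]
        norm_num [pow_succ]; ring
      rw [e]
      have hz := hz0 (j + 1)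
      calc _ ≤ K * (α ^ 2 * (16 * 16 ^ j * (σ - ρ)⁻¹ ^ 4 * (A * (g ^ lam * totalInt a u n τ t₀ Λ α (r (j + 1)) ^ (1 - lam))))) := by
            gcongr
        _ = _ := by ring)
    (by
      have h1 := S.crude_bound X.one_lt_p hc α (show 0 < r (stepCount n) by linarith [hrρ (stepCount n)]) ((hrσ _).le.trans hσ)
      refine h1.trans ?_
      have hm := S.massInt_mono α (show 0 < r (stepCount n) by linarith [hrρ (stepCount n)]) (hrσ (stepCount n)).le
      have hA1 : A ≤ A ^ (1 / lam) := by
        calc A = A ^ (1:ℝ) := (Real.rpow_one A).symm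
          _ ≤ _ := Real.rpow_le_rpow_of_exponent_le hA (by rw [one_le_div hl0]; exact X.lam_lt.le)
      have hm0 := (S.massInt_pos α (show 0 < r (stepCount n) by linarith [hrρ (stepCount n)])).le
      calc _ ≤ N₀ * n ^ (D + 3) * A ^ (1 / lam) * g := by gcongr
        _ = _ := by ring)
  simp only [hr0] at key
  refine key.trans ?_
  have b1 : (N₀ * n ^ (D + 3)) ^ ((1 - lam) ^ stepCount n) ≤ N₀ * K' := by
    have h1 := hn' n hn1
    rw [Real.rpow_natCast] at h1
    refine (mul_rpow_le_mul_rpow hN₀1 (by positivity) (pow_le_one₀ hl.le (by linarith))).trans ?_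
    gcongr
  have b2 : (K * 16 * (α ^ 2 * (σ - ρ)⁻¹ ^ 4)) ^ (1 / lam) ≤ (K * 16) ^ (1 / lam) * (α * (σ - ρ)⁻¹) ^ (4 / lam) := by
    rw [Real.mul_rpow (by positivity) (by positivity)]
    gcongr
    rw [show (4 : ℝ) / lam = ((4 : ℕ) : ℝ) * (1 / lam) by push_cast; ring, Real.rpow_mul (by positivity), Real.rpow_natCast, mul_pow]
    exact Real.rpow_le_rpow (by positivity) (mul_le_mul_of_nonneg_right (pow_le_pow_right₀ hα (by norm_num))
      (by positivity)) (by positivity)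
  calc _ ≤ ((K * 16) ^ (1 / lam) * (α * (σ - ρ)⁻¹) ^ (4 / lam)) * 16 ^ ((1 - lam) / lam ^ 2) * (N₀ * K') * (A ^ (1 / lam) * g) := by
        gcongr
    _ = _ := by ring

/-- Control of the cut-off power of `u` by its mass on a larger cylinder. -/
theorem Exponents.exists_cutoff_mass_estimate (X : Exponents D p q lam C c₀) :
    ∃ K e : ℝ, 1 ≤ K ∧ 0 ≤ e ∧ ∀ {n τ t₀ M Λ : ℝ} {a : Fin (D + 1) → (Fin (D + 1) → ℤ) → ℝ}
      {u : ℝ → (Fin (D + 1) → ℤ) → ℝ} (_ : Setting D p q c₀ n τ t₀ M Λ a u) {α ρ σ : ℝ},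
      1 ≤ α → 1 / 2 ≤ ρ → ρ < σ → σ ≤ 1 → 4 * 2 ^ stepCount n ≤ (σ - ρ) * n →
      ∃ (R : ℤ) (η : (Fin (D + 1) → ℤ) → ℝ), ⌊ρ * n⌋ ≤ R ∧ R ≤ ⌊n⌋ ∧ (∀ x ∈ cube (D + 1) ⌊ρ * n⌋, η x = 1) ∧
        (∀ x, x ∉ cube (D + 1) (R - 1) → η x = 0) ∧ (∀ x, 0 ≤ η x) ∧
        (∀ t ∈ Set.Icc (t₀ - ρ * (τ * n ^ 2)) t₀, ∑ x ∈ cube (D + 1) R, (η x * u t x ^ α) ^ 2 ≤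
          K * (α * (σ - ρ)⁻¹) ^ e * (n⁻¹ ^ 2 * ((M + τ⁻¹) * (Λ * (M + τ⁻¹)) ^ ((1 - lam) / lam)) * massInt u n τ t₀ α σ)) ∧
        ∫ t in (t₀ - ρ * (τ * n ^ 2))..t₀, cubeEnergy a R (fun x => η x * u t x ^ α) ≤
          K * (α * (σ - ρ)⁻¹) ^ e * (n⁻¹ ^ 2 * ((M + τ⁻¹) * (Λ * (M + τ⁻¹)) ^ ((1 - lam) / lam)) * massInt u n τ t₀ α σ) := by
  obtain ⟨K₁, hK₁, h1⟩ := X.exists_cutoff_estimate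
  obtain ⟨K₂, hK₂, h2⟩ := X.exists_absorbed
  have hl0 := X.lam_pos
  have hl : 0 < 1 - lam := sub_pos.2 X.lam_lt
  refine ⟨K₁ * 16 * (K₂ * 2 ^ (4 / lam)), 4 + 4 / lam, ?_, by positivity, ?_⟩
  · exact one_le_mul_of_one_le_of_one_le (by linarith) (one_le_mul_of_one_le_of_one_le hK₂
      (Real.one_le_rpow (by norm_num) (by positivity)))
  intro n τ t₀ M Λ a u S α ρ σ hα hρ hρσ hσ hgap
  have hn := S.n_pos
  have hM := S.M_pos
  have hτ := S.scale_pos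
  have hδ0 : 0 < σ - ρ := sub_pos.2 hρσ
  have hδ : 1 ≤ (σ - ρ)⁻¹ := by rw [one_le_inv₀ hδ0]; linarith
  have h2J : (1:ℝ) ≤ 2 ^ stepCount n := one_le_pow₀ (by norm_num)
  -- Half of the gap serves the cutoff estimate, the other half the absorption.
  set s := (ρ + σ) / 2 with hs
  have hs1 : s - ρ = (σ - ρ) / 2 := by rw [hs]; ring
  have hs2 : σ - s = (σ - ρ) / 2 := by rw [hs]; ring
  obtain ⟨η, e1, e2, e3, e4, e5⟩ := h1 S hα hρ (by linarith : ρ < s) (by linarith) (by rw [hs1]; linarith)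
  have h3 := h2 S hα (by linarith : 1 / 2 ≤ s) (by linarith : s < σ) hσ (by rw [hs2]; linarith)
  have hgm := S.massInt_mono α (show 0 < s by linarith) (by linarith : s ≤ σ)
  have hgp : 0 < massInt u n τ t₀ α s := S.massInt_pos α (by linarith)
  have hZ0 : 0 ≤ totalInt a u n τ t₀ Λ α s := hgp.le.trans (S.massInt_le_totalInt α (by linarith))
  have hA : 1 ≤ Λ * (M + τ⁻¹) := S.one_le
  set g := massInt u n τ t₀ α σ with hgd
  have hg : 0 < g := hgp.trans_le hgm
  have b1 : totalInt a u n τ t₀ Λ α s ^ (1 - lam) ≤ (K₂ * 2 ^ (4 / lam)) * (α * (σ - ρ)⁻¹) ^ (4 / lam) *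
      ((Λ * (M + τ⁻¹)) ^ ((1 - lam) / lam) * g ^ (1 - lam)) := by
    have hb : 1 ≤ (K₂ * 2 ^ (4 / lam)) * (α * (σ - ρ)⁻¹) ^ (4 / lam) :=
      one_le_mul_of_one_le_of_one_le (one_le_mul_of_one_le_of_one_le hK₂ (Real.one_le_rpow (by norm_num) (by positivity)))
        (Real.one_le_rpow (one_le_mul_of_one_le_of_one_le hα hδ) (by positivity))
    have h4 : totalInt a u n τ t₀ Λ α s ≤ (K₂ * 2 ^ (4 / lam)) * (α * (σ - ρ)⁻¹) ^ (4 / lam) *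
        ((Λ * (M + τ⁻¹)) ^ (1 / lam) * g) := by
      refine h3.trans (le_of_eq ?_)
      rw [hs2, inv_div, show α * (2 / (σ - ρ)) = 2 * (α * (σ - ρ)⁻¹) by ring, Real.mul_rpow (by norm_num) (by positivity)]
      ring
    refine (Real.rpow_le_rpow hZ0 h4 hl.le).trans ((mul_rpow_le_mul_rpow hb (by positivity) (by linarith)).trans (le_of_eq ?_))
    rw [Real.mul_rpow (by positivity) hg.le, ← Real.rpow_mul (by linarith)]
    rw [show 1 / lam * (1 - lam) = (1 - lam) / lam by ring]
  have b2 : K₁ * (α ^ 2 * ((s - ρ)⁻¹ ^ 4 * (n⁻¹ ^ 2 * ((M + τ⁻¹) * (massInt u n τ t₀ α s ^ lam *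
      totalInt a u n τ t₀ Λ α s ^ (1 - lam)))))) ≤
      K₁ * 16 * (K₂ * 2 ^ (4 / lam)) * (α * (σ - ρ)⁻¹) ^ (4 + 4 / lam) *
        (n⁻¹ ^ 2 * ((M + τ⁻¹) * (Λ * (M + τ⁻¹)) ^ ((1 - lam) / lam)) * g) := by
    have hg1 : g ^ lam * g ^ (1 - lam) = g := by rw [← Real.rpow_add hg, add_sub_cancel, Real.rpow_one]
    have he : (α * (σ - ρ)⁻¹) ^ (4 + 4 / lam) = (α * (σ - ρ)⁻¹) ^ 4 * (α * (σ - ρ)⁻¹) ^ (4 / lam) := by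
      rw [Real.rpow_add (by positivity)]; norm_cast
    have h5 : α ^ 2 * (s - ρ)⁻¹ ^ 4 ≤ 16 * (α * (σ - ρ)⁻¹) ^ 4 := by
      rw [hs1, inv_div, div_pow, mul_pow, inv_pow]
      have : α ^ 2 ≤ α ^ 4 := pow_le_pow_right₀ hα (by norm_num)
      calc α ^ 2 * (2 ^ 4 / (σ - ρ) ^ 4) ≤ α ^ 4 * (2 ^ 4 / (σ - ρ) ^ 4) := by gcongr
        _ = _ := by ring
    calc _ = K₁ * (α ^ 2 * (s - ρ)⁻¹ ^ 4) * (n⁻¹ ^ 2 * ((M + τ⁻¹) * (massInt u n τ t₀ α s ^ lam *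
      totalInt a u n τ t₀ Λ α s ^ (1 - lam)))) := by ring
      _ ≤ K₁ * (16 * (α * (σ - ρ)⁻¹) ^ 4) * (n⁻¹ ^ 2 * ((M + τ⁻¹) * (g ^ lam *
        ((K₂ * 2 ^ (4 / lam)) * (α * (σ - ρ)⁻¹) ^ (4 / lam) * ((Λ * (M + τ⁻¹)) ^ ((1 - lam) / lam) * g ^ (1 - lam)))))) := by gcongr
      _ = K₁ * 16 * (K₂ * 2 ^ (4 / lam)) * ((α * (σ - ρ)⁻¹) ^ 4 * (α * (σ - ρ)⁻¹) ^ (4 / lam)) *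
        (n⁻¹ ^ 2 * ((M + τ⁻¹) * (Λ * (M + τ⁻¹)) ^ ((1 - lam) / lam)) * (g ^ lam * g ^ (1 - lam))) := by ring
      _ = _ := by rw [hg1, he]
  exact ⟨⌊s * n⌋, η, Int.floor_le_floor (by gcongr; linarith),
    Int.floor_le_floor (mul_le_of_le_one_left hn.le (by linarith)), e1, e2, e3, fun t ht => (e4 t ht).trans b2, e5.trans b2⟩
end

/-! ### The reverse Hölder inequality -/

noncomputable section

/-- A Sobolev-type interpolation inequality for functions vanishing near the boundary of a cube. -/
theorem exists_gain_of_vanishing {D : ℕ} (hD : 1 ≤ D) {q : ℝ} (hq : 1 < q) (hδ0 : 0 < deltaTwo (D + 1) q)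
    (hδ1 : deltaTwo (D + 1) q < 1) :
    ∃ C : ℝ, 0 < C ∧ ∀ (R : ℤ) (a : Fin (D + 1) → (Fin (D + 1) → ℤ) → ℝ), (∀ j x, 0 < a j x) →
      ∀ w : (Fin (D + 1) → ℤ) → ℝ, (∀ x, 0 ≤ w x) → (∀ x, x ∉ cube (D + 1) (R - 1) → w x = 0) →
      ∑ x ∈ cube (D + 1) R, (w x ^ (1 + deltaTwo (D + 1) q)) ^ 2 ≤
        C * weightSum a R (-q) ^ (1 / q) * (cubeEnergy a R w * (∑ x ∈ cube (D + 1) R, w x ^ 2) ^ deltaTwo (D + 1) q) := by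
  obtain ⟨C, hC, h⟩ := exists_sobolev (D := D + 1) (by omega) hq
  refine ⟨C, hC, fun R a ha w hw hv => ?_⟩
  have h1 := h R a ha w hw 0 le_rfl (fun V hV => line_bound_zero V fun x hx i hi => hV x hx (hv x fun hx' => by
    have := mem_cube.1 hx' i
    omega))
  have e : 1 + 1 / q - 2 / ((D + 1 : ℕ) : ℝ) = 1 - deltaTwo (D + 1) q := by unfold deltaTwo; ring
  rw [e] at h1
  set δ := deltaTwo (D + 1) q
  -- Interpolation of the exponent `2(1+δ)` between `2` and the Sobolev exponent `2/(1-δ)`, with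
  -- weights chosen so that the energy enters linearly.
  have h2 := sum_rpow_mul_rpow_le (cube (D + 1) R) (fun x => w x ^ 2) (fun x => w x ^ (2 / (1 - δ))) hδ0
    (sub_pos.2 hδ1) (by ring) (fun x _ => sq_nonneg _) (fun x _ => Real.rpow_nonneg (hw x) _)
  have h3 : ∀ x, (w x ^ 2) ^ δ * (w x ^ (2 / (1 - δ))) ^ (1 - δ) = (w x ^ (1 + δ)) ^ 2 := by
    intro x
    have hδ' : 1 - δ ≠ 0 := (sub_pos.2 hδ1).ne'
    rw [← Real.rpow_natCast, ← Real.rpow_natCast, ← Real.rpow_mul (hw x), ← Real.rpow_mul (hw x), ← Real.rpow_mul (hw x),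
      ← Real.rpow_add_of_nonneg (hw x) (by positivity) (by rw [div_mul_cancel₀ _ hδ']; norm_num), div_mul_cancel₀ _ hδ']
    congr 1; push_cast; ring
  simp only [h3] at h2
  refine h2.trans ?_
  have h4 : (∑ x ∈ cube (D + 1) R, w x ^ (2 / (1 - δ))) ^ (1 - δ) ≤ C * (weightSum a R (-q) ^ (1 / q) * cubeEnergy a R w) := by
    refine h1.trans (le_of_eq ?_); ring
  refine (mul_le_mul_of_nonneg_left h4 (Real.rpow_nonneg (Finset.sum_nonneg fun _ _ => sq_nonneg _) _)).trans (le_of_eq ?_)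
  ring

variable {D : ℕ} {p q lam C c₀ n τ t₀ M Λ : ℝ} {a : Fin (D + 1) → (Fin (D + 1) → ℤ) → ℝ}
    {u : ℝ → (Fin (D + 1) → ℤ) → ℝ}

theorem Exponents.deltaTwo_pos (X : Exponents D p q lam C c₀) : 0 < deltaTwo (D + 1) q := by
  have h := X.dim_lt
  have hq : 0 < q := by have := X.one_lt_q; linarith
  have hD : (0:ℝ) < (D:ℝ) + 1 := by positivity
  unfold deltaTwo
  rw [sub_pos, div_lt_div_iff₀ hq (by push_cast; exact hD)]
  push_cast; linarith

theorem Exponents.deltaTwo_lt_one (X : Exponents D p q lam C c₀) : deltaTwo (D + 1) q < 1 := by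
  have hq : 0 < q := by have := X.one_lt_q; linarith
  have hD : (1:ℝ) ≤ D := by exact_mod_cast X.one_le_dim
  have h1 : 2 / ((D + 1 : ℕ) : ℝ) ≤ 1 := by
    push_cast
    rw [div_le_one (by linarith)]; linarith
  have h2 : 0 < 1 / q := by positivity
  unfold deltaTwo
  linarith

/-- The normalized mass of `u^(2α)` on the cylinder of relative size `σ`. -/
def massAvg {d : ℕ} (u : ℝ → (Fin d → ℤ) → ℝ) (n τ t₀ α σ : ℝ) : ℝ :=
  massInt u n τ t₀ α σ / (n ^ d * (τ * n ^ 2))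

/-- The factor in the reverse Hölder inequality. -/
def massFactor (lam τ M Λ : ℝ) : ℝ := τ * ((M + τ⁻¹) * (Λ * (M + τ⁻¹)) ^ ((1 - lam) / lam))

/-- The relation `dδ = 2 - d/q` makes `n^(d/q) n^(d(1+δ))` equal to `n^(d+2)`, the normalization of
the cylinder. The reverse Hölder inequality for averages therefore has a factor free of `n`. -/
theorem gain_arith {d : ℕ} {n τ Λ δ lam q Y K Z g S M : ℝ} (hn : 0 < n) (hτ : 0 < τ) (hΛ : 0 < Λ) (hM : 0 < M)
    (hK : 0 ≤ K) (hg : 0 ≤ g) (hδ : d * δ = 2 - d / q)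
    (hY : Y = K * (n⁻¹ ^ 2 * ((M + τ⁻¹) * (Λ * (M + τ⁻¹)) ^ ((1 - lam) / lam)) * g))
    (hS : S ≤ Z * (n ^ ((d : ℝ) / q) * Λ) * Y ^ (1 + δ)) :
    S / (n ^ d * (τ * n ^ 2)) ≤ Z * K ^ (1 + δ) * (Λ / τ * massFactor lam τ M Λ ^ (1 + δ)) *
      (g / (n ^ d * (τ * n ^ 2))) ^ (1 + δ) := by
  have hN : 0 < n ^ d * (τ * n ^ 2) := by positivity
  rw [div_le_iff₀ hN]
  refine hS.trans (le_of_eq ?_)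
  have hV : 0 ≤ massFactor lam τ M Λ := by unfold massFactor; positivity
  have hY' : Y = K * massFactor lam τ M Λ * n ^ d * (g / (n ^ d * (τ * n ^ 2))) := by
    rw [hY]; unfold massFactor; field_simp
  rw [hY', Real.mul_rpow (by positivity) (by positivity), Real.mul_rpow (by positivity) (by positivity),
    Real.mul_rpow hK hV]
  have e : n ^ ((d : ℝ) / q) * (n ^ d) ^ (1 + δ) = n ^ d * n ^ 2 := by
    rw [← Real.rpow_natCast n d, ← Real.rpow_natCast n 2, ← Real.rpow_mul hn.le, ← Real.rpow_add hn, ← Real.rpow_add hn]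
    congr 1; push_cast; linarith
  calc _ = Z * K ^ (1 + δ) * (Λ * massFactor lam τ M Λ ^ (1 + δ)) * (g / (n ^ d * (τ * n ^ 2))) ^ (1 + δ) *
        (n ^ ((d : ℝ) / q) * (n ^ d) ^ (1 + δ)) := by ring
    _ = _ := by rw [e]; field_simp

theorem Setting.inv_weight_rpow_le (S : Setting D p q c₀ n τ t₀ M Λ a u) (hq : 1 < q) (hc : 1 ≤ c₀) {R : ℤ} (hR : R ≤ ⌊n⌋) :
    weightSum a R (-q) ^ (1 / q) ≤ c₀ * (n ^ (((D + 1 : ℕ) : ℝ) / q) * Λ) := by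
  have hn := S.n_pos
  have hΛ := S.Λ_pos
  have hq0 : 0 < q := by linarith
  have h1 := (weightSum_mono S.weight_pos hR (-q)).trans S.inv_weight_le
  refine (Real.rpow_le_rpow (weightSum_nonneg S.weight_pos _ _) h1 (by positivity)).trans ?_
  rw [mul_assoc]
  refine (mul_rpow_le_mul_rpow hc (by positivity) (by rw [div_le_one hq0]; exact hq.le)).trans (le_of_eq ?_)
  rw [Real.mul_rpow (by positivity) (by positivity), ← Real.rpow_natCast n (D + 1), ← Real.rpow_mul hn.le, ← Real.rpow_mul hΛ.le,
    mul_one_div_cancel hq0.ne', Real.rpow_one, mul_one_div]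

/-- The reverse Hölder inequality and the pointwise-in-time bound for powers of `u`. -/
theorem Exponents.exists_gain (X : Exponents D p q lam C c₀) :
    ∃ K e : ℝ, 1 ≤ K ∧ 0 ≤ e ∧ ∀ {n τ t₀ M Λ : ℝ} {a : Fin (D + 1) → (Fin (D + 1) → ℤ) → ℝ}
      {u : ℝ → (Fin (D + 1) → ℤ) → ℝ} (_ : Setting D p q c₀ n τ t₀ M Λ a u) {α ρ σ : ℝ},
      1 ≤ α → 1 / 2 ≤ ρ → ρ < σ → σ ≤ 1 → 4 * 2 ^ stepCount n ≤ (σ - ρ) * n →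
      massAvg u n τ t₀ (α * (1 + deltaTwo (D + 1) q)) ρ ≤ K * (α * (σ - ρ)⁻¹) ^ e *
        (Λ / τ * massFactor lam τ M Λ ^ (1 + deltaTwo (D + 1) q)) * massAvg u n τ t₀ α σ ^ (1 + deltaTwo (D + 1) q) ∧
      ∀ t ∈ Set.Icc (t₀ - ρ * (τ * n ^ 2)) t₀, ∀ x ∈ cube (D + 1) ⌊ρ * n⌋, (u t x ^ α) ^ 2 ≤
        K * (α * (σ - ρ)⁻¹) ^ e * (massFactor lam τ M Λ * n ^ (D + 1)) * massAvg u n τ t₀ α σ := by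
  obtain ⟨K, e, hK, he, h⟩ := X.exists_cutoff_mass_estimate
  have hδ0 := X.deltaTwo_pos
  have hδ1 := X.deltaTwo_lt_one
  have hq := X.one_lt_q
  have hq0 : 0 < q := by linarith
  have hc := X.one_le_const
  obtain ⟨C', hC', hg⟩ := exists_gain_of_vanishing X.one_le_dim hq hδ0 hδ1
  have hdδ : ((D + 1 : ℕ) : ℝ) * deltaTwo (D + 1) q = 2 - ((D + 1 : ℕ) : ℝ) / q := by
    have : ((D + 1 : ℕ) : ℝ) ≠ 0 := by positivity
    unfold deltaTwo; field_simp
  set δ := deltaTwo (D + 1) q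
  refine ⟨C' * c₀ * K ^ (1 + δ) + K, e * (1 + δ) + e, ?_, by positivity, ?_⟩
  · have : 0 ≤ C' * c₀ * K ^ (1 + δ) := by positivity
    linarith
  intro n τ t₀ M Λ a u S α ρ σ hα hρ hρσ hσ hgap
  obtain ⟨R, η, hR1, hR2, e1, e2, e3, e4, e5⟩ := h S hα hρ hρσ hσ hgap
  have hn := S.n_pos
  have hM := S.M_pos
  have hτ := S.scale_pos
  have hΛ := S.Λ_pos
  have hδp : 0 < σ - ρ := sub_pos.2 hρσ
  have hL1 : 1 ≤ α * (σ - ρ)⁻¹ := one_le_mul_of_one_le_of_one_le hα (by rw [one_le_inv₀ hδp]; linarith)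
  set L := α * (σ - ρ)⁻¹
  have hgp : 0 < massInt u n τ t₀ α σ := S.massInt_pos α (by linarith)
  set Y := K * L ^ e * (n⁻¹ ^ 2 * ((M + τ⁻¹) * (Λ * (M + τ⁻¹)) ^ ((1 - lam) / lam)) * massInt u n τ t₀ α σ) with hY
  have hY0 : 0 < Y := by positivity
  have hV : 0 < massFactor lam τ M Λ := by unfold massFactor; positivity
  have hav : 0 < massAvg u n τ t₀ α σ := by unfold massAvg; positivity
  have hT := S.time_lt (show 0 < ρ by linarith)
  have hcE : Continuous fun t => cubeEnergy a R (fun x => η x * u t x ^ α) :=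
    continuous_cubeEnergy fun x => continuous_const.mul (S.sub.continuous_rpow α x)
  have hw := S.inv_weight_rpow_le hq hc hR2
  constructor
  · have hpt : ∀ t ∈ Set.Icc (t₀ - ρ * (τ * n ^ 2)) t₀,
        ∑ x ∈ cube (D + 1) ⌊ρ * n⌋, (u t x ^ (α * (1 + δ))) ^ 2 ≤
          (C' * (c₀ * (n ^ (((D + 1 : ℕ) : ℝ) / q) * Λ)) * Y ^ δ) * cubeEnergy a R (fun x => η x * u t x ^ α) := by
      intro t ht
      have hE := cubeEnergy_nonneg S.weight_pos R (fun x => η x * u t x ^ α)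
      have h1 : ∑ x ∈ cube (D + 1) ⌊ρ * n⌋, (u t x ^ (α * (1 + δ))) ^ 2 ≤
          ∑ x ∈ cube (D + 1) R, ((η x * u t x ^ α) ^ (1 + δ)) ^ 2 := by
        refine le_trans (le_of_eq (Finset.sum_congr rfl fun x hx => ?_)) (Finset.sum_le_sum_of_subset_of_nonneg (cube_mono hR1)
          fun _ _ _ => sq_nonneg _)
        rw [e1 x hx, one_mul, Real.rpow_mul (S.sub.pos t x).le]
      refine h1.trans ((hg R a S.weight_pos (fun x => η x * u t x ^ α)
        (fun x => mul_nonneg (e3 x) (Real.rpow_nonneg (S.sub.pos t x).le _)) (fun x hx => by rw [e2 x hx, zero_mul])).trans ?_)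
      have h2 : (∑ x ∈ cube (D + 1) R, (η x * u t x ^ α) ^ 2) ^ δ ≤ Y ^ δ :=
        Real.rpow_le_rpow (Finset.sum_nonneg fun _ _ => sq_nonneg _) (e4 t ht) hδ0.le
      calc _ ≤ C' * (c₀ * (n ^ (((D + 1 : ℕ) : ℝ) / q) * Λ)) * (cubeEnergy a R (fun x => η x * u t x ^ α) * Y ^ δ) := by gcongr
        _ = _ := by ring
    have hint : massInt u n τ t₀ (α * (1 + δ)) ρ ≤ C' * c₀ * (n ^ (((D + 1 : ℕ) : ℝ) / q) * Λ) * Y ^ (1 + δ) := by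
      calc massInt u n τ t₀ (α * (1 + δ)) ρ ≤ ∫ t in (t₀ - ρ * (τ * n ^ 2))..t₀,
            (C' * (c₀ * (n ^ (((D + 1 : ℕ) : ℝ) / q) * Λ)) * Y ^ δ) * cubeEnergy a R (fun x => η x * u t x ^ α) :=
            intervalIntegral.integral_mono_on hT.le ((S.continuous_mass _ _).intervalIntegrable _ _)
              ((continuous_const.mul hcE).intervalIntegrable _ _) hpt
        _ = (C' * (c₀ * (n ^ (((D + 1 : ℕ) : ℝ) / q) * Λ)) * Y ^ δ) *
            ∫ t in (t₀ - ρ * (τ * n ^ 2))..t₀, cubeEnergy a R (fun x => η x * u t x ^ α) :=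
            intervalIntegral.integral_const_mul _ _
        _ ≤ (C' * (c₀ * (n ^ (((D + 1 : ℕ) : ℝ) / q) * Λ)) * Y ^ δ) * Y := by gcongr
        _ = _ := by rw [Real.rpow_add hY0, Real.rpow_one]; ring
    have h1 := gain_arith (lam := lam) (S := massInt u n τ t₀ (α * (1 + δ)) ρ) hn hτ hΛ hM (by positivity) hgp.le hdδ hY hint
    refine h1.trans ?_
    change _ * massAvg u n τ t₀ α σ ^ (1 + δ) ≤ _
    have h2 : C' * c₀ * (K * L ^ e) ^ (1 + δ) ≤ (C' * c₀ * K ^ (1 + δ) + K) * L ^ (e * (1 + δ) + e) := by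
      rw [Real.mul_rpow (by positivity) (by positivity), ← Real.rpow_mul (by positivity), ← mul_assoc]
      gcongr
      · linarith
      · linarith
    gcongr
  · intro t ht x hx
    have h1 : (u t x ^ α) ^ 2 ≤ Y := by
      refine le_trans ?_ (e4 t ht)
      refine le_trans (le_of_eq ?_) (Finset.single_le_sum (f := fun x => (η x * u t x ^ α) ^ 2) (fun _ _ => sq_nonneg _)
        (cube_mono hR1 hx))
      rw [e1 x hx, one_mul]
    have h2 : Y = K * L ^ e * (massFactor lam τ M Λ * n ^ (D + 1)) * massAvg u n τ t₀ α σ := by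
      rw [hY]; unfold massFactor massAvg; field_simp
    rw [h2] at h1
    refine h1.trans ?_
    have h3 : K * L ^ e ≤ (C' * c₀ * K ^ (1 + δ) + K) * L ^ (e * (1 + δ) + e) := by
      gcongr
      · have : 0 ≤ C' * c₀ * K ^ (1 + δ) := by positivity
        linarith
      · have : 0 ≤ e * (1 + δ) := by positivity
        linarith
    gcongr
end

/-! ### Moser's iteration -/

noncomputable section

/-- Iteration of a superlinear recursive inequality. -/
theorem superlinear_iterate {δ c : ℝ} (hδ : 0 < δ) (hc1 : 1 ≤ c) :
    ∀ (k : ℕ) (B : ℝ) (z : ℕ → ℝ), 1 ≤ B → (∀ j, 0 ≤ z j) →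
      (∀ j < k, z (j + 1) ≤ B * c ^ j * z j ^ (1 + δ)) →
      z k ≤ (B ^ (1 / δ) * c ^ (1 / δ ^ 2) * z 0) ^ ((1 + δ) ^ k) := by
  have hc : 0 < c := by linarith
  intro k
  induction k with
  | zero =>
    intro B z hB hz _
    rw [pow_zero, Real.rpow_one]
    exact le_mul_of_one_le_left (hz 0) (one_le_mul_of_one_le_of_one_le (Real.one_le_rpow hB (by positivity))
      (Real.one_le_rpow hc1 (by positivity)))
  | succ k ih =>
    intro B z hB1 hz h
    have hB : 0 < B := by linarith
    -- The exponents `x = 1/δ` and `y = 1/δ²` satisfy `(1+δ) x = x + 1` and `(1+δ) y = x + y`, hence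
    -- survive the shift of the sequence.
    have h1 := ih (B * c) (fun j => z (j + 1)) (one_le_mul_of_one_le_of_one_le hB1 hc1) (fun j => hz _)
      (fun j hj => (h (j + 1) (by omega)).trans (le_of_eq (by ring)))
    have h0 := h 0 (by omega)
    rw [pow_zero, mul_one, zero_add] at h0
    refine h1.trans ?_
    have hz0 := hz 0
    have hz1 := hz 1
    rw [pow_succ' (1 + δ), Real.rpow_mul (by positivity)]
    refine Real.rpow_le_rpow (by positivity) ?_ (by positivity)
    refine (mul_le_mul_of_nonneg_left h0 (by positivity)).trans (le_of_eq ?_)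
    rw [Real.mul_rpow (by positivity) hz0, Real.mul_rpow hB.le hc.le, Real.mul_rpow (by positivity) (by positivity),
      ← Real.rpow_mul hB.le, ← Real.rpow_mul hc.le]
    have e1 : B ^ (1 / δ) * B = B ^ (1 / δ * (1 + δ)) := by
      conv_lhs => rw [← Real.rpow_one B, ← Real.rpow_mul hB.le, ← Real.rpow_add hB]
      congr 1; field_simp
    have e2 : c ^ (1 / δ) * c ^ (1 / δ ^ 2) = c ^ (1 / δ ^ 2 * (1 + δ)) := by
      rw [← Real.rpow_add hc]; congr 1; field_simp; ring
    rw [← e1, ← e2]; ring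

/-- The factor in the local boundedness estimate. -/
def boundFactor (lam δ τ M Λ : ℝ) : ℝ :=
  τ * (M + τ⁻¹) * (Λ * (M + τ⁻¹)) ^ (1 / (lam * δ) + (1 - lam) / lam)

/-- With the prefactor written as the `δ`-th power of `F`, the product of `F` and the average
satisfies a recursion in which neither the weights nor `τ` appear. -/
theorem boundFactor_eq {lam δ τ M Λ : ℝ} (hl : 0 < lam) (hδ : 0 < δ) (hτ : 0 < τ) (hM : 0 < M) (hΛ : 0 < Λ) :
    Λ / τ * massFactor lam τ M Λ ^ (1 + δ) = boundFactor lam δ τ M Λ ^ δ := by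
  unfold massFactor boundFactor
  set A := M + τ⁻¹ with hA
  have hA0 : 0 < A := by positivity
  rw [Real.mul_rpow hτ.le (by positivity), Real.mul_rpow hA0.le (by positivity),
    Real.mul_rpow (x := τ * A) (by positivity) (by positivity), Real.mul_rpow hτ.le hA0.le,
    ← Real.rpow_mul (by positivity), ← Real.rpow_mul (by positivity), Real.rpow_add hτ, Real.rpow_add hA0,
    Real.rpow_one, Real.rpow_one]
  have e : (Λ * A) ^ ((1 / (lam * δ) + (1 - lam) / lam) * δ) = (Λ * A) * (Λ * A) ^ ((1 - lam) / lam * (1 + δ)) := by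
    conv_rhs => rw [← Real.rpow_one (Λ * A), ← Real.rpow_mul (by positivity), ← Real.rpow_add (by positivity)]
    congr 1; field_simp; ring
  rw [e]
  field_simp

theorem one_le_scale_mul {τ M : ℝ} (hτ : 0 < τ) (hM : 0 < M) : 1 ≤ τ * (M + τ⁻¹) := by
  rw [mul_add, mul_inv_cancel₀ hτ.ne']
  have := mul_pos hτ hM
  linarith

theorem one_le_boundFactor {lam δ τ M Λ : ℝ} (hl : 0 < lam) (hl1 : lam < 1) (hδ : 0 < δ) (hτ : 0 < τ) (hM : 0 < M)
    (hΛ : 1 ≤ Λ * (M + τ⁻¹)) : 1 ≤ boundFactor lam δ τ M Λ := by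
  have : 0 < 1 - lam := sub_pos.2 hl1
  exact one_le_mul_of_one_le_of_one_le (one_le_scale_mul hτ hM) (Real.one_le_rpow hΛ (by positivity))

theorem massFactor_le_boundFactor {lam δ τ M Λ : ℝ} (hl : 0 < lam) (hδ : 0 < δ) (hτ : 0 < τ) (hM : 0 < M)
    (hΛ : 1 ≤ Λ * (M + τ⁻¹)) : massFactor lam τ M Λ ≤ boundFactor lam δ τ M Λ := by
  have : (Λ * (M + τ⁻¹)) ^ ((1 - lam) / lam) ≤ (Λ * (M + τ⁻¹)) ^ (1 / (lam * δ) + (1 - lam) / lam) :=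
    Real.rpow_le_rpow_of_exponent_le hΛ (by have : 0 < 1 / (lam * δ) := by positivity
                                            linarith)
  unfold massFactor boundFactor
  rw [← mul_assoc]
  gcongr

theorem two_pow_stepCount_le {n : ℝ} (hn : 1 ≤ n) : (2:ℝ) ^ stepCount n ≤ n ^ (1 / 4 : ℝ) := by
  have hn0 : 0 < n := by linarith
  have h : (stepCount n : ℝ) ≤ 1 / 4 * Real.logb 2 n :=
    Nat.floor_le (mul_nonneg (by norm_num) (Real.logb_nonneg (by norm_num) hn))
  calc (2:ℝ) ^ stepCount n = 2 ^ (stepCount n : ℝ) := (Real.rpow_natCast _ _).symm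
    _ ≤ 2 ^ (Real.logb 2 n * (1 / 4)) := Real.rpow_le_rpow_of_exponent_le (by norm_num) (by linarith)
    _ = n ^ (1 / 4 : ℝ) := by rw [Real.rpow_mul (by norm_num), Real.rpow_logb (by norm_num) (by norm_num) hn0]

variable {D : ℕ} {p q lam C c₀ n τ t₀ M Λ : ℝ} {a : Fin (D + 1) → (Fin (D + 1) → ℤ) → ℝ}
    {u : ℝ → (Fin (D + 1) → ℤ) → ℝ}

/-- The quadratic bound of Moser's iteration. -/
theorem Exponents.exists_sq_bound (X : Exponents D p q lam C c₀) :
    ∃ K e : ℝ, 1 ≤ K ∧ 0 ≤ e ∧ ∀ {n τ t₀ M Λ : ℝ} {a : Fin (D + 1) → (Fin (D + 1) → ℤ) → ℝ}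
      {u : ℝ → (Fin (D + 1) → ℤ) → ℝ} (_ : Setting D p q c₀ n τ t₀ M Λ a u) {ρ σ : ℝ},
      1 / 2 ≤ ρ → ρ < σ → σ ≤ 1 → 4 * (2 ^ stepCount n * 2 ^ stepCount n) ≤ (σ - ρ) * n →
      ∀ t ∈ Set.Icc (t₀ - ρ * (τ * n ^ 2)) t₀, ∀ x ∈ cube (D + 1) ⌊ρ * n⌋, u t x ^ 2 ≤
        K * (σ - ρ)⁻¹ ^ e * boundFactor lam (deltaTwo (D + 1) q) τ M Λ * massAvg u n τ t₀ 1 σ := by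
  obtain ⟨K, e, hK, he, h⟩ := X.exists_gain
  have hδ0 := X.deltaTwo_pos
  have hδ1 := X.deltaTwo_lt_one
  set δ := deltaTwo (D + 1) q
  have hβ0 : 0 < (1 + δ)⁻¹ := by positivity
  have hβ1 : (1 + δ)⁻¹ < 1 := inv_lt_one_of_one_lt₀ (by linarith)
  obtain ⟨K', hK', hn'⟩ := exists_rpow_pow_stepCount_le hβ0 hβ1 (by positivity : (0:ℝ) ≤ (D + 1 : ℕ) + e)
  have hK0 : 0 < K := by linarith
  refine ⟨K * K' * ((K * 2 ^ e) ^ (1 / δ) * (4 ^ e) ^ (1 / δ ^ 2)), e + e / δ, ?_, by positivity, ?_⟩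
  · refine one_le_mul_of_one_le_of_one_le (one_le_mul_of_one_le_of_one_le hK hK')
      (one_le_mul_of_one_le_of_one_le (Real.one_le_rpow (one_le_mul_of_one_le_of_one_le hK
        (Real.one_le_rpow (by norm_num) he)) (by positivity)) (Real.one_le_rpow (Real.one_le_rpow (by norm_num) he) (by positivity)))
  intro n τ t₀ M Λ a u S ρ σ hρ hρσ hσ hgap t ht x hx
  have hn := S.n_pos
  have hn1 : 1 ≤ n := le_trans (by norm_num) S.large
  have hM := S.M_pos
  have hτ := S.scale_pos
  have hΛ := S.Λ_pos
  have hd0 : 0 < σ - ρ := sub_pos.2 hρσ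
  have hd1 : 1 ≤ (σ - ρ)⁻¹ := by rw [one_le_inv₀ hd0]; linarith
  have hH := boundFactor_eq X.lam_pos hδ0 hτ hM hΛ
  have hHV := massFactor_le_boundFactor X.lam_pos hδ0 hτ hM S.one_le
  have hF1 := one_le_boundFactor X.lam_pos X.lam_lt hδ0 hτ hM S.one_le
  set F := boundFactor lam δ τ M Λ
  have hF0 : 0 < F := by linarith
  have hu := S.sub.pos t x
  set J := stepCount n with hJ
  let r : ℕ → ℝ := fun j => ρ + (σ - ρ) * (2 ^ j)⁻¹
  have hr0 : r 0 = σ := by simp [r]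
  have hrρ : ∀ j, ρ < r j := fun j => by simp only [r]; have : 0 < (σ - ρ) * (2 ^ j)⁻¹ := by positivity
                                         linarith
  have hrσ : ∀ j, r j ≤ 1 := fun j => by
    have : (σ - ρ) * (2 ^ j)⁻¹ ≤ σ - ρ := mul_le_of_le_one_right hd0.le (inv_le_one_of_one_le₀ (one_le_pow₀ (by norm_num)))
    simp only [r]; linarith
  have hrr : ∀ j, r j - r (j + 1) = (σ - ρ) * (2 ^ (j + 1))⁻¹ := fun j => by
    simp only [r, pow_succ]; field_simp; ring
  have hrJ : ∀ j, r j - ρ = (σ - ρ) * (2 ^ j)⁻¹ := fun j => by simp only [r]; ring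
  -- Two factors `2^J` are needed in the hypothesis on the gap: one for the `J` halvings here, one
  -- for the absorption inside each step.
  have hgapj : ∀ j ≤ J, 4 * 2 ^ J ≤ ((σ - ρ) * (2 ^ j)⁻¹) * n := by
    intro j hj
    rw [mul_right_comm, ← div_eq_mul_inv, le_div_iff₀ (by positivity)]
    have h2 : (2:ℝ) ^ j ≤ 2 ^ J := pow_le_pow_right₀ (by norm_num) hj
    calc (4:ℝ) * 2 ^ J * 2 ^ j ≤ 4 * 2 ^ J * 2 ^ J := by gcongr
      _ ≤ _ := by linarith
  have hα1 : ∀ k : ℕ, 1 ≤ (1 + δ) ^ k := fun k => one_le_pow₀ (by linarith)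
  have hα2 : ∀ k : ℕ, (1 + δ) ^ k ≤ 2 ^ k := fun k => pow_le_pow_left₀ (by linarith) (by linarith) k
  have hav : ∀ k, 0 < massAvg u n τ t₀ ((1 + δ) ^ k) (r k) := fun k => by
    have := S.massInt_pos ((1 + δ) ^ k) (show 0 < r k by linarith [hrρ k])
    unfold massAvg; positivity
  let z : ℕ → ℝ := fun k => F * massAvg u n τ t₀ ((1 + δ) ^ k) (r k)
  have hz0 : z 0 = F * massAvg u n τ t₀ 1 σ := by simp only [z, pow_zero, hr0]
  have hstep : ∀ k < J, z (k + 1) ≤ (K * 2 ^ e * (σ - ρ)⁻¹ ^ e) * (4 ^ e) ^ k * z k ^ (1 + δ) := by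
    intro k hk
    have h1 := (h S (hα1 k) (hρ.trans (hrρ (k + 1)).le) (by
        have : 0 < r k - r (k + 1) := by rw [hrr]; positivity
        linarith) (hrσ k) (by rw [hrr]; exact hgapj _ hk)).1
    rw [← pow_succ, hrr, hH] at h1
    have h2 : ((1 + δ) ^ k * ((σ - ρ) * (2 ^ (k + 1))⁻¹)⁻¹) ^ e ≤ 2 ^ e * (σ - ρ)⁻¹ ^ e * (4 ^ e) ^ k := by
      have h3 : (1 + δ) ^ k * ((σ - ρ) * (2 ^ (k + 1))⁻¹)⁻¹ ≤ 2 * (σ - ρ)⁻¹ * 4 ^ k := by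
        calc _ ≤ 2 ^ k * ((σ - ρ) * (2 ^ (k + 1))⁻¹)⁻¹ := mul_le_mul_of_nonneg_right (hα2 k) (by positivity)
          _ = 2 * (σ - ρ)⁻¹ * (2 ^ k * 2 ^ k) := by rw [mul_inv, inv_inv, pow_succ]; ring
          _ = _ := by rw [← mul_pow]; norm_num
      refine (Real.rpow_le_rpow (by positivity) h3 he).trans (le_of_eq ?_)
      rw [Real.mul_rpow (by positivity) (by positivity), Real.mul_rpow (by positivity) (by positivity),
        ← Real.rpow_natCast, ← Real.rpow_natCast, ← Real.rpow_mul (by norm_num), ← Real.rpow_mul (by norm_num), mul_comm e]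
    have hk0 := hav k
    calc z (k + 1) ≤ F * (K * (2 ^ e * (σ - ρ)⁻¹ ^ e * (4 ^ e) ^ k) * F ^ δ * massAvg u n τ t₀ ((1 + δ) ^ k) (r k) ^ (1 + δ)) := by
          refine mul_le_mul_of_nonneg_left (h1.trans ?_) hF0.le
          gcongr
      _ = (K * 2 ^ e * (σ - ρ)⁻¹ ^ e) * (4 ^ e) ^ k * (F ^ (1 + δ) * massAvg u n τ t₀ ((1 + δ) ^ k) (r k) ^ (1 + δ)) := by
          rw [Real.rpow_add hF0, Real.rpow_one]; ring
      _ = _ := by rw [← Real.mul_rpow hF0.le hk0.le]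
  have hit := superlinear_iterate hδ0 (Real.one_le_rpow (by norm_num) he : (1:ℝ) ≤ 4 ^ e) J (K * 2 ^ e * (σ - ρ)⁻¹ ^ e) z
    (one_le_mul_of_one_le_of_one_le (one_le_mul_of_one_le_of_one_le hK (Real.one_le_rpow (by norm_num) he))
      (Real.one_le_rpow hd1 he))
    (fun j => mul_nonneg hF0.le (hav j).le) hstep
  rw [hz0] at hit
  -- At the last scale one value is bounded by the sum over the cube, which costs a power of `n`.
  -- The `(1+δ)^J`-th root taken below reduces that power to a constant.
  have hlast := (h S (hα1 J) hρ (hrρ J) (hrσ J) (by rw [hrJ]; exact hgapj _ le_rfl)).2 t ht x hx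
  rw [hrJ] at hlast
  set W := (K * 2 ^ e * (σ - ρ)⁻¹ ^ e) ^ (1 / δ) * (4 ^ e) ^ (1 / δ ^ 2) * (F * massAvg u n τ t₀ 1 σ) with hW
  have hW0 : 0 < W := by
    have : 0 < F * massAvg u n τ t₀ 1 σ := by rw [← hz0]; exact mul_pos hF0 (hav 0)
    positivity
  have hfin : (u t x ^ ((1 + δ) ^ J)) ^ 2 ≤ K * (σ - ρ)⁻¹ ^ e * n ^ (((D + 1 : ℕ) : ℝ) + e) * W ^ ((1 + δ) ^ J) := by
    -- Since `δ < 1`, the power of `u` and the inverse gap grow together by at most `4^J ≤ n^(1/2)`.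
    have h3 : (1 + δ) ^ J * ((σ - ρ) * (2 ^ J)⁻¹)⁻¹ ≤ (σ - ρ)⁻¹ * n := by
      have h4 := two_pow_stepCount_le hn1
      calc _ ≤ 2 ^ J * ((σ - ρ) * (2 ^ J)⁻¹)⁻¹ := mul_le_mul_of_nonneg_right (hα2 J) (by positivity)
        _ = (σ - ρ)⁻¹ * (2 ^ J * 2 ^ J) := by rw [mul_inv, inv_inv]; ring
        _ ≤ (σ - ρ)⁻¹ * (n ^ (1 / 4 : ℝ) * n ^ (1 / 4 : ℝ)) := by gcongr
        _ ≤ (σ - ρ)⁻¹ * n := by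
          gcongr
          rw [← Real.rpow_add hn]
          calc n ^ (1 / 4 + 1 / 4 : ℝ) ≤ n ^ (1 : ℝ) := Real.rpow_le_rpow_of_exponent_le hn1 (by norm_num)
            _ = n := Real.rpow_one n
    have h5 : ((1 + δ) ^ J * ((σ - ρ) * (2 ^ J)⁻¹)⁻¹) ^ e ≤ (σ - ρ)⁻¹ ^ e * n ^ e := by
      rw [← Real.mul_rpow (by positivity) hn.le]
      exact Real.rpow_le_rpow (by positivity) h3 he
    have hJ0 := hav J
    have hV0 : 0 < massFactor lam τ M Λ := by unfold massFactor; positivity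
    refine hlast.trans ?_
    calc _ ≤ K * ((σ - ρ)⁻¹ ^ e * n ^ e) * (F * n ^ (D + 1)) * massAvg u n τ t₀ ((1 + δ) ^ J) (r J) := by gcongr
      _ = K * (σ - ρ)⁻¹ ^ e * n ^ (((D + 1 : ℕ) : ℝ) + e) * z J := by
        rw [Real.rpow_add hn, Real.rpow_natCast]; ring
      _ ≤ _ := by gcongr
  have hp0 : 0 < (1 + δ) ^ J := by positivity
  have hroot := Real.rpow_le_rpow (sq_nonneg _) hfin (by positivity : 0 ≤ ((1 + δ)⁻¹) ^ J)
  have hl : ((u t x ^ ((1 + δ) ^ J)) ^ 2) ^ (((1 + δ)⁻¹) ^ J) = u t x ^ 2 := by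
    rw [← Real.rpow_natCast _ 2, ← Real.rpow_natCast _ 2, ← Real.rpow_mul hu.le, ← Real.rpow_mul hu.le, inv_pow]
    congr 1; field_simp
  rw [hl, Real.mul_rpow (by positivity) (by positivity), ← Real.rpow_mul hW0.le, inv_pow, mul_inv_cancel₀ hp0.ne', Real.rpow_one,
    ← inv_pow] at hroot
  have hb1 : ((1 + δ)⁻¹) ^ J ≤ 1 := pow_le_one₀ hβ0.le hβ1.le
  have h6 : (K * (σ - ρ)⁻¹ ^ e * n ^ (((D + 1 : ℕ) : ℝ) + e)) ^ (((1 + δ)⁻¹) ^ J) ≤ K * (σ - ρ)⁻¹ ^ e * K' := by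
    refine (mul_rpow_le_mul_rpow (one_le_mul_of_one_le_of_one_le hK (Real.one_le_rpow hd1 he)) (by positivity) hb1).trans ?_
    gcongr
    exact hn' n hn1
  refine hroot.trans ((mul_le_mul_of_nonneg_right h6 hW0.le).trans (le_of_eq ?_))
  rw [hW, Real.mul_rpow (by positivity) (by positivity), ← Real.rpow_mul (by positivity), Real.rpow_add (by positivity), mul_one_div]
  ring
end

/-! ### From the mean of `u²` to the mean of `u` -/

noncomputable section

theorem le_cylSupNorm {d : ℕ} {u : ℝ → (Fin d → ℤ) → ℝ} (hu : ∀ x, Continuous fun t => u t x) {A B : ℝ}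
    {S : Finset (Fin d → ℤ)} {t : ℝ} (ht : t ∈ Set.Icc A B) {x : Fin d → ℤ} (hx : x ∈ S) :
    u t x ≤ cylSupNorm (Set.Icc A B) S u := by
  refine (le_abs_self _).trans (le_csSup ?_ ⟨t, ht, x, hx, rfl⟩)
  have h : BddAbove (⋃ x ∈ (S : Set (Fin d → ℤ)), (fun t => |u t x|) '' Set.Icc A B) := by
    rw [(Finset.finite_toSet S).bddAbove_biUnion]
    intro x _
    exact isCompact_Icc.bddAbove_image (hu x).abs.continuousOn
  refine h.mono ?_
  rintro r ⟨t, ht, x, hx, rfl⟩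
  simp only [Set.mem_iUnion]
  exact ⟨x, hx, t, ht, rfl⟩

theorem cylSupNorm_le {d : ℕ} {u : ℝ → (Fin d → ℤ) → ℝ} {I : Set ℝ} {S : Finset (Fin d → ℤ)} (hI : I.Nonempty)
    (hS : S.Nonempty) {b : ℝ} (h : ∀ t ∈ I, ∀ x ∈ S, |u t x| ≤ b) : cylSupNorm I S u ≤ b := by
  obtain ⟨t, ht⟩ := hI
  obtain ⟨x, hx⟩ := hS
  refine csSup_le ⟨_, t, ht, x, hx, rfl⟩ ?_
  rintro r ⟨t, ht, x, hx, rfl⟩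
  exact h t ht x hx

theorem cube_nonempty {d : ℕ} {R : ℤ} (hR : 0 ≤ R) : (cube d R).Nonempty :=
  ⟨0, by rw [mem_cube]; intro i; simp [hR]⟩

theorem card_cube_floor_le {d : ℕ} {n : ℝ} (hn1 : 1 ≤ n) : ((cube d ⌊n⌋).card : ℝ) ≤ 3 ^ d * n ^ d := by
  have hn : 0 ≤ n := by linarith
  have hf : (0:ℝ) ≤ ⌊n⌋ := by exact_mod_cast Int.floor_nonneg.2 hn
  rw [card_cube (Int.floor_nonneg.2 hn), ← mul_pow]
  refine pow_le_pow_left₀ (by linarith) ?_ _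
  have := Int.floor_le n
  linarith

/-- The supremum of `u` over the cylinder of relative size `σ`. -/
def supOn {d : ℕ} (u : ℝ → (Fin d → ℤ) → ℝ) (n τ t₀ σ : ℝ) : ℝ :=
  cylSupNorm (Set.Icc (t₀ - σ * (τ * n ^ 2)) t₀) (cube d ⌊σ * n⌋) u

/-- The normalized integral of `u` over the cylinder of size `n`. -/
def meanOn {d : ℕ} (u : ℝ → (Fin d → ℤ) → ℝ) (n τ t₀ : ℝ) : ℝ :=
  (∫ t in (t₀ - τ * n ^ 2)..t₀, ∑ x ∈ cube d ⌊n⌋, u t x) / (n ^ d * (τ * n ^ 2))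

variable {D : ℕ} {p q lam C c₀ n τ t₀ M Λ : ℝ} {a : Fin (D + 1) → (Fin (D + 1) → ℤ) → ℝ}
    {u : ℝ → (Fin (D + 1) → ℤ) → ℝ}

namespace Setting

theorem le_supOn (S : Setting D p q c₀ n τ t₀ M Λ a u) {σ t : ℝ} (ht : t ∈ Set.Icc (t₀ - σ * (τ * n ^ 2)) t₀)
    {x : Fin (D + 1) → ℤ} (hx : x ∈ cube (D + 1) ⌊σ * n⌋) : u t x ≤ supOn u n τ t₀ σ :=
  le_cylSupNorm S.sub.cont ht hx

theorem supOn_le (S : Setting D p q c₀ n τ t₀ M Λ a u) {σ b : ℝ} (hσ : 0 < σ)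
    (h : ∀ t ∈ Set.Icc (t₀ - σ * (τ * n ^ 2)) t₀, ∀ x ∈ cube (D + 1) ⌊σ * n⌋, u t x ≤ b) : supOn u n τ t₀ σ ≤ b :=
  cylSupNorm_le (Set.nonempty_Icc.2 (S.time_lt hσ).le) (cube_nonempty (Int.floor_nonneg.2 (mul_pos hσ S.n_pos).le))
    fun t ht x hx => by rw [abs_of_pos (S.sub.pos t x)]; exact h t ht x hx

theorem supOn_pos (S : Setting D p q c₀ n τ t₀ M Λ a u) {σ : ℝ} (hσ : 0 < σ) : 0 < supOn u n τ t₀ σ := by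
  obtain ⟨x, hx⟩ := cube_nonempty (d := D + 1) (Int.floor_nonneg.2 (mul_pos hσ S.n_pos).le)
  exact (S.sub.pos t₀ x).trans_le (S.le_supOn ⟨(S.time_lt hσ).le, le_rfl⟩ hx)

theorem supOn_mono (S : Setting D p q c₀ n τ t₀ M Λ a u) {ρ σ : ℝ} (hρ : 0 < ρ) (h : ρ ≤ σ) :
    supOn u n τ t₀ ρ ≤ supOn u n τ t₀ σ :=
  S.supOn_le hρ fun t ht x hx => S.le_supOn
    ⟨le_trans (by have := S.time_pos; gcongr) ht.1, ht.2⟩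
    (cube_mono (Int.floor_le_floor (by have := S.n_pos; gcongr)) hx)

theorem continuous_sum (S : Setting D p q c₀ n τ t₀ M Λ a u) (R : ℤ) :
    Continuous fun t => ∑ x ∈ cube (D + 1) R, u t x := continuous_finsetSum _ fun x _ => S.sub.cont x

theorem meanOn_pos (S : Setting D p q c₀ n τ t₀ M Λ a u) : 0 < meanOn u n τ t₀ := by
  have hn := S.n_pos
  have hτ := S.scale_pos
  refine div_pos (intervalIntegral.intervalIntegral_pos_of_pos ((S.continuous_sum _).intervalIntegrable _ _)
    (fun t => Finset.sum_pos (fun x _ => S.sub.pos t x) (cube_nonempty (Int.floor_nonneg.2 hn.le)))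
    (by have := S.time_pos; linarith)) (by positivity)

/-- Bounding one factor of `u²` by the supremum trades the quadratic mean for the linear one; the
supremum is then absorbed. -/
theorem massAvg_le (S : Setting D p q c₀ n τ t₀ M Λ a u) {σ : ℝ} (hσ : 0 < σ) (hσ1 : σ ≤ 1) :
    massAvg u n τ t₀ 1 σ ≤ supOn u n τ t₀ σ * meanOn u n τ t₀ := by
  have hn := S.n_pos
  have hτ := S.scale_pos
  have hT := S.time_pos
  have hs := S.supOn_pos hσ
  have h1 : massInt u n τ t₀ 1 σ ≤ ∫ t in (t₀ - σ * (τ * n ^ 2))..t₀, supOn u n τ t₀ σ * ∑ x ∈ cube (D + 1) ⌊n⌋, u t x := by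
    refine intervalIntegral.integral_mono_on (S.time_lt hσ).le ((S.continuous_mass _ _).intervalIntegrable _ _)
      ((continuous_const.mul (S.continuous_sum _)).intervalIntegrable _ _) fun t ht => ?_
    calc ∑ x ∈ cube (D + 1) ⌊σ * n⌋, (u t x ^ (1:ℝ)) ^ 2 ≤ ∑ x ∈ cube (D + 1) ⌊σ * n⌋, supOn u n τ t₀ σ * u t x := by
          refine Finset.sum_le_sum fun x hx => ?_
          rw [Real.rpow_one, sq]
          exact mul_le_mul_of_nonneg_right (S.le_supOn ht hx) (S.sub.pos t x).le
      _ = supOn u n τ t₀ σ * ∑ x ∈ cube (D + 1) ⌊σ * n⌋, u t x := (Finset.mul_sum _ _ _).symm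
      _ ≤ _ := mul_le_mul_of_nonneg_left (Finset.sum_le_sum_of_subset_of_nonneg
          (cube_mono (Int.floor_le_floor (mul_le_of_le_one_left hn.le hσ1))) fun x _ _ => (S.sub.pos t x).le) hs.le
  have h2 : ∫ t in (t₀ - σ * (τ * n ^ 2))..t₀, supOn u n τ t₀ σ * ∑ x ∈ cube (D + 1) ⌊n⌋, u t x ≤
      supOn u n τ t₀ σ * ∫ t in (t₀ - τ * n ^ 2)..t₀, ∑ x ∈ cube (D + 1) ⌊n⌋, u t x := by
    rw [intervalIntegral.integral_const_mul]
    refine mul_le_mul_of_nonneg_left ?_ hs.le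
    exact intervalIntegral.integral_mono_interval (sub_le_sub_left (mul_le_of_le_one_left hT.le hσ1) _) (S.time_lt hσ).le le_rfl
      (Filter.Eventually.of_forall fun t => Finset.sum_nonneg fun x _ => (S.sub.pos t x).le)
      ((S.continuous_sum _).intervalIntegrable _ _)
  unfold massAvg meanOn
  rw [← mul_div_assoc]
  exact div_le_div_of_nonneg_right (h1.trans h2) (by positivity)

theorem meanOn_le (S : Setting D p q c₀ n τ t₀ M Λ a u) : meanOn u n τ t₀ ≤ 3 ^ (D + 1) * supOn u n τ t₀ 1 := by
  have hn := S.n_pos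
  have hτ := S.scale_pos
  have hT := S.time_pos
  have hs := S.supOn_pos one_pos
  unfold meanOn
  rw [div_le_iff₀ (by positivity)]
  calc (∫ t in (t₀ - τ * n ^ 2)..t₀, ∑ x ∈ cube (D + 1) ⌊n⌋, u t x)
      ≤ ∫ _t in (t₀ - τ * n ^ 2)..t₀, 3 ^ (D + 1) * n ^ (D + 1) * supOn u n τ t₀ 1 := by
        refine intervalIntegral.integral_mono_on (by linarith) ((S.continuous_sum _).intervalIntegrable _ _)
          (continuous_const.intervalIntegrable _ _) fun t ht => ?_
        calc ∑ x ∈ cube (D + 1) ⌊n⌋, u t x ≤ ∑ _x ∈ cube (D + 1) ⌊n⌋, supOn u n τ t₀ 1 :=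
              Finset.sum_le_sum fun x hx => S.le_supOn (by rwa [one_mul]) (by rwa [one_mul])
          _ = ((cube (D + 1) ⌊n⌋).card : ℝ) * supOn u n τ t₀ 1 := by rw [Finset.sum_const, nsmul_eq_mul]
          _ ≤ _ := mul_le_mul_of_nonneg_right (card_cube_floor_le (le_trans (by norm_num) S.large)) hs.le
    _ = _ := by
      rw [intervalIntegral.integral_const, smul_eq_mul]; ring

end Setting

/-- With `y = n^(1/4)`, each of the two equal factors is at most `y` and `2^(j+2) ≤ 4y`. The product
`16 y³` is at most `y⁴ = n` as soon as `y ≥ 16`, and `n ≥ 2^20` gives `y ≥ 32`. -/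
theorem scale_gap {n : ℝ} (hn : 2 ^ 20 ≤ n) {j : ℕ} (hj : j < stepCount (3 * n)) :
    4 * ((2:ℝ) ^ stepCount n * 2 ^ stepCount n) ≤ (2 ^ (j + 2))⁻¹ * n := by
  have hn1 : 1 ≤ n := le_trans (by norm_num) hn
  have hn0 : 0 < n := by linarith
  have h1 := two_pow_stepCount_le hn1
  have h2 := two_pow_stepCount_le (show 1 ≤ 3 * n by linarith)
  rw [Real.mul_rpow (by norm_num) hn0.le] at h2
  have h3 : (3:ℝ) ^ (1 / 4 : ℝ) ≤ 2 := by
    calc (3:ℝ) ^ (1 / 4 : ℝ) ≤ (2 ^ (4:ℝ)) ^ (1 / 4 : ℝ) := Real.rpow_le_rpow (by norm_num) (by norm_num) (by norm_num)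
      _ = 2 := by rw [← Real.rpow_mul (by norm_num)]; norm_num
  have h4 : (32:ℝ) ≤ n ^ (1 / 4 : ℝ) := by
    calc (32:ℝ) = ((2:ℝ) ^ (20:ℝ)) ^ (1 / 4 : ℝ) := by rw [← Real.rpow_mul (by norm_num)]; norm_num
      _ ≤ _ := Real.rpow_le_rpow (by positivity) (by exact_mod_cast hn) (by norm_num)
  have h5 : (n ^ (1 / 4 : ℝ)) ^ 4 = n := by
    rw [← Real.rpow_natCast, ← Real.rpow_mul hn0.le]; norm_num
  set y := n ^ (1 / 4 : ℝ)
  have hy : 0 < y := by linarith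
  have h6 : (2:ℝ) ^ (j + 2) ≤ 2 * (2 * y) * 1 := by
    calc (2:ℝ) ^ (j + 2) = 2 * 2 ^ (j + 1) := by ring
      _ ≤ 2 * 2 ^ stepCount (3 * n) := by gcongr; norm_num; omega
      _ ≤ 2 * (3 ^ (1 / 4 : ℝ) * y) := by gcongr
      _ ≤ 2 * (2 * y) := by gcongr
      _ = _ := by ring
  rw [mul_comm _ n, ← div_eq_mul_inv, le_div_iff₀ (by positivity)]
  calc 4 * ((2:ℝ) ^ stepCount n * 2 ^ stepCount n) * 2 ^ (j + 2) ≤ 4 * (y * y) * (2 * (2 * y) * 1) := by gcongr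
    _ = 16 * y ^ 3 := by ring
    _ ≤ y * y ^ 3 := by gcongr; linarith
    _ = n := by rw [← h5]; ring

/-- The local boundedness estimate with the mean of `u` on the right-hand side. -/
theorem Exponents.exists_sup_bound (X : Exponents D p q lam C c₀) :
    ∃ K : ℝ, 1 ≤ K ∧ ∀ {n τ t₀ M Λ : ℝ} {a : Fin (D + 1) → (Fin (D + 1) → ℤ) → ℝ}
      {u : ℝ → (Fin (D + 1) → ℤ) → ℝ} (_ : Setting D p q c₀ n τ t₀ M Λ a u) {b : ℝ},
      (1 / 2 : ℝ) ^ stepCount (3 * n) ≤ b → b ≤ 1 →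
      supOn u n τ t₀ (1 / 2) ≤ K * boundFactor lam (deltaTwo (D + 1) q) τ M Λ *
        (meanOn u n τ t₀ ^ (1 - b) * supOn u n τ t₀ 1 ^ b) := by
  obtain ⟨K, e, hK, he, h⟩ := X.exists_sq_bound
  have hδ0 := X.deltaTwo_pos
  refine ⟨(K * 4 ^ e) ^ (1 / (1 / 2) : ℝ) * (2 ^ e) ^ ((1 - 1 / 2) / (1 / 2) ^ 2 : ℝ) * 3 ^ (D + 1), ?_, ?_⟩
  · exact one_le_mul_of_one_le_of_one_le (one_le_mul_of_one_le_of_one_le (Real.one_le_rpow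
      (one_le_mul_of_one_le_of_one_le hK (Real.one_le_rpow (by norm_num) he)) (by norm_num))
      (Real.one_le_rpow (Real.one_le_rpow (by norm_num) he) (by norm_num))) (one_le_pow₀ (by norm_num))
  intro n τ t₀ M Λ a u S b hb hb1
  have hF1 := one_le_boundFactor X.lam_pos X.lam_lt hδ0 S.scale_pos S.M_pos S.one_le
  set F := boundFactor lam (deltaTwo (D + 1) q) τ M Λ
  have hF0 : 0 < F := by linarith
  have hm := S.meanOn_pos
  have hm3 := S.meanOn_le
  have hs1 := S.supOn_pos one_pos
  set m := meanOn u n τ t₀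
  set s := supOn u n τ t₀ 1
  let r : ℕ → ℝ := fun j => 1 - (2 ^ (j + 1))⁻¹
  have hr0 : r 0 = 1 / 2 := by norm_num [r]
  have hr1 : ∀ j, r j ≤ 1 := fun j => by simp only [r]; have : (0:ℝ) < (2 ^ (j + 1))⁻¹ := by positivity
                                         linarith
  have hrh : ∀ j, 1 / 2 ≤ r j := fun j => by
    have : ((2:ℝ) ^ (j + 1))⁻¹ ≤ 2⁻¹ := inv_anti₀ (by norm_num) (le_self_pow₀ (by norm_num) (by omega))
    simp only [r]; norm_num at this ⊢; linarith
  have hrr : ∀ j, r (j + 1) - r j = (2 ^ (j + 2))⁻¹ := fun j => by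
    simp only [r, pow_succ]; field_simp; ring
  have hsp : ∀ j, 0 < supOn u n τ t₀ (r j) := fun j => S.supOn_pos (by linarith [hrh j])
  have hN : 1 ≤ 3 ^ (D + 1) * (s / m) := by
    rw [← mul_div_assoc, one_le_div hm]; exact hm3
  -- The square root of the quadratic bound gives exponent `1/2` to `F` times the mean and `1/2` to
  -- the supremum on the next cylinder. The iteration stops at the supremum over the full cylinder.
  have key := absorb_iterate (lam := 1 / 2) (c := 2 ^ e) (by norm_num) (by norm_num) (Real.one_le_rpow (by norm_num) he)
    (mul_pos hF0 hm) hN (stepCount (3 * n)) (K * 4 ^ e) (fun j => supOn u n τ t₀ (r j))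
    (one_le_mul_of_one_le_of_one_le hK (Real.one_le_rpow (by norm_num) he)) (fun j => (hsp j).le)
    (by
      intro j hj
      have h2j : (1:ℝ) ≤ 2 ^ (j + 2) := one_le_pow₀ (by norm_num)
      have hlt : r j < r (j + 1) := by
        have : 0 < r (j + 1) - r j := by rw [hrr]; positivity
        linarith
      have hbd := h S (hrh j) hlt (hr1 _) (by rw [hrr]; exact scale_gap S.large hj)
      have hma := S.massAvg_le (by linarith [hrh (j + 1)]) (hr1 (j + 1))
      rw [hrr, inv_inv] at hbd
      have hs' := hsp (j + 1)
      have hE : ((2:ℝ) ^ (j + 2)) ^ e = 4 ^ e * (2 ^ e) ^ j := by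
        rw [pow_add, mul_comm, Real.mul_rpow (by positivity) (by positivity), ← Real.rpow_natCast, ← Real.rpow_natCast,
          ← Real.rpow_natCast, ← Real.rpow_mul (by norm_num), ← Real.rpow_mul (by norm_num) (j : ℝ), mul_comm (j : ℝ), ← Real.rpow_mul (by norm_num)]
        congr 1
        rw [Real.rpow_mul (by norm_num)]; norm_num
      have hB : 1 ≤ K * (2 ^ (j + 2)) ^ e := one_le_mul_of_one_le_of_one_le hK (Real.one_le_rpow h2j he)
      refine S.supOn_le (by linarith [hrh j]) fun t ht x hx => ?_
      have h7 : u t x ^ 2 ≤ (K * (2 ^ (j + 2)) ^ e) * ((F * m) * supOn u n τ t₀ (r (j + 1))) := by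
        refine (hbd t ht x hx).trans ?_
        calc _ ≤ K * (2 ^ (j + 2)) ^ e * F * (supOn u n τ t₀ (r (j + 1)) * m) := by gcongr
          _ = _ := by ring
      have h8 := Real.rpow_le_rpow (sq_nonneg _) h7 (by norm_num : (0:ℝ) ≤ 1 / 2)
      have h9 : (u t x ^ 2) ^ (1 / 2 : ℝ) = u t x := by
        rw [← Real.sqrt_eq_rpow, Real.sqrt_sq (S.sub.pos t x).le]
      rw [h9] at h8
      refine h8.trans ((mul_rpow_le_mul_rpow hB (by positivity) (by norm_num)).trans (le_of_eq ?_))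
      rw [Real.mul_rpow (by positivity) hs'.le, hE, show (1:ℝ) - 1 / 2 = 1 / 2 by norm_num]
      ring)
    (by
      refine (S.supOn_mono (by linarith [hrh (stepCount (3 * n))]) (hr1 _)).trans ?_
      calc s ≤ 3 ^ (D + 1) * F * s := le_mul_of_one_le_left hs1.le
            (one_le_mul_of_one_le_of_one_le (one_le_pow₀ (by norm_num)) hF1)
        _ = _ := by field_simp)
  simp only [hr0] at key
  refine key.trans ?_
  -- The base is at least one, because the mean is at most `3^(D+1)` times the supremum, so the
  -- exponent may be raised to `b`.
  have h10 : (3 ^ (D + 1) * (s / m)) ^ ((1 - 1 / 2 : ℝ) ^ stepCount (3 * n)) ≤ 3 ^ (D + 1) * (s / m) ^ b := by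
    refine (Real.rpow_le_rpow_of_exponent_le hN (show _ ≤ b by norm_num at hb ⊢; exact hb)).trans ?_
    exact mul_rpow_le_mul_rpow (one_le_pow₀ (by norm_num)) (by positivity) hb1
  have h11 : (s / m) ^ b * m = m ^ (1 - b) * s ^ b := by
    rw [Real.div_rpow hs1.le hm.le, Real.rpow_sub hm, Real.rpow_one]; field_simp
  calc _ ≤ (K * 4 ^ e) ^ (1 / (1 / 2) : ℝ) * (2 ^ e) ^ ((1 - 1 / 2) / (1 / 2) ^ 2 : ℝ) * (3 ^ (D + 1) * (s / m) ^ b) * (F * m) := by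
        gcongr
    _ = (K * 4 ^ e) ^ (1 / (1 / 2) : ℝ) * (2 ^ e) ^ ((1 - 1 / 2) / (1 / 2) ^ 2 : ℝ) * 3 ^ (D + 1) * F * ((s / m) ^ b * m) := by ring
    _ = _ := by rw [h11]
end

/-! ### Translation between bonds of the lattice and weights on a cube -/

noncomputable section

variable {d : ℕ}

theorem adj_add_unitVec (x : Fin d → ℤ) (j : Fin d) : (latticeGraph d).Adj x (x + unitVec j) := by
  change ∑ i, (x i - (x + unitVec j) i) ^ 2 = 1
  rw [Finset.sum_eq_single j]
  · simp [unitVec]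
  · intro i _ hi; simp [unitVec, hi]
  · simp

theorem eq_add_or_eq_sub_of_adj {x y : Fin d → ℤ} (h : (latticeGraph d).Adj x y) :
    ∃ j, y = x + unitVec j ∨ y = x - unitVec j := by
  change ∑ i, (x i - y i) ^ 2 = 1 at h
  obtain ⟨j, hj⟩ : ∃ j, x j - y j ≠ 0 := by
    by_contra! hc
    simp [hc] at h
  have h1 : 1 ≤ (x j - y j) ^ 2 := by
    have := sq_pos_of_ne_zero hj
    omega
  rw [← Finset.add_sum_erase _ _ (Finset.mem_univ j)] at h
  have h0 : 0 ≤ ∑ i ∈ Finset.univ.erase j, (x i - y i) ^ 2 := Finset.sum_nonneg fun _ _ => sq_nonneg _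
  have hrest : ∑ i ∈ Finset.univ.erase j, (x i - y i) ^ 2 = 0 := by omega
  have hj1 : (x j - y j) ^ 2 = 1 := by omega
  have hi : ∀ i, i ≠ j → y i = x i := fun i hij => by
    have := (Finset.sum_eq_zero_iff_of_nonneg fun _ _ => sq_nonneg _).1 hrest i (Finset.mem_erase.2 ⟨hij, Finset.mem_univ i⟩)
    have := pow_eq_zero_iff (two_ne_zero) |>.1 this
    omega
  refine ⟨j, ?_⟩
  rcases mul_self_eq_one_iff.1 ((sq _).symm.trans hj1) with h2 | h2
  · right; funext i
    by_cases hij : i = j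
    · subst hij; simp [unitVec]; omega
    · simp [unitVec, hij, hi i hij]
  · left; funext i
    by_cases hij : i = j
    · subst hij; simp [unitVec]; omega
    · simp [unitVec, hij, hi i hij]

theorem conductance_comm (ω : Bond d → ℝ) (x y : Fin d → ℤ) : conductance ω x y = conductance ω y x := by
  classical
  exact congrArg (fun e : Sym2 (Fin d → ℤ) => if h : e ∈ (latticeGraph d).edgeSet then ω ⟨e, h⟩ else 0) Sym2.eq_swap

/-- The bond between `x` and `x + e_j`. -/
def bondAt (x : Fin d → ℤ) (j : Fin d) : Bond d := ⟨s(x, x + unitVec j), adj_add_unitVec x j⟩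

theorem conductance_bondAt (ω : Bond d → ℝ) (x : Fin d → ℤ) (j : Fin d) :
    conductance ω x (x + unitVec j) = ω (bondAt x j) := dif_pos (adj_add_unitVec x j)

theorem conductance_eq_zero {ω : Bond d → ℝ} {x y : Fin d → ℤ} (h : ¬ (latticeGraph d).Adj x y) :
    conductance ω x y = 0 := dif_neg h

theorem unitVec_injective : Function.Injective (unitVec : Fin d → Fin d → ℤ) := fun i j h => by
  have := congrFun h i
  by_contra hij
  simp [unitVec, hij] at this

theorem unitVec_ne_neg (i j : Fin d) : unitVec i ≠ -unitVec j := fun h => by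
  have := congrFun h i
  by_cases hij : i = j
  · subst hij; simp [unitVec] at this
  · simp [unitVec, hij] at this

/-- The neighbours of a site are the `2d` distinct points `x ± e_j`. The sum is indexed by direction
and sign, with `x₀` moved to the origin. -/
theorem generator_eq_gen (ω : Bond d → ℝ) (v : (Fin d → ℤ) → ℝ) (x₀ x : Fin d → ℤ) :
    generator ω v (x + x₀) = gen (fun j y => conductance ω (y + x₀) (y + x₀ + unitVec j)) (fun y => v (y + x₀)) x := by
  classical
  let f : Fin d × Bool → (Fin d → ℤ) := fun s => bif s.2 then x + x₀ + unitVec s.1 else x + x₀ - unitVec s.1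
  have hf : Function.Injective f := by
    rintro ⟨i, b⟩ ⟨j, b'⟩ h
    cases b <;> cases b' <;> simp only [f, cond_true, cond_false] at h
    · rw [sub_right_inj] at h; rw [unitVec_injective h]
    · rw [sub_eq_add_neg, add_right_inj] at h; exact absurd h.symm (unitVec_ne_neg _ _)
    · rw [sub_eq_add_neg, add_right_inj] at h; exact absurd h (unitVec_ne_neg _ _)
    · rw [add_right_inj] at h; rw [unitVec_injective h]
  have hs : (Function.support fun y : Fin d → ℤ => conductance ω (x + x₀) y * (v y - v (x + x₀))) ⊆
      ((Finset.univ.image f : Finset (Fin d → ℤ)) : Set (Fin d → ℤ)) := by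
    intro y hy
    have hadj : (latticeGraph d).Adj (x + x₀) y := by
      by_contra hc
      exact hy (by simp [conductance_eq_zero hc])
    obtain ⟨j, h | h⟩ := eq_add_or_eq_sub_of_adj hadj
    · simp only [Finset.coe_image, Finset.coe_univ, Set.image_univ, Set.mem_range]
      exact ⟨(j, true), h.symm⟩
    · simp only [Finset.coe_image, Finset.coe_univ, Set.image_univ, Set.mem_range]
      exact ⟨(j, false), h.symm⟩
  unfold generator gen
  rw [finsum_eq_sum_of_support_subset _ hs, Finset.sum_image fun a _ b _ h => hf h, Fintype.sum_prod_type]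
  refine Finset.sum_congr rfl fun j _ => ?_
  rw [Fintype.sum_bool]
  simp only [f, cond_true, cond_false]
  have e1 : x + unitVec j + x₀ = x + x₀ + unitVec j := by abel
  have e2 : x - unitVec j + x₀ = x + x₀ - unitVec j := by abel
  rw [e1, e2, sub_add_cancel, conductance_comm ω (x + x₀ - unitVec j)]

theorem mem_latticeBall_add {x₀ x : Fin d → ℤ} {r : ℝ} : x + x₀ ∈ latticeBall x₀ r ↔ x ∈ cube d ⌊r⌋ := by
  rw [mem_cube]
  simp only [latticeBall, Fintype.mem_piFinset, Finset.mem_Icc, Pi.add_apply]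
  refine forall_congr' fun i => ?_
  constructor <;> rintro ⟨h1, h2⟩ <;> constructor <;> omega

theorem latticeBall_eq_map (x₀ : Fin d → ℤ) (r : ℝ) :
    latticeBall x₀ r = (cube d ⌊r⌋).map (addRightEmbedding x₀) := by
  ext y
  rw [Finset.mem_map]
  constructor
  · intro h
    exact ⟨y - x₀, by rw [← mem_latticeBall_add (x₀ := x₀), sub_add_cancel]; exact h, by simp⟩
  · rintro ⟨x, hx, rfl⟩
    exact mem_latticeBall_add.2 hx

theorem mem_bondsIn {S : Finset (Fin d → ℤ)} {e : Bond d} : e ∈ bondsIn S ↔ ∀ x ∈ e.1, x ∈ S := by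
  classical
  unfold bondsIn
  rw [Finset.mem_subtype, Finset.mem_sym2_iff]

theorem bondAt_mem_bondsIn {x₀ x : Fin d → ℤ} {r : ℝ} {j : Fin d} (hx : x ∈ cubeEdges d ⌊r⌋ j) :
    bondAt (x + x₀) j ∈ bondsIn (latticeBall x₀ r) := by
  rw [mem_bondsIn]
  intro y hy
  rcases Sym2.mem_iff.1 hy with rfl | rfl
  · exact mem_latticeBall_add.2 (mem_cubeEdges.1 hx).1
  · rw [add_right_comm]
    exact mem_latticeBall_add.2 (add_unitVec_mem_cube hx)

theorem bondAt_injective {x y : Fin d → ℤ} {i j : Fin d} (h : bondAt x i = bondAt y j) : x = y ∧ i = j := by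
  have h1 : s(x, x + unitVec i) = s(y, y + unitVec j) := congrArg Subtype.val h
  rcases Sym2.eq_iff.1 h1 with ⟨h2, h3⟩ | ⟨h2, h3⟩
  · subst h2
    exact ⟨rfl, unitVec_injective (add_left_cancel h3)⟩
  · exfalso
    rw [h2, add_assoc] at h3
    have h4 : unitVec j + unitVec i = 0 := by simpa using h3
    exact unitVec_ne_neg j i (eq_neg_of_add_eq_zero_left h4)

/-- Distinct pairs of a lower end-point and a direction give distinct bonds, so no bond is counted
twice. -/
theorem sum_cubeEdges_le_sum_bondsIn {F : Bond d → ℝ} (hF : ∀ e, 0 ≤ F e) (x₀ : Fin d → ℤ) (r : ℝ) :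
    ∑ j, ∑ x ∈ cubeEdges d ⌊r⌋ j, F (bondAt (x + x₀) j) ≤ ∑ e ∈ bondsIn (latticeBall x₀ r), F e := by
  classical
  rw [← Finset.sum_sigma (s := Finset.univ) (t := fun j => cubeEdges d ⌊r⌋ j) (f := fun e => F (bondAt (e.2 + x₀) e.1)),
    ← Finset.sum_image (f := F) (g := fun e : (_ : Fin d) × (Fin d → ℤ) => bondAt (e.2 + x₀) e.1)]
  · refine Finset.sum_le_sum_of_subset_of_nonneg ?_ fun e _ _ => hF e
    intro e he
    obtain ⟨⟨j, x⟩, hx, rfl⟩ := Finset.mem_image.1 he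
    exact bondAt_mem_bondsIn (Finset.mem_sigma.1 hx).2
  · rintro ⟨i, x⟩ _ ⟨j, y⟩ _ h
    obtain ⟨h1, h2⟩ := bondAt_injective h
    subst h2
    have h3 : x = y := add_right_cancel h1
    rw [h3]

theorem card_bondsIn_le (x₀ : Fin d → ℤ) (r : ℝ) :
    (bondsIn (latticeBall x₀ r)).card ≤ d * (cube d ⌊r⌋).card := by
  classical
  have hsub : bondsIn (latticeBall x₀ r) ⊆
      ((Finset.univ : Finset (Fin d)) ×ˢ latticeBall x₀ r).image fun e => bondAt e.2 e.1 := by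
    rintro ⟨e, he⟩ h
    rw [mem_bondsIn] at h
    induction e using Sym2.ind with
    | _ x y =>
      have hadj : (latticeGraph d).Adj x y := he
      rw [Finset.mem_image]
      obtain ⟨j, h1 | h1⟩ := eq_add_or_eq_sub_of_adj hadj
      · exact ⟨(j, x), Finset.mem_product.2 ⟨Finset.mem_univ j, h x (Sym2.mem_mk_left x y)⟩, Subtype.ext (by simp [bondAt, h1])⟩
      · refine ⟨(j, y), Finset.mem_product.2 ⟨Finset.mem_univ j, h y (Sym2.mem_mk_right x y)⟩, Subtype.ext ?_⟩
        change s(y, y + unitVec j) = s(x, y)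
        rw [show y + unitVec j = x by rw [h1, sub_add_cancel], Sym2.eq_swap]
  refine (Finset.card_le_card hsub).trans (Finset.card_image_le.trans (le_of_eq ?_))
  rw [Finset.card_product, Finset.card_univ, Fintype.card_fin, latticeBall_eq_map, Finset.card_map]

theorem card_bondsIn_pos (hd : 0 < d) (x₀ : Fin d → ℤ) {r : ℝ} (hr : 1 ≤ r) :
    0 < (bondsIn (latticeBall x₀ r)).card := by
  refine Finset.card_pos.2 ⟨bondAt (0 + x₀) ⟨0, hd⟩, bondAt_mem_bondsIn ?_⟩
  have h1 : 1 ≤ ⌊r⌋ := Int.le_floor.2 (by simpa using hr)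
  rw [mem_cubeEdges, mem_cube]
  exact ⟨fun i => by simp; omega, by simp; omega⟩

section norms

variable {S : Finset (Fin d → ℤ)} {F : Bond d → ℝ} {r : ℝ}

theorem bondAvgNorm_rpow (hr : 0 < r) (hF : ∀ e, 0 < F e) :
    ((bondsIn S).card : ℝ) * bondAvgNorm r S F ^ r = ∑ e ∈ bondsIn S, F e ^ r := by
  have h0 : 0 ≤ ∑ e ∈ bondsIn S, |F e| ^ r := Finset.sum_nonneg fun _ _ => Real.rpow_nonneg (abs_nonneg _) _
  unfold bondAvgNorm
  rw [← Real.rpow_mul (by positivity), one_div_mul_cancel hr.ne', Real.rpow_one]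
  have e : ∑ e ∈ bondsIn S, |F e| ^ r = ∑ e ∈ bondsIn S, F e ^ r :=
    Finset.sum_congr rfl fun e _ => by rw [abs_of_pos (hF e)]
  rcases Nat.eq_zero_or_pos (bondsIn S).card with h | h
  · rw [Finset.card_eq_zero.1 h]; simp
  · rw [e]; field_simp

theorem bondAvgNorm_pos (hF : ∀ e, 0 < F e) (hS : 0 < (bondsIn S).card) : 0 < bondAvgNorm r S F := by
  refine Real.rpow_pos_of_pos (mul_pos (by positivity) (Finset.sum_pos (fun e _ => ?_) (Finset.card_pos.1 hS))) _
  exact Real.rpow_pos_of_pos (abs_pos.2 (hF e).ne') _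

/-- Hölder's inequality for `1 = ω^s ω^(-s)` with `s = pq/(p+q)`. -/
theorem one_le_bondAvgNorm_inv_mul {p q : ℝ} (hp : 0 < p) (hq : 0 < q) (hF : ∀ e, 0 < F e)
    (hS : 0 < (bondsIn S).card) : 1 ≤ bondAvgNorm q S (fun e => (F e)⁻¹) * bondAvgNorm p S F := by
  have hM := bondAvgNorm_pos (r := p) hF hS
  have hΛ := bondAvgNorm_pos (r := q) (F := fun e => (F e)⁻¹) (fun e => inv_pos.2 (hF e)) hS
  have e1 := bondAvgNorm_rpow (S := S) hp hF
  have e2 := bondAvgNorm_rpow (S := S) hq (F := fun e => (F e)⁻¹) fun e => inv_pos.2 (hF e)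
  have h := sum_rpow_mul_rpow_le (bondsIn S) (fun e => F e ^ p) (fun e => (F e)⁻¹ ^ q) (α := q / (p + q)) (β := p / (p + q))
    (by positivity) (by positivity) (by field_simp; ring) (fun e _ => Real.rpow_nonneg (hF e).le _)
    (fun e _ => Real.rpow_nonneg (inv_pos.2 (hF e)).le _)
  rw [← e1, ← e2] at h
  set N : ℝ := ((bondsIn S).card : ℝ) with hN
  have hN0 : 0 < N := by rw [hN]; exact_mod_cast hS
  set M := bondAvgNorm p S F
  set Λ := bondAvgNorm q S fun e => (F e)⁻¹
  have h1 : ∀ e, (F e ^ p) ^ (q / (p + q)) * ((F e)⁻¹ ^ q) ^ (p / (p + q)) = 1 := fun e => by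
    rw [← Real.rpow_mul (hF e).le, ← Real.rpow_mul (inv_pos.2 (hF e)).le, show q * (p / (p + q)) = p * (q / (p + q)) by ring,
      ← Real.mul_rpow (hF e).le (inv_pos.2 (hF e)).le, mul_inv_cancel₀ (hF e).ne', Real.one_rpow]
  simp only [h1, Finset.sum_const, nsmul_eq_mul, mul_one] at h
  have h2 : (N * M ^ p) ^ (q / (p + q)) * (N * Λ ^ q) ^ (p / (p + q)) = N * (Λ * M) ^ (p * q / (p + q)) := by
    rw [Real.mul_rpow hN0.le (by positivity), Real.mul_rpow hN0.le (by positivity), ← Real.rpow_mul hM.le, ← Real.rpow_mul hΛ.le,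
      Real.mul_rpow hΛ.le hM.le, show q * (p / (p + q)) = p * q / (p + q) by ring, show p * (q / (p + q)) = p * q / (p + q) by ring]
    have : N ^ (q / (p + q)) * N ^ (p / (p + q)) = N := by
      rw [← Real.rpow_add hN0, ← add_div, add_comm q, div_self (by positivity), Real.rpow_one]
    linear_combination (M ^ (p * q / (p + q)) * Λ ^ (p * q / (p + q))) * this
  rw [h2] at h
  by_contra! hc
  have h3 : (Λ * M) ^ (p * q / (p + q)) < 1 := Real.rpow_lt_one (by positivity) hc (by positivity)
  have : N * (Λ * M) ^ (p * q / (p + q)) < N * 1 := by gcongr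
  linarith

end norms
end

/-! ### Comparison of exponents, and extension of `u` beyond the cylinder -/

noncomputable section

section exponents

/-- The interpolation exponent on the slices. -/
def sliceExp (d : ℕ) (p q : ℝ) : ℝ := 1 - 1 / thetaExp d p q

variable {D : ℕ} {p q : ℝ}

theorem thetaExp_of_two_le (hD : 2 ≤ D) (hp : 1 < p) : thetaExp (D + 1) p q = p * (2 / D - 1 / q) := by
  have hp0 : p ≠ 0 := by linarith
  unfold thetaExp deltaOne
  rw [if_neg (by omega)]
  push_cast
  rw [add_sub_cancel_right]
  field_simp
  ring

theorem one_lt_thetaExp (hp : 1 < p) (hpq : 1 / p + 1 / q < 2 / (((D + 1 : ℕ) : ℝ) - 1)) :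
    1 < thetaExp (D + 1) p q := by
  unfold thetaExp deltaOne
  split_ifs with h
  · exact hp
  · have : 0 < p * (2 / (((D + 1 : ℕ) : ℝ) - 1) - 1 / p - 1 / q) := mul_pos (by linarith) (by linarith)
    linarith

theorem sliceExp_pos (hp : 1 < p) (hpq : 1 / p + 1 / q < 2 / (((D + 1 : ℕ) : ℝ) - 1)) : 0 < sliceExp (D + 1) p q := by
  have h := one_lt_thetaExp hp hpq
  unfold sliceExp
  rw [sub_pos, div_lt_one (by linarith)]
  exact h

theorem sliceExp_lt_one (hp : 1 < p) (hpq : 1 / p + 1 / q < 2 / (((D + 1 : ℕ) : ℝ) - 1)) : sliceExp (D + 1) p q < 1 := by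
  have h := one_lt_thetaExp hp hpq
  have : 0 < 1 / thetaExp (D + 1) p q := by positivity
  unfold sliceExp
  linarith

/-- The number `θ` is defined so that `1/θ` is the energy exponent dictated by scaling on slices of
dimension `d - 1`. -/
theorem sliceExp_spec (hD : 1 ≤ D) (hp : 1 < p) (hpq : 1 / p + 1 / q < 2 / (((D + 1 : ℕ) : ℝ) - 1)) :
    (D = 1 ∧ sliceExp (D + 1) p q = 1 - 1 / p) ∨
      (2 ≤ D ∧ 1 / p = (1 - sliceExp (D + 1) p q) * (2 / D - 1 / q)) := by
  rcases hD.eq_or_lt with rfl | h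
  · left; exact ⟨rfl, by simp [sliceExp, thetaExp]⟩
  · right
    have h1 := one_lt_thetaExp hp hpq
    refine ⟨h, ?_⟩
    unfold sliceExp
    rw [thetaExp_of_two_le h hp] at h1 ⊢
    have hp0 : 0 < p := by linarith
    have h2 : 0 < 2 / (D : ℝ) - 1 / q := by
      by_contra hc
      have := mul_nonpos_of_nonneg_of_nonpos hp0.le (not_lt.1 hc)
      linarith
    rw [sub_sub_cancel]
    set y := 2 / (D : ℝ) - 1 / q
    field_simp

/-- For `D ≥ 2`, `δ₂ ≤ 2/D - 1/q` bounds the left side by `1/p`; for `D = 1`, `δ₂ ≤ 1` does so. -/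
theorem one_sub_sliceExp_mul_le (hD : 1 ≤ D) (hp : 1 < p)
    (hpq : 1 / p + 1 / q < 2 / (((D + 1 : ℕ) : ℝ) - 1)) (hδ1 : deltaTwo (D + 1) q ≤ 1) :
    (1 - sliceExp (D + 1) p q) * deltaTwo (D + 1) q ≤ 1 / (p - 1) := by
  have hp1 : 0 < p - 1 := by linarith
  have hl1 := sliceExp_lt_one hp hpq
  rcases sliceExp_spec hD hp hpq with ⟨-, h⟩ | ⟨h2, h⟩
  · rw [h, sub_sub_cancel]
    calc 1 / p * deltaTwo (D + 1) q ≤ 1 / p := mul_le_of_le_one_right (by positivity) hδ1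
      _ ≤ 1 / (p - 1) := one_div_le_one_div_of_le hp1 (by linarith)
  · have hD0 : (0:ℝ) < D := by exact_mod_cast hD
    have : deltaTwo (D + 1) q ≤ 2 / D - 1 / q := by
      unfold deltaTwo
      push_cast
      gcongr
      linarith
    calc (1 - sliceExp (D + 1) p q) * deltaTwo (D + 1) q ≤ (1 - sliceExp (D + 1) p q) * (2 / D - 1 / q) :=
          mul_le_mul_of_nonneg_left this (by linarith)
      _ = 1 / p := h.symm
      _ ≤ 1 / (p - 1) := one_div_le_one_div_of_le hp1 (by linarith)

/-- Write `A = M + τ⁻¹` and `l = sliceExp`. As `1 - ν = l δ₂`, the square of the second term in the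
maximum is `τA (ΛA)^(1/(lδ₂))`. Both `τA` and `ΛA` are at least one, so exponents may be raised.
Raising them by the factor `p/(p-1)` covers the additional exponent `(1-l)/l`, because `(1-l) δ₂ ≤
1/(p-1)`. -/
theorem boundFactor_le_cylConst_rpow (hD : 1 ≤ D) (hp : 1 < p)
    (hpq : 1 / p + 1 / q < 2 / (((D + 1 : ℕ) : ℝ) - 1)) (hδ0 : 0 < deltaTwo (D + 1) q) (hδ1 : deltaTwo (D + 1) q ≤ 1)
    {ω : Bond (D + 1) → ℝ} {S : Finset (Fin (D + 1) → ℤ)} {τ : ℝ} (hτ : 0 < τ) (hM : 0 < bondAvgNorm p S ω)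
    (hΛ : 0 < bondAvgNorm q S fun e => (ω e)⁻¹)
    (hK : 1 ≤ (bondAvgNorm q S fun e => (ω e)⁻¹) * (bondAvgNorm p S ω + τ⁻¹)) :
    boundFactor (sliceExp (D + 1) p q) (deltaTwo (D + 1) q) τ (bondAvgNorm p S ω) (bondAvgNorm q S fun e => (ω e)⁻¹) ≤
      cylConst p q ω S τ ^ (2 * p / (p - 1)) := by
  have hl0 := sliceExp_pos hp hpq
  have hl1 := sliceExp_lt_one hp hpq
  have hlδ := one_sub_sliceExp_mul_le hD hp hpq hδ1
  have hν : 1 - nuExp (D + 1) p q = sliceExp (D + 1) p q * deltaTwo (D + 1) q := by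
    unfold nuExp sliceExp; ring
  have hν2 : 2 - nuExp (D + 1) p q = 1 + sliceExp (D + 1) p q * deltaTwo (D + 1) q := by
    rw [← hν]; ring
  unfold cylConst boundFactor
  rw [hν, hν2]
  have hA1 := one_le_scale_mul hτ hM
  set M := bondAvgNorm p S ω
  set Λ := bondAvgNorm q S fun e => (ω e)⁻¹
  set l := sliceExp (D + 1) p q
  set δ := deltaTwo (D + 1) q
  set A := M + τ⁻¹ with hA
  have hA0 : 0 < A := by positivity
  have hp1 : 0 < p - 1 := by linarith
  have hp0 : 0 < p := by linarith
  set Z := τ ^ (1 / 2 : ℝ) * (Λ * A ^ (1 + l * δ)) ^ (1 / (2 * (l * δ)))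
  have hZ0 : 0 ≤ Z := by positivity
  have hZ2 : Z ^ (2 : ℝ) = τ * A * (Λ * A) ^ (1 / (l * δ)) := by
    simp only [Z]
    rw [Real.mul_rpow (by positivity) (by positivity), ← Real.rpow_mul hτ.le, ← Real.rpow_mul (by positivity),
      show (1 / 2 : ℝ) * 2 = 1 by norm_num, Real.rpow_one, show 1 / (2 * (l * δ)) * 2 = 1 / (l * δ) by field_simp,
      Real.rpow_add hA0, Real.rpow_one, ← mul_assoc, Real.mul_rpow (by positivity) (by positivity), ← Real.rpow_mul hA0.le,
      mul_one_div_cancel (by positivity), Real.rpow_one]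
    ring
  have hs : 1 ≤ p / (p - 1) := by rw [one_le_div hp1]; linarith
  have hexp : 1 / (l * δ) + (1 - l) / l ≤ 1 / (l * δ) * (p / (p - 1)) := by
    have e1 : 1 / (l * δ) + (1 - l) / l = 1 / (l * δ) * (1 + (1 - l) * δ) := by field_simp
    have e2 : p / (p - 1) = 1 + 1 / (p - 1) := by field_simp; ring
    rw [e1, e2]
    gcongr
  calc τ * A * (Λ * A) ^ (1 / (l * δ) + (1 - l) / l)
      ≤ (τ * A) ^ (p / (p - 1)) * (Λ * A) ^ (1 / (l * δ) * (p / (p - 1))) := by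
        refine mul_le_mul ?_ (Real.rpow_le_rpow_of_exponent_le hK hexp) (by positivity) (by positivity)
        calc τ * A = (τ * A) ^ (1:ℝ) := (Real.rpow_one _).symm
          _ ≤ _ := Real.rpow_le_rpow_of_exponent_le hA1 hs
    _ = (Z ^ (2 : ℝ)) ^ (p / (p - 1)) := by
      rw [hZ2, Real.mul_rpow (x := τ * A) (by positivity) (by positivity), ← Real.rpow_mul (by positivity)]
    _ = Z ^ (2 * p / (p - 1)) := by rw [← Real.rpow_mul hZ0, mul_div_assoc]
    _ ≤ max 1 Z ^ (2 * p / (p - 1)) := Real.rpow_le_rpow hZ0 (le_max_right _ _) (by positivity)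

end exponents

section extension

variable {d : ℕ}

open scoped Classical in
/-- The translate by `x₀` of a function on a cylinder, frozen outside of the time interval and set to `1`
outside of the cube. -/
def cylExtend (u : ℝ → (Fin d → ℤ) → ℝ) (A B : ℝ) (x₀ : Fin d → ℤ) (R : ℤ) (t : ℝ) (x : Fin d → ℤ) : ℝ :=
  if x ∈ cube d R then u (max A (min B t)) (x + x₀) else 1

theorem cylExtend_apply {u : ℝ → (Fin d → ℤ) → ℝ} {A B : ℝ} {x₀ : Fin d → ℤ} {R : ℤ} {t : ℝ} (ht : t ∈ Set.Icc A B)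
    {x : Fin d → ℤ} (hx : x ∈ cube d R) : cylExtend u A B x₀ R t x = u t (x + x₀) := by
  rw [cylExtend, if_pos hx, min_eq_right ht.2, max_eq_right ht.1]

/-- Freezing in time keeps continuity and positivity on the whole line. The differential inequality
is used only at interior times and at sites all of whose neighbours lie in the cube, where the
extension agrees with `u`. -/
theorem subcaloricOn_cylExtend {ω : Bond d → ℝ} {u : ℝ → (Fin d → ℤ) → ℝ} {A B : ℝ} (hAB : A ≤ B) {x₀ : Fin d → ℤ}
    {r : ℝ} (hpos : ∀ t ∈ Set.Icc A B, ∀ x ∈ latticeBall x₀ r, 0 < u t x)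
    (hu : IsSubcaloric ω (Set.Icc A B) (latticeBall x₀ r) u) :
    SubcaloricOn (fun j y => conductance ω (y + x₀) (y + x₀ + unitVec j)) A B ⌊r⌋ (cylExtend u A B x₀ ⌊r⌋) where
  cont x := by
    by_cases hx : x ∈ cube d ⌊r⌋
    · simp only [cylExtend, if_pos hx]
      have h : ContinuousOn (fun t => u t (x + x₀)) (Set.Icc A B) := fun t ht =>
        (hu t ht _ (mem_latticeBall_add.2 hx)).1.continuousWithinAt
      exact h.comp_continuous (by fun_prop) fun t => ⟨le_max_left _ _, max_le hAB (min_le_left _ _)⟩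
    · simp only [cylExtend, if_neg hx]
      exact continuous_const
  pos t x := by
    unfold cylExtend
    split_ifs with hx
    · exact hpos _ ⟨le_max_left _ _, max_le hAB (min_le_left _ _)⟩ _ (mem_latticeBall_add.2 hx)
    · exact one_pos
  sub t ht x hx := by
    have hxR : x ∈ cube d ⌊r⌋ := cube_mono (by omega) hx
    have htI := Set.Ioo_subset_Icc_self ht
    have hnhds : Set.Icc A B ∈ nhds t := Icc_mem_nhds ht.1 ht.2
    obtain ⟨h1, h2⟩ := hu t htI _ (mem_latticeBall_add.2 hxR)
    have h3 : HasDerivAt (fun s => u s (x + x₀)) (derivWithin (fun s => u s (x + x₀)) (Set.Icc A B) t) t :=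
      h1.hasDerivWithinAt.hasDerivAt hnhds
    refine ⟨_, h3.congr_of_eventuallyEq ?_, ?_⟩
    · filter_upwards [hnhds] with s hs
      exact cylExtend_apply hs hxR
    · refine (sub_nonpos.1 h2).trans (le_of_eq ?_)
      rw [generator_eq_gen]
      unfold gen
      rw [mem_cube] at hx
      refine Finset.sum_congr rfl fun j _ => ?_
      have hp : x + unitVec j ∈ cube d ⌊r⌋ := mem_cube.2 fun i => by
        have := hx i
        by_cases hij : i = j
        · subst hij; simp [unitVec]; omega
        · simp [unitVec, hij]; omega
      have hm : x - unitVec j ∈ cube d ⌊r⌋ := mem_cube.2 fun i => by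
        have := hx i
        by_cases hij : i = j
        · subst hij; simp [unitVec]; omega
        · simp [unitVec, hij]; omega
      rw [cylExtend_apply htI hxR, cylExtend_apply htI hp, cylExtend_apply htI hm]

theorem cylSupNorm_cylExtend {u : ℝ → (Fin d → ℤ) → ℝ} {A A' B : ℝ} (hA : A ≤ A') {x₀ : Fin d → ℤ} {r r' : ℝ} (hr : r' ≤ r) :
    cylSupNorm (Set.Icc A' B) (cube d ⌊r'⌋) (cylExtend u A B x₀ ⌊r⌋) = cylSupNorm (Set.Icc A' B) (latticeBall x₀ r') u := by
  have hval : ∀ t ∈ Set.Icc A' B, ∀ x ∈ cube d ⌊r'⌋, cylExtend u A B x₀ ⌊r⌋ t x = u t (x + x₀) := fun t ht x hx =>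
    cylExtend_apply ⟨hA.trans ht.1, ht.2⟩ (cube_mono (Int.floor_le_floor hr) hx)
  unfold cylSupNorm
  congr 1
  ext s
  constructor
  · rintro ⟨t, ht, x, hx, rfl⟩
    exact ⟨t, ht, x + x₀, mem_latticeBall_add.2 hx, by rw [hval t ht x hx]⟩
  · rintro ⟨t, ht, y, hy, rfl⟩
    have hx : y - x₀ ∈ cube d ⌊r'⌋ := by
      rw [← mem_latticeBall_add (x₀ := x₀), sub_add_cancel]; exact hy
    exact ⟨t, ht, y - x₀, hx, by rw [hval t ht _ hx, sub_add_cancel]⟩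

theorem integral_cylExtend {u : ℝ → (Fin d → ℤ) → ℝ} {A B : ℝ} (hAB : A ≤ B) {x₀ : Fin d → ℤ} {r : ℝ}
    (hpos : ∀ t ∈ Set.Icc A B, ∀ x ∈ latticeBall x₀ r, 0 < u t x) :
    ∫ t in A..B, ∑ x ∈ cube d ⌊r⌋, cylExtend u A B x₀ ⌊r⌋ t x =
      ∫ t in Set.Icc A B, ∑ x ∈ latticeBall x₀ r, |u t x| := by
  rw [intervalIntegral.integral_of_le hAB, ← MeasureTheory.integral_Icc_eq_integral_Ioc]
  refine MeasureTheory.setIntegral_congr_fun measurableSet_Icc fun t ht => ?_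
  rw [latticeBall_eq_map, Finset.sum_map]
  refine Finset.sum_congr rfl fun x hx => ?_
  rw [cylExtend_apply ht hx, addRightEmbedding_apply, abs_of_pos (hpos t ht _ (mem_latticeBall_add.2 hx))]

end extension

theorem smallExp_le_one {p n : ℝ} (hp : 1 < p) : smallExp p n ≤ 1 := by
  have : 1 / p ≤ 1 := by rw [div_le_one (by linarith)]; exact hp.le
  exact pow_le_one₀ (by positivity) (by linarith)

/-- The step count at `3n` is `k̂`, and the base `½(1 + 1/p)` exceeds `½`: the stated exponent is
weaker than the one the absorption delivers. -/
theorem half_pow_le_smallExp {p n : ℝ} (hp : 1 < p) : (1 / 2 : ℝ) ^ stepCount (3 * n) ≤ smallExp p n := by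
  have : 0 < 1 / p := by positivity
  exact pow_le_pow_left₀ (by norm_num) (by linarith) _
end

/-! ### Assembly -/

noncomputable section

/-- The constant `d 3^d` bounds the number of bonds in the cube relative to `n^d`, which turns the
normalized norms into bounds on the sums of weights. -/
theorem setting_cylExtend {D : ℕ} {p q : ℝ} (hp : 1 < p) (hq : 1 < q) {ω : Bond (D + 1) → ℝ} (hω : ∀ e, 0 < ω e)
    {t₀ n τ : ℝ} {x₀ : Fin (D + 1) → ℤ} (hn : (2 : ℝ) ^ 20 ≤ n) (hτ : 0 < τ) {u : ℝ → (Fin (D + 1) → ℤ) → ℝ}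
    (hpos : ∀ t ∈ Set.Icc (t₀ - τ * n ^ 2) t₀, ∀ x ∈ latticeBall x₀ n, 0 < u t x)
    (hu : IsSubcaloric ω (Set.Icc (t₀ - τ * n ^ 2) t₀) (latticeBall x₀ n) u) :
    Setting D p q (((D + 1 : ℕ) : ℝ) * 3 ^ (D + 1)) n τ t₀ (bondAvgNorm p (latticeBall x₀ n) ω)
      (bondAvgNorm q (latticeBall x₀ n) fun e => (ω e)⁻¹)
      (fun j y => conductance ω (y + x₀) (y + x₀ + unitVec j)) (cylExtend u (t₀ - τ * n ^ 2) t₀ x₀ ⌊n⌋) := by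
  have hn1 : 1 ≤ n := le_trans (by norm_num) hn
  have hn0 : 0 < n := by linarith
  have hN := card_bondsIn_pos (Nat.succ_pos D) x₀ hn1
  have hωi : ∀ e, 0 < (ω e)⁻¹ := fun e => inv_pos.2 (hω e)
  have hM := bondAvgNorm_pos (r := p) hω hN
  have hΛ := bondAvgNorm_pos (r := q) hωi hN
  have hcard : ((bondsIn (latticeBall x₀ n)).card : ℝ) ≤ ((D + 1 : ℕ) : ℝ) * 3 ^ (D + 1) * n ^ (D + 1) := by
    have h1 : ((bondsIn (latticeBall x₀ n)).card : ℝ) ≤ ((D + 1 : ℕ) : ℝ) * ((cube (D + 1) ⌊n⌋).card : ℝ) := by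
      exact_mod_cast card_bondsIn_le x₀ n
    refine h1.trans ?_
    rw [mul_assoc]
    exact mul_le_mul_of_nonneg_left (card_cube_floor_le hn1) (by positivity)
  refine ⟨hn, hτ, hM, hΛ, fun j x => ?_, ?_, ?_, ?_, subcaloricOn_cylExtend ?_ hpos hu⟩
  · rw [conductance_bondAt]; exact hω _
  · unfold weightSum
    simp only [conductance_bondAt]
    refine (sum_cubeEdges_le_sum_bondsIn (F := fun e => ω e ^ p) (fun e => Real.rpow_nonneg (hω e).le _) x₀ n).trans ?_
    rw [← bondAvgNorm_rpow (by linarith) hω]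
    gcongr
  · unfold weightSum
    simp only [conductance_bondAt]
    refine (sum_cubeEdges_le_sum_bondsIn (F := fun e => ω e ^ (-q)) (fun e => Real.rpow_nonneg (hω e).le _) x₀ n).trans ?_
    have : ∀ e, ω e ^ (-q) = (ω e)⁻¹ ^ q := fun e => by rw [Real.rpow_neg (hω e).le, Real.inv_rpow (hω e).le]
    simp only [this]
    rw [← bondAvgNorm_rpow (by linarith) hωi]
    gcongr
  · refine (one_le_bondAvgNorm_inv_mul (p := p) (q := q) (by linarith) (by linarith) hω hN).trans ?_
    have : 0 < τ⁻¹ := by positivity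
    gcongr
    linarith
  · have : 0 < τ * n ^ 2 := by positivity
    linarith

end

theorem corollary1 (d : ℕ) (hd : 2 ≤ d) (p q : ℝ) (hp : 1 < p) (hq : (d : ℝ) / 2 < q)
    (hpq : 1 / p + 1 / q < 2 / ((d : ℝ) - 1)) :
    ∃ c : ℝ, 1 ≤ c ∧
      ∀ (ω : Bond d → ℝ), (∀ e, 0 < ω e) →
      ∀ (t₀ : ℝ) (x₀ : Fin d → ℤ) (n τ : ℝ), (2 : ℝ) ^ 20 ≤ n → 0 < τ →
      ∀ u : ℝ → (Fin d → ℤ) → ℝ,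
        (∀ t ∈ cylTime 1 t₀ τ n, ∀ x ∈ cylSpace 1 x₀ n, 0 < u t x) →
        IsSubcaloric ω (cylTime 1 t₀ τ n) (cylSpace 1 x₀ n) u →
        cylSupNorm (cylTime (1 / 2) t₀ τ n) (cylSpace (1 / 2) x₀ n) u ≤
          c * cylConst p q ω (latticeBall x₀ n) τ ^ (2 * p / (p - 1)) *
            cylAvgL1 (cylTime 1 t₀ τ n) (cylSpace 1 x₀ n) u ^ (1 - smallExp p n) *
            cylSupNorm (cylTime 1 t₀ τ n) (cylSpace 1 x₀ n) u ^ smallExp p n := by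
  obtain ⟨D, rfl⟩ : ∃ D, d = D + 1 := ⟨d - 1, by omega⟩
  have hD : 1 ≤ D := by omega
  have hD' : (1 : ℝ) ≤ D := by exact_mod_cast hD
  have hq' : ((D : ℝ) + 1) / 2 < q := by push_cast at hq; exact hq
  have hq1 : 1 < q := by linarith
  have hl0 := sliceExp_pos hp hpq
  have hl1 := sliceExp_lt_one hp hpq
  obtain ⟨C, hC, hslice⟩ := exists_slice_inequality hD hp hq1 hl0 hl1 (sliceExp_spec hD hp hpq)
  have hc₀ : (1 : ℝ) ≤ ((D + 1 : ℕ) : ℝ) * 3 ^ (D + 1) :=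
    one_le_mul_of_one_le_of_one_le (by push_cast; linarith) (one_le_pow₀ (by norm_num))
  have X : Exponents D p q (sliceExp (D + 1) p q) C (((D + 1 : ℕ) : ℝ) * 3 ^ (D + 1)) :=
    ⟨hD, hp, hq1, hq', hl0, hl1, hC, hc₀, hslice⟩
  obtain ⟨K, hK, hsup⟩ := X.exists_sup_bound
  refine ⟨K * 3 ^ (D + 1), one_le_mul_of_one_le_of_one_le hK (one_le_pow₀ (by norm_num)), ?_⟩
  intro ω hω t₀ x₀ n τ hn hτ u hpos hu
  have hn1 : 1 ≤ n := le_trans (by norm_num) hn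
  have hn0 : 0 < n := by linarith
  have hT : 0 < τ * n ^ 2 := by positivity
  simp only [cylTime, cylSpace, one_mul, mul_assoc (1 / 2 : ℝ)] at hpos hu ⊢
  have S := setting_cylExtend (q := q) hp hq1 hω hn hτ hpos hu
  have hb := smallExp_le_one (n := n) hp
  have h := hsup S (half_pow_le_smallExp hp) hb
  have hmean0 := S.meanOn_pos
  have hs1 := S.supOn_pos one_pos
  have hF := boundFactor_le_cylConst_rpow hD hp hpq X.deltaTwo_pos X.deltaTwo_lt_one.le hτ S.M_pos S.Λ_pos S.one_le
  have hF0 := one_le_boundFactor X.lam_pos X.lam_lt X.deltaTwo_pos hτ S.M_pos S.one_le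
  have e1 : supOn (cylExtend u (t₀ - τ * n ^ 2) t₀ x₀ ⌊n⌋) n τ t₀ (1 / 2) =
      cylSupNorm (Set.Icc (t₀ - 1 / 2 * (τ * n ^ 2)) t₀) (latticeBall x₀ (1 / 2 * n)) u :=
    cylSupNorm_cylExtend (by linarith) (by linarith)
  have e2 : supOn (cylExtend u (t₀ - τ * n ^ 2) t₀ x₀ ⌊n⌋) n τ t₀ 1 =
      cylSupNorm (Set.Icc (t₀ - τ * n ^ 2) t₀) (latticeBall x₀ n) u := by
    unfold supOn
    rw [one_mul, one_mul]
    exact cylSupNorm_cylExtend le_rfl le_rfl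
  -- The iteration normalizes by `n^d`, the norm in the statement by the number of sites, which is
  -- at most `3^d n^d`.
  have hmean : meanOn (cylExtend u (t₀ - τ * n ^ 2) t₀ x₀ ⌊n⌋) n τ t₀ ≤
      3 ^ (D + 1) * cylAvgL1 (Set.Icc (t₀ - τ * n ^ 2) t₀) (latticeBall x₀ n) u := by
    unfold meanOn cylAvgL1
    rw [integral_cylExtend (by linarith) hpos, latticeBall_eq_map, Finset.card_map, ← latticeBall_eq_map,
      Real.volume_real_Icc_of_le (by linarith), sub_sub_cancel]
    have hI : 0 ≤ ∫ t in Set.Icc (t₀ - τ * n ^ 2) t₀, ∑ x ∈ latticeBall x₀ n, |u t x| :=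
      MeasureTheory.setIntegral_nonneg measurableSet_Icc fun t _ => Finset.sum_nonneg fun _ _ => abs_nonneg _
    have hcp : 0 < ((cube (D + 1) ⌊n⌋).card : ℝ) := by
      exact_mod_cast Finset.card_pos.2 (cube_nonempty (Int.floor_nonneg.2 hn0.le))
    rw [← mul_assoc (3 ^ (D + 1) : ℝ), mul_one_div, div_mul_eq_mul_div, div_le_div_iff₀ (by positivity) (by positivity)]
    calc _ = (τ * n ^ 2) * (∫ t in Set.Icc (t₀ - τ * n ^ 2) t₀, ∑ x ∈ latticeBall x₀ n, |u t x|) *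
          ((cube (D + 1) ⌊n⌋).card : ℝ) := by ring
      _ ≤ (τ * n ^ 2) * (∫ t in Set.Icc (t₀ - τ * n ^ 2) t₀, ∑ x ∈ latticeBall x₀ n, |u t x|) * (3 ^ (D + 1) * n ^ (D + 1)) :=
          mul_le_mul_of_nonneg_left (card_cube_floor_le hn1) (by positivity)
      _ = _ := by ring
  rw [e1] at h
  rw [e2] at h hs1
  set s := cylSupNorm (Set.Icc (t₀ - τ * n ^ 2) t₀) (latticeBall x₀ n) u
  set L := cylAvgL1 (Set.Icc (t₀ - τ * n ^ 2) t₀) (latticeBall x₀ n) u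
  have hL : 0 ≤ L := by
    by_contra hc
    have : 3 ^ (D + 1) * L < 0 := mul_neg_of_pos_of_neg (by positivity) (not_le.1 hc)
    linarith
  have hb0 : 0 ≤ smallExp p n := (by positivity : (0:ℝ) ≤ (1 / 2) ^ stepCount (3 * n)).trans (half_pow_le_smallExp hp)
  have hmp : meanOn (cylExtend u (t₀ - τ * n ^ 2) t₀ x₀ ⌊n⌋) n τ t₀ ^ (1 - smallExp p n) ≤
      3 ^ (D + 1) * L ^ (1 - smallExp p n) :=
    (Real.rpow_le_rpow hmean0.le hmean (by linarith)).trans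
      (mul_rpow_le_mul_rpow (one_le_pow₀ (by norm_num)) hL (by linarith))
  have hc0 := (zero_le_one.trans hF0).trans hF
  refine h.trans ?_
  calc _ ≤ K * cylConst p q ω (latticeBall x₀ n) τ ^ (2 * p / (p - 1)) *
        (3 ^ (D + 1) * L ^ (1 - smallExp p n) * s ^ smallExp p n) := by
        gcongr
    _ = _ := by ring
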